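/- **Setting.** A learning problem consists of: dimension $d$, sample size $n$, even width $m$, learning rate $\eta>0$; two classes $c\in\{1,-1\}$ with core features $v_c\in\mathbb R^d$; finitely many spurious features $v_s$, $s\in\mathcal A$; all these features are pairwise orthogonal. Example $i$ has class $c_i=y_i$ and spurious feature $s_i$, and input $x_i=v_{c_i}+v_{s_i}+\xi_i$ with i.i.d. noise $\xi_i\sim N(0,\Sigma_\xi)$. Each class $c$ has a majority group, formed by its examples with spurious feature $s(c)$, where $s(1)\ne s(-1)$; its other examples are its minority groups. The features $v_c$ and $v_{s(c)}$ are nonzero eigenvectors of $\Sigma_\xi$; the eigenvalue for such a feature $v$ is denoted $\sigma_v^2$, and the noise-to-signal ratio of $v$ is $\sigma_v/\|v\|$. It has a common value $R_c$ for the two core features and a common value $R_s$ for the two majority spurious features. The network $f(x;W,z)=m^{-1/2}\sum_{r\le m} z_r\,\phi(w_r^\top x/\sqrt d)$ is trained on both layers by gradient descent with step $\eta$ on $\frac1{2n}\sum_i(f(x_i;W,z)-y_i)^2$, from the symmetric initialization in which, independently of each other and of the noise, $w_r\sim N(0,I_d)$ and $z_r\sim\mathrm{Unif}\{\pm1\}$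 for $r\le m/2$, and $w_{r+m/2}=w_r$, $z_{r+m/2}=-z_r$. The activation $\phi$ either has bounded first and second derivatives, or is $\phi(z)=z$ for $z\ge0$ and $\phi(z)=az$ for $z<0$. For $g\sim N(0,1)$ put $\zeta=\mathbb E\phi'(g)$, $\vartheta_0=\mathbb E\phi(g)$, $\vartheta_1=\mathbb E[g\phi'(g)]$, $\vartheta_2=\mathbb E[(\frac12g^3-g)\phi'(g)]$; assume $\zeta\neq0$, and that $\vartheta_0\ne0$ or $\vartheta_1=\vartheta_2=0$. Let $\Sigma$ be the covariance matrix of the data set, $\nu=\vartheta_1\sqrt{\mathrm{Tr}(\Sigma^2)/d}$, and $$\psi(x)=\Big(\sqrt{\tfrac2d}\,\zeta x,\ \sqrt{\tfrac3{2d}}\,\nu,\ \vartheta_0+\vartheta_1(\tfrac{\|x\|}{\sqrt d}-1)+\vartheta_2(\tfrac{\|x\|}{\sqrt d}-1)^2\Big),\qquad f^{lin}(x;\beta)=\psi(x)^\top\beta .$$ Let $\beta_t$ be the gradient descent iterates, with step $\eta$ and $\beta_0=0$, of the linear model $f^{lin}$ for the same square loss. **Assumptions.** Fix $\alpha\in(0,\frac14)$,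 $\gamma>0$ and positive constants $c_0,\kappa,a,K$. Consider a sequence of problems with $d\to\infty$; "with high probability" means with probability tending to $1$. Suppose: 1. $d^{1+\alpha}\le Kn$, $d^{1+\alpha}\le Km$, $n\le Kd^K$; $\eta/d\to0$ and $\eta\vartheta_0^2\le1$. 2. The classes are balanced (of equal size), and the total size of the minority groups of each class is at most $Kn^{1-\gamma}$. 3. With high probability, $\big|\|x_i\|^2/d-1\big|\le K\sqrt{\log n/d}$ for all $i$, $|\langle x_i,x_j\rangle|/d\le K\sqrt{\log n/d}$ for all $i\ne j$, $\|XX^\top\|\le Kn$ (where $X$ has rows $x_i$), and all eigenvalues of $\Sigma$ are at least $c_0$. 4. (Simplicity bias on features.) With high probability, for all integers $0\le t\le\kappa\, d\log d/\eta$ and all $v\in\{v_1,v_{-1},v_{s(1)},v_{s(-1)}\}$, $|f^{lin}(v;\beta_t)-f(v;W_t,z_t)|\le K\eta t/d^{1+a\alpha}$. **Conclusion.** There are $\nu_2>0$ and $b>0$, depending only on $\phi,c_0,\kappa,a$, and a constant $C$, depending only on these and on $\alpha,\gamma,K$, such that at $T=\lfloor\nu_2\, d\log d/\eta\rfloor$,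 with high probability, for both classes $c$, $$|f(v_c;W_T,z_T)|\le\frac{\sqrt2R_s}{R_c}+C\big(n^{-\gamma}+d^{-b\alpha}\big).$$ Moreover, if $\min\{R_c,1\}\gg R_s$, the contribution of the spurious feature dominates: for every $M>0$ there is $\rho>0$, depending only on $M$, such that if $R_s\le\rho\min\{R_c,1\}$ along the sequence, then with high probability, for both classes $c$, $|f(v_{s(c)};W_T,z_T)|>M\,|f(v_c;W_T,z_T)|$. -/

import Mathlib

open MeasureTheory ProbabilityTheory Filter Topology
open scoped BigOperators Matrix Matrix.Norms.L2Operator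

noncomputable section

namespace SpuriousNet

/-! ### Activation functions -/

/-- Admissible activations: smooth with bounded first and second derivative, or piecewise linear
with slope `1` on `[0, ∞)` and slope `a` on `(-∞, 0)`. -/
def IsActivation (φ : ℝ → ℝ) : Prop :=
  (Differentiable ℝ φ ∧ Differentiable ℝ (deriv φ) ∧
      ∃ B : ℝ, ∀ z, |deriv φ z| ≤ B ∧ |deriv (deriv φ) z| ≤ B) ∨
    ∃ a : ℝ, ∀ z, φ z = if 0 ≤ z then z else a * z

/-- `ζ = 𝔼[φ'(g)]`, `g ∼ N(0,1)`. -/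
def zeta (φ : ℝ → ℝ) : ℝ := ∫ g, deriv φ g ∂(gaussianReal 0 1)

/-- `ϑ₀ = 𝔼[φ(g)]`. -/
def theta0 (φ : ℝ → ℝ) : ℝ := ∫ g, φ g ∂(gaussianReal 0 1)

/-- `ϑ₁ = 𝔼[g φ'(g)]`. -/
def theta1 (φ : ℝ → ℝ) : ℝ := ∫ g, g * deriv φ g ∂(gaussianReal 0 1)

/-- `ϑ₂ = 𝔼[(g³/2 - g) φ'(g)]`. -/
def theta2 (φ : ℝ → ℝ) : ℝ := ∫ g, (g ^ 3 / 2 - g) * deriv φ g ∂(gaussianReal 0 1)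

/-! ### Two-layer network and its gradient descent -/

/-- Parameters of a two-layer network with input dimension `d` and `m = 2h` hidden neurons
(the neurons are indexed by two copies of `Fin h`, which are used by the symmetric
initialization). -/
structure Weights (d h : ℕ) where
  W : Fin h ⊕ Fin h → EuclideanSpace ℝ (Fin d)
  z : Fin h ⊕ Fin h → ℝ

/-- `f(x; W, z) = m^{-1/2} ∑_r z_r φ(⟨w_r, x⟩ / √d)`, `m = 2h`. -/
def netOut (φ : ℝ → ℝ) {d h : ℕ} (θ : Weights d h) (x : EuclideanSpace ℝ (Fin d)) : ℝ :=
  1 / √(2 * h : ℝ) * ∑ r, θ.z r * φ (inner ℝ (θ.W r) x / √(d : ℝ))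

/-- One step of gradient descent, on both layers, for the loss
`(2n)⁻¹ ∑ i, (f(x_i; W, z) - y_i)²`. The gradient is written out by the chain rule; at a kink of a
piecewise linear activation the value `deriv φ 0` (zero, unless `φ` is linear) is used. -/
def netStep (φ : ℝ → ℝ) {d h n : ℕ} (η : ℝ) (x : Fin n → EuclideanSpace ℝ (Fin d))
    (y : Fin n → ℝ) (θ : Weights d h) : Weights d h where
  W r := θ.W r - η • ((1 / (n : ℝ)) • ∑ i, ((netOut φ θ (x i) - y i) *
    (1 / √(2 * h : ℝ) * θ.z r * deriv φ (inner ℝ (θ.W r) (x i) / √(d : ℝ)) / √(d : ℝ))) • x i)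
  z r := θ.z r - η * (1 / (n : ℝ) * ∑ i, (netOut φ θ (x i) - y i) *
    (1 / √(2 * h : ℝ) * φ (inner ℝ (θ.W r) (x i) / √(d : ℝ))))

/-- The network weights after `t` steps of gradient descent started at `θ₀`. -/
def netGD (φ : ℝ → ℝ) {d h n : ℕ} (η : ℝ) (x : Fin n → EuclideanSpace ℝ (Fin d))
    (y : Fin n → ℝ) (θ₀ : Weights d h) (t : ℕ) : Weights d h :=
  (netStep φ η x y)^[t] θ₀

/-! ### Data matrices and the linear model on transformed data -/

/-- The data matrix `X`, whose `i`-th row is `x_i`. -/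
def dataMatrix {d n : ℕ} (x : Fin n → EuclideanSpace ℝ (Fin d)) : Matrix (Fin n) (Fin d) ℝ :=
  Matrix.of fun i j => x i j

/-- The covariance matrix `Σ = n⁻¹ ∑ i, (x_i - x̄)(x_i - x̄)ᵀ` of a data set. -/
def dataCov {d n : ℕ} (x : Fin n → EuclideanSpace ℝ (Fin d)) : Matrix (Fin d) (Fin d) ℝ :=
  let mean : EuclideanSpace ℝ (Fin d) := (1 / (n : ℝ)) • ∑ i, x i
  (1 / (n : ℝ)) • ∑ i, Matrix.vecMulVec (x i - mean).ofLp (x i - mean).ofLp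

/-- The transformed input `ψ(x) ∈ ℝ^{d+2}`: the rescaled input `√(2/d) ζ x`, the bias coordinate
`√(3/(2d)) ν` with `ν = ϑ₁ √(Tr(S²)/d)`, and the norm coordinate
`ϑ₀ + ϑ₁ (‖x‖/√d - 1) + ϑ₂ (‖x‖/√d - 1)²`. Here `S` is the covariance of the training data. -/
def psi (φ : ℝ → ℝ) {d : ℕ} (S : Matrix (Fin d) (Fin d) ℝ) (x : EuclideanSpace ℝ (Fin d)) :
    Fin d ⊕ Fin 2 → ℝ :=
  Sum.elim (fun j => √(2 / d : ℝ) * zeta φ * x j)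
    ![√(3 / (2 * d) : ℝ) * (theta1 φ * √((S ^ 2).trace / d)),
      theta0 φ + theta1 φ * (‖x‖ / √(d : ℝ) - 1) + theta2 φ * (‖x‖ / √(d : ℝ) - 1) ^ 2]

/-- The linear model `f^lin(x; β) = ψ(x)ᵀ β`. -/
def linOut (φ : ℝ → ℝ) {d : ℕ} (S : Matrix (Fin d) (Fin d) ℝ) (β : Fin d ⊕ Fin 2 → ℝ)
    (x : EuclideanSpace ℝ (Fin d)) : ℝ :=
  psi φ S x ⬝ᵥ β

/-- The matrix `Ψ` with rows `ψ(x_i)`. -/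
def psiMatrix (φ : ℝ → ℝ) {d n : ℕ} (x : Fin n → EuclideanSpace ℝ (Fin d)) :
    Matrix (Fin n) (Fin d ⊕ Fin 2) ℝ :=
  Matrix.of fun i => psi φ (dataCov x) (x i)

/-- Gradient descent for the linear model from `β(0) = 0`:
`β(t+1) = β(t) - (η/n) Ψᵀ (Ψ β(t) - y)`. -/
def linGD (φ : ℝ → ℝ) {d n : ℕ} (η : ℝ) (x : Fin n → EuclideanSpace ℝ (Fin d))
    (y : Fin n → ℝ) (t : ℕ) : Fin d ⊕ Fin 2 → ℝ :=
  (fun β => β - (η / n) • ((psiMatrix φ x)ᵀ *ᵥ (psiMatrix φ x *ᵥ β - y)))^[t] 0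

/-! ### Core and spurious features, groups -/

/-- The standard deviation of noise with covariance `S` along the feature `v`. -/
def featureStd {d : ℕ} (S : Matrix (Fin d) (Fin d) ℝ) (v : EuclideanSpace ℝ (Fin d)) : ℝ :=
  √(v.ofLp ⬝ᵥ (S *ᵥ v.ofLp)) / ‖v‖

/-- The noise-to-signal ratio `R = σ / ‖v‖` of the feature `v`. -/
def nsr {d : ℕ} (S : Matrix (Fin d) (Fin d) ℝ) (v : EuclideanSpace ℝ (Fin d)) : ℝ :=
  featureStd S v / ‖v‖

/-- The parameters of one learning problem. The two classes are the labels `1, -1 : ℤˣ`. -/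
structure Problem where
  /-- input dimension -/
  d : ℕ
  /-- number of training examples -/
  n : ℕ
  /-- half of the network width -/
  h : ℕ
  /-- number of spurious features -/
  numSpur : ℕ
  /-- learning rate -/
  η : ℝ
  /-- core feature of each class -/
  core : ℤˣ → EuclideanSpace ℝ (Fin d)
  /-- the spurious features -/
  spurious : Fin numSpur → EuclideanSpace ℝ (Fin d)
  /-- noise covariance -/
  noiseCov : Matrix (Fin d) (Fin d) ℝ
  /-- class of each training example -/
  label : Fin n → ℤˣ
  /-- spurious feature of each training example -/
  spur : Fin n → Fin numSpur
  /-- spurious feature of the majority group of each class -/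
  maj : ℤˣ → Fin numSpur

namespace Problem

variable (P : Problem)

/-- The network width `m`. -/
def m : ℕ := 2 * P.h

/-- The group `g_{c,s}` of training examples. -/
def group (c : ℤˣ) (s : Fin P.numSpur) : Finset (Fin P.n) :=
  {i | P.label i = c ∧ P.spur i = s}

/-- The number `n_c` of training examples in class `c`. -/
def classSize (c : ℤˣ) : ℕ := ∑ s, (P.group c s).card

/-- The total size of the minority groups of class `c`. -/
def minoritySize (c : ℤˣ) : ℕ := ∑ s ∈ {s | s ≠ P.maj c}, (P.group c s).card

/-- All features, core and spurious. -/
def feature : ℤˣ ⊕ Fin P.numSpur → EuclideanSpace ℝ (Fin P.d) := Sum.elim P.core P.spurious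

/-- `R_c`, the noise-to-signal ratio of the core feature of class `c`. -/
def Rc (c : ℤˣ) : ℝ := nsr P.noiseCov (P.core c)

/-- `R_s`, the noise-to-signal ratio of the spurious feature of the majority group of class `c`. -/
def Rs (c : ℤˣ) : ℝ := nsr P.noiseCov (P.spurious (P.maj c))

/-- The deterministic assumptions on a learning problem. -/
structure Valid : Prop where
  eta_pos : 0 < P.η
  noise_psd : P.noiseCov.PosSemidef
  orthogonal : Pairwise fun a b => inner ℝ (P.feature a) (P.feature b) = 0
  core_ne_zero : ∀ c, P.core c ≠ 0
  maj_ne_zero : ∀ c, P.spurious (P.maj c) ≠ 0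
  /-- the noise along a core feature is uncorrelated with the noise in orthogonal directions -/
  core_eigen : ∀ c, P.noiseCov *ᵥ (P.core c).ofLp =
    featureStd P.noiseCov (P.core c) ^ 2 • (P.core c).ofLp
  /-- the same for the spurious features of the majority groups -/
  maj_eigen : ∀ c, P.noiseCov *ᵥ (P.spurious (P.maj c)).ofLp =
    featureStd P.noiseCov (P.spurious (P.maj c)) ^ 2 • (P.spurious (P.maj c)).ofLp
  Rc_eq : P.Rc 1 = P.Rc (-1)
  Rs_eq : P.Rs 1 = P.Rs (-1)
  /-- the majority groups of the two classes have different spurious features -/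
  maj_ne : P.maj 1 ≠ P.maj (-1)
  balanced : P.classSize 1 = P.classSize (-1)

/-! ### Randomness: noise and initialization -/

/-- A sample: the noise vectors `ξ_i`, and the first half of the initial weights of each layer. -/
abbrev Sample : Type :=
  (Fin P.n → EuclideanSpace ℝ (Fin P.d)) ×
    (Fin P.h → EuclideanSpace ℝ (Fin P.d)) × (Fin P.h → ℝ)

/-- Independent `ξ_i ∼ N(0, Σ_ξ)`, `w_r ∼ N(0, I)`, `z_r ∼ Unif{-1, 1}`. -/
def law : Measure P.Sample :=
  (Measure.pi fun _ => multivariateGaussian 0 P.noiseCov).prod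
    ((Measure.pi fun _ => stdGaussian (EuclideanSpace ℝ (Fin P.d))).prod
      (Measure.pi fun _ => uniformOn ({1, -1} : Set ℝ)))

/-- The training inputs `x_i = v_c + v_s + ξ_i`. -/
def input (ω : P.Sample) (i : Fin P.n) : EuclideanSpace ℝ (Fin P.d) :=
  P.core (P.label i) + P.spurious (P.spur i) + ω.1 i

/-- The training labels as real numbers. -/
def y (i : Fin P.n) : ℝ := ((P.label i : ℤ) : ℝ)

/-- Symmetric initialization: the second half of the neurons copies the first-layer weights of the
first half and negates their second-layer weights. -/
def init (ω : P.Sample) : Weights P.d P.h where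
  W := Sum.elim ω.2.1 ω.2.1
  z := Sum.elim ω.2.2 (fun r => -ω.2.2 r)

/-- `f(v; W_t, z_t)`: the output on `v` of the network trained for `t` steps. -/
def net (φ : ℝ → ℝ) (ω : P.Sample) (t : ℕ) (v : EuclideanSpace ℝ (Fin P.d)) : ℝ :=
  netOut φ (netGD φ P.η (P.input ω) P.y (P.init ω) t) v

/-- `f^lin(v; β_t)`: the output on `v` of the linear model trained for `t` steps. -/
def lin (φ : ℝ → ℝ) (ω : P.Sample) (t : ℕ) (v : EuclideanSpace ℝ (Fin P.d)) : ℝ :=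
  linOut φ (dataCov (P.input ω)) (linGD φ P.η (P.input ω) P.y t) v

/-- The input distribution assumption, with constants `K` and `c₀`. -/
def InputRegular (K c₀ : ℝ) (ω : P.Sample) : Prop :=
  (∀ i, |‖P.input ω i‖ ^ 2 / P.d - 1| ≤ K * √(Real.log P.n / P.d)) ∧
  (∀ i j, i ≠ j → |inner ℝ (P.input ω i) (P.input ω j)| / P.d ≤ K * √(Real.log P.n / P.d)) ∧
  ‖dataMatrix (P.input ω) * (dataMatrix (P.input ω))ᵀ‖ ≤ K * P.n ∧
  (dataCov (P.input ω) - c₀ • (1 : Matrix (Fin P.d) (Fin P.d) ℝ)).PosSemidef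

/-- Simplicity bias on features, with constants `κ`, `a`, `K`: up to time `κ d log d / η`, the
network and the linear model differ by at most `K η t / d^{1 + a α}` on the core features and on
the spurious features of the majority groups. -/
def SimplicityBias (φ : ℝ → ℝ) (κ a α K : ℝ) (ω : P.Sample) : Prop :=
  ∀ t : ℕ, (t : ℝ) ≤ κ * (P.d * Real.log P.d / P.η) → ∀ c : ℤˣ,
    |P.lin φ ω t (P.core c) - P.net φ ω t (P.core c)| ≤
        K * (P.η * t / (P.d : ℝ) ^ (1 + a * α)) ∧
    |P.lin φ ω t (P.spurious (P.maj c)) - P.net φ ω t (P.spurious (P.maj c))| ≤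
        K * (P.η * t / (P.d : ℝ) ^ (1 + a * α))

/-- The time `T = ν d log d / η`, as a number of steps. -/
def time (ν : ℝ) : ℕ := ⌊ν * (P.d * Real.log P.d / P.η)⌋₊

end Problem

/-! ### Asymptotics -/

/-- The events `E k` hold with high probability: the probability of failure tends to `0`. -/
def WithHighProbability (P : ℕ → Problem) (E : ∀ k, (P k).Sample → Prop) : Prop :=
  Tendsto (fun k => (P k).law {ω | ¬ E k ω}) atTop (𝓝 0)

/-- The asymptotic regime: a sequence of learning problems with `d → ∞`. -/
structure Regime (φ : ℝ → ℝ) (c₀ κ a α γ K : ℝ) (P : ℕ → Problem) : Prop where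
  valid : ∀ k, (P k).Valid
  d_tendsto : Tendsto (fun k => (P k).d) atTop atTop
  n_ge : ∀ k, ((P k).d : ℝ) ^ (1 + α) ≤ K * (P k).n
  n_le : ∀ k, ((P k).n : ℝ) ≤ K * ((P k).d : ℝ) ^ K
  m_ge : ∀ k, ((P k).d : ℝ) ^ (1 + α) ≤ K * (P k).m
  minority : ∀ k c, ((P k).minoritySize c : ℝ) ≤ K * ((P k).n : ℝ) ^ (1 - γ)
  /-- `η ≪ d` -/
  eta_small : Tendsto (fun k => (P k).η / (P k).d) atTop (𝓝 0)
  /-- stability of gradient descent along the constant part of the norm coordinate -/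
  eta_stable : ∀ k, (P k).η * theta0 φ ^ 2 ≤ 1
  input : WithHighProbability P fun k => (P k).InputRegular K c₀
  simplicity : WithHighProbability P fun k => (P k).SimplicityBias φ κ a α K

end SpuriousNet

end

/-! By the simplicity-bias hypothesis it is enough to find the outputs of the linear model on the
main features at T = κ d log d/η. There the linear model is nearly a stationary point of least
squares with intercept, and its values on the features solve a small explicit linear system.

Optimization. In residual form gradient descent reads r ↦ r - (η/n) ΨΨᵀ r. The relevant gradient is
Ψᵀr, not r, since n exceeds d and the residual need not vanish. On the input block the curvature is
of order c₀ζ²/d, so after κ d log d/η steps the gradient has shrunk by a power of d. The obstruction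
is that the bias coordinate and the norm coordinate are both nearly constant, so ΨᵀΨ has an almost
null direction. The bias coordinate k₀ is therefore absorbed into the norm coordinate by the factor
√(1 + k₀²/θ₀²). The modified features are well conditioned (`LinRegular.le_norm_gramOp`), and the
two Gram operators are so close (`LinRegular.gramOp_close`) that the error accumulated up to T is a
negative power of d (`residual_dynamics`, `LinRegular.residual_bounds`). A quantity that is nearly
conserved along the iteration (`bias_weight_close`) then bounds the weight of the norm coordinate by
the total intercept. Hence on the data the model is an affine predictor ⟨w, x⟩ + b up to small
errors, and on a feature it is ⟨w, v⟩ up to a multiple of |b| plus a small error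
(`linGD_nearCritical`).

Statistics. Second-moment concentration of the noise makes sample averages behave like population
averages, with error ε of order d^(-β) + n^(-γ). Since the main features are eigenvectors of the
noise covariance, noise along a feature is uncorrelated with noise in orthogonal directions. Testing
stationarity against a feature v of class c gives ½ ρ_c ‖v‖² + σ² ⟨w, v⟩ ≈ 0, where ρ_c = ⟨w, v_c⟩ +
⟨w, v_s(c)⟩ + b - c is the mean residual on the majority group (`feature_equation`). With Q = R⁻²
for the two kinds of features, adding the two equations of a class gives (1 + (Q_c + Q_s)/2) ρ_c ≈ b
- c. The intercept equation ρ_1 + ρ_{-1} ≈ 0, or the absence of an intercept, forces b ≈ 0. Hence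
⟨w, v⟩ ≈ c Q/(2 + Q_c + Q_s), with Q that of v (`predictor_on_features`). The minority groups have
few examples, but their contribution is of order ε only because the part of w orthogonal to the
features has small mean square on the data (`sum_inner_orth_sq_le`).

Elementary estimates of Q/(2 + Q_c + Q_s) finish both claims. -/

noncomputable section

namespace SpuriousNet

/-! ### Gaussian moments -/

/-- The fourth moment of a standard Gaussian. -/
def gaussFour : ℝ := ∫ x, x ^ 4 ∂(gaussianReal 0 1)

lemma gaussFour_nonneg : 0 ≤ gaussFour := integral_nonneg fun x => by positivity

section Gaussian

variable {d : ℕ} {S : Matrix (Fin d) (Fin d) ℝ}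

lemma memLp_inner_gaussian (v : EuclideanSpace ℝ (Fin d)) (p : ENNReal) (hp : p ≠ ⊤) :
    MemLp (fun ξ : EuclideanSpace ℝ (Fin d) => inner ℝ v ξ) p (multivariateGaussian 0 S) :=
  IsGaussian.memLp_dual (multivariateGaussian 0 S) (innerSL ℝ v) p hp

lemma integral_inner_gaussian (v : EuclideanSpace ℝ (Fin d)) :
    ∫ ξ, inner ℝ v ξ ∂(multivariateGaussian 0 S) = 0 := by
  rw [integral_inner IsGaussian.integrable_fun_id, integral_id_multivariateGaussian, inner_zero_right]

lemma integral_inner_mul_inner_gaussian (hS : S.PosSemidef) (u v : EuclideanSpace ℝ (Fin d)) :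
    ∫ ξ, inner ℝ u ξ * inner ℝ v ξ ∂(multivariateGaussian 0 S) = u.ofLp ⬝ᵥ (S *ᵥ v.ofLp) := by
  have h := covarianceBilin_multivariateGaussian (μ := 0) hS u v
  rw [covarianceBilin_apply_eq_cov IsGaussian.memLp_two_id,
    covariance_eq_sub (memLp_inner_gaussian u 2 (by simp)) (memLp_inner_gaussian v 2 (by simp)),
    integral_inner_gaussian, integral_inner_gaussian] at h
  simpa using h

lemma map_inner_gaussian (hS : S.PosSemidef) (v : EuclideanSpace ℝ (Fin d)) :
    (multivariateGaussian 0 S).map (fun ξ => inner ℝ v ξ) =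
      gaussianReal 0 (v.ofLp ⬝ᵥ (S *ᵥ v.ofLp)).toNNReal := by
  have h := IsGaussian.map_eq_gaussianReal (μ := multivariateGaussian 0 S) (innerSL ℝ v)
  have hm : (multivariateGaussian 0 S)[fun ξ => innerSL ℝ v ξ] = 0 := integral_inner_gaussian v
  have hv : Var[fun ξ => innerSL ℝ v ξ; multivariateGaussian 0 S] = v.ofLp ⬝ᵥ (S *ᵥ v.ofLp) := by
    rw [variance_of_integral_eq_zero (by fun_prop) hm]
    simp_rw [pow_two]
    exact integral_inner_mul_inner_gaussian hS v v
  rw [hm, hv] at h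
  exact h

lemma integral_pow_four_gaussianReal (v : NNReal) :
    ∫ x, x ^ 4 ∂(gaussianReal 0 v) = gaussFour * (v : ℝ) ^ 2 := by
  have h := gaussianReal_map_const_mul (μ := 0) (v := 1) (√(v : ℝ))
  have e : (NNReal.mk (√(v : ℝ) ^ 2) (sq_nonneg _) * 1 : NNReal) = v := by
    ext; simp
  rw [e, mul_zero] at h
  rw [← h, integral_map (by fun_prop) (by fun_prop)]
  simp_rw [mul_pow]
  have e2 : √(v : ℝ) ^ 4 = (v : ℝ) ^ 2 := by
    rw [show 4 = 2 * 2 by rfl, pow_mul, Real.sq_sqrt (NNReal.coe_nonneg v)]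
  rw [integral_const_mul, gaussFour, e2]
  ring

lemma integral_inner_pow_four_gaussian (hS : S.PosSemidef) (v : EuclideanSpace ℝ (Fin d)) :
    ∫ ξ, inner ℝ v ξ ^ 4 ∂(multivariateGaussian 0 S) =
      gaussFour * (v.ofLp ⬝ᵥ (S *ᵥ v.ofLp)) ^ 2 := by
  have h0 : 0 ≤ v.ofLp ⬝ᵥ (S *ᵥ v.ofLp) := by simpa using hS.dotProduct_mulVec_nonneg v.ofLp
  have h := integral_pow_four_gaussianReal (v.ofLp ⬝ᵥ (S *ᵥ v.ofLp)).toNNReal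
  rw [Real.coe_toNNReal _ h0, ← map_inner_gaussian hS v, integral_map (by fun_prop) (by fun_prop)] at h
  exact h

lemma memLp_inner_mul_inner_gaussian (u v : EuclideanSpace ℝ (Fin d)) :
    MemLp (fun ξ => inner ℝ u ξ * inner ℝ v ξ) 2 (multivariateGaussian 0 S) := by
  have : ENNReal.HolderTriple 4 4 2 := ⟨by
    rw [← ENNReal.toReal_eq_toReal_iff' (by simp) (by simp)]
    rw [ENNReal.toReal_add (by simp) (by simp)]; simp; norm_num⟩
  exact (memLp_inner_gaussian v 4 (by simp)).mul (memLp_inner_gaussian u 4 (by simp))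

/-- Cauchy–Schwarz reduces the mixed moment to fourth moments of one-dimensional Gaussians. Only
finiteness of the fourth-moment constant matters below, so its value is never computed. -/
lemma integral_inner_sq_mul_inner_sq_gaussian_le (hS : S.PosSemidef)
    (u v : EuclideanSpace ℝ (Fin d)) :
    ∫ ξ, (inner ℝ u ξ * inner ℝ v ξ) ^ 2 ∂(multivariateGaussian 0 S) ≤
      gaussFour * ((u.ofLp ⬝ᵥ (S *ᵥ u.ofLp)) * (v.ofLp ⬝ᵥ (S *ᵥ v.ofLp))) := by
  have hu : 0 ≤ u.ofLp ⬝ᵥ (S *ᵥ u.ofLp) := by simpa using hS.dotProduct_mulVec_nonneg u.ofLp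
  have hv : 0 ≤ v.ofLp ⬝ᵥ (S *ᵥ v.ofLp) := by simpa using hS.dotProduct_mulVec_nonneg v.ofLp
  have m (w : EuclideanSpace ℝ (Fin d)) : MemLp (fun ξ => inner ℝ w ξ ^ 2)
      (ENNReal.ofReal 2) (multivariateGaussian 0 S) := by
    have := memLp_inner_mul_inner_gaussian (S := S) w w
    simpa [pow_two] using this
  have h := integral_mul_le_Lp_mul_Lq_of_nonneg (μ := multivariateGaussian 0 S)
    Real.HolderConjugate.two_two
    (ae_of_all _ fun ξ => sq_nonneg (inner ℝ u ξ)) (ae_of_all _ fun ξ => sq_nonneg (inner ℝ v ξ))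
    (m u) (m v)
  have e (w : EuclideanSpace ℝ (Fin d)) (hw : 0 ≤ w.ofLp ⬝ᵥ (S *ᵥ w.ofLp)) :
      (∫ ξ, (inner ℝ w ξ ^ 2) ^ (2 : ℝ) ∂(multivariateGaussian 0 S)) ^ (1 / (2 : ℝ)) =
      √gaussFour * (w.ofLp ⬝ᵥ (S *ᵥ w.ofLp)) := by
    rw [← Real.sqrt_eq_rpow]
    have h1 : √(gaussFour * (w.ofLp ⬝ᵥ (S *ᵥ w.ofLp)) ^ 2) =
        √gaussFour * (w.ofLp ⬝ᵥ (S *ᵥ w.ofLp)) := by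
      rw [Real.sqrt_mul gaussFour_nonneg, Real.sqrt_sq hw]
    refine Eq.trans ?_ h1
    rw [← integral_inner_pow_four_gaussian hS]
    congr 2; ext ξ; rw [Real.rpow_two]; ring
  rw [e u hu, e v hv] at h
  calc _ = ∫ ξ, inner ℝ u ξ ^ 2 * inner ℝ v ξ ^ 2 ∂(multivariateGaussian 0 S) := by
        simp_rw [mul_pow]
    _ ≤ _ := h
    _ = (√gaussFour * √gaussFour) *
        ((u.ofLp ⬝ᵥ (S *ᵥ u.ofLp)) * (v.ofLp ⬝ᵥ (S *ᵥ v.ofLp))) := by ring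
    _ = _ := by rw [Real.mul_self_sqrt gaussFour_nonneg]

end Gaussian

/-! ### Second moment concentration for sums of independent vectors -/

/-- Markov's inequality at the level `B * W`. When `W = 0` the level is zero and Markov says
nothing, but then the function vanishes almost everywhere. -/
lemma measure_not_le_le_of_integral_le {Ω : Type*} [MeasurableSpace Ω] {μ : Measure Ω}
    [IsFiniteMeasure μ] {f : Ω → ℝ} (hf : ∀ ω, 0 ≤ f ω) (hi : Integrable f μ) {B W : ℝ}
    (hW : ∫ ω, f ω ∂μ ≤ W) (hB : 0 < B) :
    μ {ω | ¬ f ω ≤ B * W} ≤ ENNReal.ofReal (1 / B) := by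
  have h0 : 0 ≤ ∫ ω, f ω ∂μ := integral_nonneg hf
  rcases (h0.trans hW).eq_or_lt with h | h
  · have : f =ᵐ[μ] 0 := (integral_eq_zero_iff_of_nonneg hf hi).1 (le_antisymm (h ▸ hW) h0)
    have : μ {ω | ¬ f ω ≤ B * W} = 0 := by
      rw [← h, mul_zero]
      refine measure_mono_null (fun ω hω => ?_) (ae_iff.1 this)
      exact fun h => hω (le_of_eq h)
    rw [this]
    exact zero_le
  · have := mul_meas_ge_le_integral_of_nonneg (ae_of_all _ hf) hi (B * W)
    have h2 : μ.real {ω | B * W ≤ f ω} ≤ 1 / B := by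
      rw [le_div_iff₀ hB]
      have h3 : (μ.real {ω | B * W ≤ f ω} * B) * W ≤ 1 * W := by nlinarith
      exact le_of_mul_le_mul_right h3 h
    calc μ {ω | ¬ f ω ≤ B * W} ≤ μ {ω | B * W ≤ f ω} :=
          measure_mono fun ω hω => (not_le.1 hω).le
      _ = ENNReal.ofReal (μ.real {ω | B * W ≤ f ω}) := by simp [measureReal_def]
      _ ≤ _ := ENNReal.ofReal_le_ofReal h2

/-- Chebyshev for all coordinates at once: the variance of a sum of independent terms is additive,
and Markov is applied to the sum over `a` of the squared deviations. This controls a vector norm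
without a union bound over coordinates. -/
lemma pi_sum_concentration {E α : Type*} [MeasurableSpace E] [Fintype α] {μ : Measure E}
    [IsProbabilityMeasure μ] {n : ℕ} (I : Finset (Fin n)) (F : α → E → ℝ) (hF : ∀ a, MemLp (F a) 2 μ)
    {V : ℝ} (hV : ∑ a, ∫ ξ, F a ξ ^ 2 ∂μ ≤ V) {B : ℝ} (hB : 0 < B) :
    (Measure.pi fun _ : Fin n => μ)
      {ω | ¬ ∑ a, (∑ i ∈ I, (F a (ω i) - ∫ ξ, F a ξ ∂μ)) ^ 2 ≤ B * (n * V)} ≤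
      ENNReal.ofReal (1 / B) := by
  set μn := Measure.pi fun _ : Fin n => μ
  -- Terms outside `I` are replaced by zero so that the variance formula for a full product over
  -- `Fin n` applies.
  let X (a : α) (i : Fin n) (ξ : E) : ℝ := if i ∈ I then F a ξ - ∫ ξ, F a ξ ∂μ else 0
  have hX a i : MemLp (X a i) 2 μ := by
    by_cases h : i ∈ I
    · simp only [X, h, if_true]; exact (hF a).sub (memLp_const _)
    · simp only [X, h, if_false]; exact MemLp.zero
  have hXm a i : MemLp (fun ω : Fin n → E => X a i (ω i)) 2 μn :=
    (hX a i).comp_measurePreserving (measurePreserving_eval _ i)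
  have hsum a (ω : Fin n → E) : ∑ i ∈ I, (F a (ω i) - ∫ ξ, F a ξ ∂μ) =
      (∑ i, fun ω : Fin n → E => X a i (ω i)) ω := by
    simp only [X, Finset.sum_apply]
    rw [Finset.sum_ite_mem, Finset.univ_inter]
  have hmean a i : ∫ ξ, X a i ξ ∂μ = 0 := by
    by_cases h : i ∈ I
    · simp only [X, h, if_true]
      rw [integral_sub ((hF a).integrable (by norm_num)) (integrable_const _)]
      simp
    · simp [X, h]
  have hL a : MemLp (∑ i, fun ω : Fin n → E => X a i (ω i)) 2 μn :=
    memLp_finsetSum' _ fun i _ => hXm a i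
  have hvar a : ∫ ω, (∑ i, fun ω : Fin n → E => X a i (ω i)) ω ^ 2 ∂μn ≤
      n * ∫ ξ, F a ξ ^ 2 ∂μ := by
    have hm : ∫ ω, (∑ i, fun ω : Fin n → E => X a i (ω i)) ω ∂μn = 0 := by
      simp only [Finset.sum_apply]
      rw [integral_finsetSum _ fun i _ => (hXm a i).integrable (by norm_num)]
      refine Finset.sum_eq_zero fun i _ => ?_
      rw [integral_comp_eval (μ := fun _ => μ) (i := i) (f := X a i) (hX a i).1, hmean]
    rw [← variance_of_integral_eq_zero (hL a).1.aemeasurable hm,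
      variance_sum_pi (μ := fun _ => μ) (X := fun i => X a i) (hX a)]
    have : ∀ i ∈ Finset.univ, Var[X a i; μ] ≤ ∫ ξ, F a ξ ^ 2 ∂μ := by
      intro i _
      by_cases h : i ∈ I
      · simp only [X, h, if_true]
        rw [variance_sub_const (hF a).1, variance_eq_sub (hF a)]
        have := sq_nonneg (∫ ξ, F a ξ ∂μ)
        simp only [Pi.pow_apply]
        linarith
      · rw [variance_of_integral_eq_zero (hX a i).1.aemeasurable (hmean a i)]
        simp only [X, h, if_false]
        simp
        exact integral_nonneg fun _ => sq_nonneg _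
    simpa using Finset.sum_le_sum this
  simp_rw [hsum]
  refine measure_not_le_le_of_integral_le (fun ω => by positivity)
    (integrable_finsetSum _ fun a _ => (hL a).integrable_sq) ?_ hB
  rw [integral_finsetSum _ fun a _ => (hL a).integrable_sq]
  calc _ ≤ ∑ a, n * ∫ ξ, F a ξ ^ 2 ∂μ := Finset.sum_le_sum fun a _ => hvar a
    _ = n * ∑ a, ∫ ξ, F a ξ ^ 2 ∂μ := by rw [Finset.mul_sum]
    _ ≤ _ := by gcongr

section NoiseSums

variable {d n : ℕ} {S : Matrix (Fin d) (Fin d) ℝ}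

lemma inner_single_eq (ξ : EuclideanSpace ℝ (Fin d)) (a : Fin d) :
    inner ℝ (EuclideanSpace.single a (1 : ℝ)) ξ = ξ a := by
  simp [EuclideanSpace.inner_single_left]

lemma single_quadForm (S : Matrix (Fin d) (Fin d) ℝ) (a : Fin d) (v : Fin d → ℝ) :
    (EuclideanSpace.single a (1 : ℝ)).ofLp ⬝ᵥ (S *ᵥ v) = (S *ᵥ v) a := by
  simp

lemma single_quadForm_single (S : Matrix (Fin d) (Fin d) ℝ) (a : Fin d) :
    (EuclideanSpace.single a (1 : ℝ)).ofLp ⬝ᵥ (S *ᵥ (EuclideanSpace.single a (1 : ℝ)).ofLp) =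
      S a a := by
  simp

/-- A sum of independent Gaussian noise vectors is small. -/
lemma noise_sum_concentration (hS : S.PosSemidef) (I : Finset (Fin n)) {B : ℝ} (hB : 0 < B) :
    (Measure.pi fun _ : Fin n => multivariateGaussian 0 S)
      {ξ | ¬ ‖∑ i ∈ I, ξ i‖ ^ 2 ≤ B * (n * S.trace)} ≤ ENNReal.ofReal (1 / B) := by
  have hL (a : Fin d) : MemLp (fun ξ : EuclideanSpace ℝ (Fin d) => ξ a) 2
      (multivariateGaussian 0 S) := by
    simpa only [inner_single_eq] using memLp_inner_gaussian (S := S) (EuclideanSpace.single a 1) 2 (by simp)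
  have hm (a : Fin d) : ∫ ξ : EuclideanSpace ℝ (Fin d), ξ a ∂(multivariateGaussian 0 S) = 0 := by
    simpa only [inner_single_eq] using integral_inner_gaussian (S := S) (EuclideanSpace.single a 1)
  have h2 (a : Fin d) : ∫ ξ : EuclideanSpace ℝ (Fin d), ξ a ^ 2 ∂(multivariateGaussian 0 S) =
      S a a := by
    have := integral_inner_mul_inner_gaussian hS (EuclideanSpace.single a 1)
      (EuclideanSpace.single a 1)
    rw [single_quadForm_single] at this
    simpa only [inner_single_eq, ← pow_two] using this
  have := pi_sum_concentration I (fun a (ξ : EuclideanSpace ℝ (Fin d)) => ξ a) hL (V := S.trace)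
    (by simp_rw [h2]; rfl) hB
  refine le_trans (measure_mono fun ξ hξ => ?_) this
  simp only [Set.mem_ofPred_eq, hm, sub_zero] at hξ ⊢
  convert hξ using 2
  rw [EuclideanSpace.norm_sq_eq]
  simp

/-- The empirical covariance of Gaussian noise with its component along `v` is close to the
population covariance. -/
lemma noise_cov_concentration (hS : S.PosSemidef) (I : Finset (Fin n))
    (v : EuclideanSpace ℝ (Fin d)) {B : ℝ} (hB : 0 < B) :
    (Measure.pi fun _ : Fin n => multivariateGaussian 0 S)
      {ξ | ¬ ‖∑ i ∈ I, (inner ℝ v (ξ i) • ξ i - WithLp.toLp 2 (S *ᵥ v.ofLp))‖ ^ 2 ≤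
        B * (n * (gaussFour * (S.trace * (v.ofLp ⬝ᵥ (S *ᵥ v.ofLp)))))} ≤
      ENNReal.ofReal (1 / B) := by
  have hL (a : Fin d) : MemLp (fun ξ : EuclideanSpace ℝ (Fin d) => ξ a * inner ℝ v ξ) 2
      (multivariateGaussian 0 S) := by
    simpa only [inner_single_eq] using
      memLp_inner_mul_inner_gaussian (S := S) (EuclideanSpace.single a 1) v
  have hm (a : Fin d) : ∫ ξ : EuclideanSpace ℝ (Fin d), ξ a * inner ℝ v ξ
      ∂(multivariateGaussian 0 S) = (S *ᵥ v.ofLp) a := by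
    rw [← single_quadForm]
    simpa only [inner_single_eq] using
      integral_inner_mul_inner_gaussian hS (EuclideanSpace.single a 1) v
  have h2 (a : Fin d) : ∫ ξ : EuclideanSpace ℝ (Fin d), (ξ a * inner ℝ v ξ) ^ 2
      ∂(multivariateGaussian 0 S) ≤ gaussFour * (S a a * (v.ofLp ⬝ᵥ (S *ᵥ v.ofLp))) := by
    have := integral_inner_sq_mul_inner_sq_gaussian_le hS (EuclideanSpace.single a 1) v
    rw [single_quadForm_single] at this
    simpa only [inner_single_eq] using this
  have := pi_sum_concentration I (fun a (ξ : EuclideanSpace ℝ (Fin d)) => ξ a * inner ℝ v ξ) hL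
    (V := gaussFour * (S.trace * (v.ofLp ⬝ᵥ (S *ᵥ v.ofLp))))
    (by
      refine (Finset.sum_le_sum fun a _ => h2 a).trans (le_of_eq ?_)
      rw [← Finset.mul_sum, ← Finset.sum_mul]; rfl) hB
  refine le_trans (measure_mono fun ξ hξ => ?_) this
  simp only [Set.mem_ofPred_eq, hm] at hξ ⊢
  convert hξ using 2
  rw [EuclideanSpace.norm_sq_eq]
  refine Finset.sum_congr rfl fun a _ => ?_
  rw [Real.norm_eq_abs, sq_abs]
  simp only [WithLp.ofLp_sum, Finset.sum_apply, WithLp.ofLp_sub, WithLp.ofLp_smul, Pi.sub_apply,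
    Pi.smul_apply, smul_eq_mul]
  congr 1
  refine Finset.sum_congr rfl fun i _ => by ring

/-- The total squared length of Gaussian noise vectors concentrates around its mean. -/
lemma noise_normSq_concentration (hS : S.PosSemidef) (I : Finset (Fin n)) {B : ℝ} (hB : 0 < B) :
    (Measure.pi fun _ : Fin n => multivariateGaussian 0 S)
      {ξ | ¬ (∑ i ∈ I, (‖ξ i‖ ^ 2 - S.trace)) ^ 2 ≤ B * (n * (gaussFour * S.trace ^ 2))} ≤
      ENNReal.ofReal (1 / B) := by
  have hLa (a : Fin d) : MemLp (fun ξ : EuclideanSpace ℝ (Fin d) => ξ a ^ 2) 2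
      (multivariateGaussian 0 S) := by
    simpa only [inner_single_eq, ← pow_two] using
      memLp_inner_mul_inner_gaussian (S := S) (EuclideanSpace.single a 1) (EuclideanSpace.single a 1)
  have hab (a b : Fin d) : ∫ ξ : EuclideanSpace ℝ (Fin d), ξ a ^ 2 * ξ b ^ 2
      ∂(multivariateGaussian 0 S) ≤ gaussFour * (S a a * S b b) := by
    have := integral_inner_sq_mul_inner_sq_gaussian_le hS (EuclideanSpace.single a 1)
      (EuclideanSpace.single b 1)
    rw [single_quadForm_single, single_quadForm_single] at this
    simpa only [inner_single_eq, mul_pow] using this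
  have hnorm (ξ : EuclideanSpace ℝ (Fin d)) : ‖ξ‖ ^ 2 = ∑ a, ξ a ^ 2 := by
    rw [EuclideanSpace.norm_sq_eq]; simp
  have hL : MemLp (fun ξ : EuclideanSpace ℝ (Fin d) => ‖ξ‖ ^ 2) 2 (multivariateGaussian 0 S) := by
    simp_rw [hnorm]
    exact memLp_finsetSum _ fun a _ => hLa a
  have hm : ∫ ξ : EuclideanSpace ℝ (Fin d), ‖ξ‖ ^ 2 ∂(multivariateGaussian 0 S) = S.trace := by
    simp_rw [hnorm]
    rw [integral_finsetSum _ fun a _ => (hLa a).integrable (by norm_num)]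
    refine Finset.sum_congr rfl fun a _ => ?_
    have := integral_inner_mul_inner_gaussian hS (EuclideanSpace.single a 1)
      (EuclideanSpace.single a 1)
    rw [single_quadForm_single] at this
    rw [Matrix.diag_apply]
    simpa only [inner_single_eq, ← pow_two] using this
  have hi (a b : Fin d) : Integrable (fun ξ : EuclideanSpace ℝ (Fin d) => ξ a ^ 2 * ξ b ^ 2)
      (multivariateGaussian 0 S) := (hLa a).integrable_mul (hLa b)
  have h2 : ∫ ξ : EuclideanSpace ℝ (Fin d), (‖ξ‖ ^ 2) ^ 2 ∂(multivariateGaussian 0 S) ≤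
      gaussFour * S.trace ^ 2 := by
    simp_rw [hnorm, pow_two (∑ a, _), Finset.sum_mul_sum]
    rw [integral_finsetSum _ fun a _ => integrable_finsetSum _ fun b _ => hi a b]
    calc _ ≤ ∑ a, ∑ b, gaussFour * (S a a * S b b) := by
          refine Finset.sum_le_sum fun a _ => ?_
          rw [integral_finsetSum _ fun b _ => hi a b]
          exact Finset.sum_le_sum fun b _ => hab a b
      _ = _ := by
          simp_rw [← Finset.mul_sum]
          rw [Matrix.trace, pow_two, Finset.sum_mul]; rfl
  have := pi_sum_concentration I (fun (_ : Unit) (ξ : EuclideanSpace ℝ (Fin d)) => ‖ξ‖ ^ 2)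
    (fun _ => hL) (V := gaussFour * S.trace ^ 2) (by simpa using h2) hB
  simpa [hm] using this

end NoiseSums

/-! ### Events of high probability -/

section HighProbability

/-- The noise is the first factor of the product law, and the initialization factors are probability
measures. -/
lemma law_noise_le (P : Problem) (E : (Fin P.n → EuclideanSpace ℝ (Fin P.d)) → Prop) :
    P.law {ω | E ω.1} ≤ (Measure.pi fun _ => multivariateGaussian 0 P.noiseCov) {ξ | E ξ} := by
  have : IsProbabilityMeasure (uniformOn ({1, -1} : Set ℝ)) :=
    isProbabilityMeasure_uniformOn (by simp) (by simp)
  have h : {ω : P.Sample | E ω.1} = {ξ | E ξ} ×ˢ Set.univ := by ext ω; simp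
  rw [h, Problem.law, Measure.prod_prod]
  simp

lemma WithHighProbability.mono {P : ℕ → Problem} {E F : ∀ k, (P k).Sample → Prop}
    (hE : WithHighProbability P E) (h : ∀ᶠ k in atTop, ∀ ω, E k ω → F k ω) :
    WithHighProbability P F := by
  refine tendsto_of_tendsto_of_tendsto_of_le_of_le' tendsto_const_nhds hE
    (Eventually.of_forall fun _ => zero_le) ?_
  filter_upwards [h] with k hk
  exact measure_mono fun ω hω hE => hω (hk ω hE)

lemma WithHighProbability.and {P : ℕ → Problem} {E F : ∀ k, (P k).Sample → Prop}
    (hE : WithHighProbability P E) (hF : WithHighProbability P F) :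
    WithHighProbability P fun k ω => E k ω ∧ F k ω := by
  have h := hE.add hF
  rw [add_zero] at h
  refine tendsto_of_tendsto_of_tendsto_of_le_of_le tendsto_const_nhds h
    (fun _ => zero_le) fun k => ?_
  refine le_trans (measure_mono fun ω hω => ?_) (measure_union_le _ _)
  simp only [Set.mem_ofPred_eq, Set.mem_union] at hω ⊢
  tauto

lemma WithHighProbability.all {P : ℕ → Problem} {α : Type*} [Finite α]
    {E : α → ∀ k, (P k).Sample → Prop} (hE : ∀ a, WithHighProbability P (E a)) :
    WithHighProbability P fun k ω => ∀ a, E a k ω := by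
  have := Fintype.ofFinite α
  have h : Tendsto (fun k => ∑ a, (P k).law {ω | ¬ E a k ω}) atTop (𝓝 (∑ _a : α, 0)) :=
    tendsto_finsetSum _ fun a _ => hE a
  rw [Finset.sum_const_zero] at h
  refine tendsto_of_tendsto_of_tendsto_of_le_of_le tendsto_const_nhds h
    (fun _ => zero_le) fun k => ?_
  refine le_trans (measure_mono (t := ⋃ a, {ω | ¬ E a k ω}) fun ω hω => ?_)
    (measure_iUnion_fintype_le _ _)
  simpa using hω

lemma WithHighProbability.of_noise {P : ℕ → Problem}
    {E : ∀ k, (Fin (P k).n → EuclideanSpace ℝ (Fin (P k).d)) → Prop} {B : ℕ → ℝ}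
    (hB : Tendsto B atTop atTop)
    (h : ∀ k, 0 < B k → (Measure.pi fun _ => multivariateGaussian 0 (P k).noiseCov) {ξ | ¬ E k ξ} ≤
      ENNReal.ofReal (1 / B k)) :
    WithHighProbability P fun k ω => E k ω.1 := by
  have h0 : Tendsto (fun k => ENNReal.ofReal (1 / B k)) atTop (𝓝 0) := by
    have := ENNReal.tendsto_ofReal (hB.inv_tendsto_atTop)
    simpa using this
  refine tendsto_of_tendsto_of_tendsto_of_le_of_le' tendsto_const_nhds h0
    (Eventually.of_forall fun _ => zero_le) ?_
  filter_upwards [hB.eventually_gt_atTop 0] with k hk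
  exact (law_noise_le (P k) fun ξ => ¬ E k ξ).trans (h k hk)

end HighProbability

/-! ### Elementary inequalities for sums -/

lemma abs_sum_mul_le {ι : Type*} {s : Finset ι} {f g : ι → ℝ} {A B : ℝ} (hA : 0 ≤ A) (hB : 0 ≤ B)
    (hf : ∑ i ∈ s, f i ^ 2 ≤ A ^ 2) (hg : ∑ i ∈ s, g i ^ 2 ≤ B ^ 2) :
    |∑ i ∈ s, f i * g i| ≤ A * B := by
  refine abs_le_of_sq_le_sq ?_ (mul_nonneg hA hB)
  rw [mul_pow]
  exact (Finset.sum_mul_sq_le_sq_mul_sq s f g).trans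
    (mul_le_mul hf hg (Finset.sum_nonneg fun _ _ => sq_nonneg _) (sq_nonneg _))

lemma abs_inner_le_of_norm_le {E : Type*} [NormedAddCommGroup E] [InnerProductSpace ℝ E] {u v : E}
    {A B : ℝ} (hu : ‖u‖ ≤ A) (hv : ‖v‖ ≤ B) : |inner ℝ u v| ≤ A * B :=
  (abs_real_inner_le_norm u v).trans
    (mul_le_mul hu hv (norm_nonneg _) ((norm_nonneg _).trans hu))

/-! ### Regular samples -/

variable {E : Type*} [NormedAddCommGroup E] [InnerProductSpace ℝ E] {n : ℕ}

/-- Inputs with core features `v c 0` and spurious features `v c 1` of the majority groups `I c`;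
the remaining examples form `J`. -/
structure FeatureSample (E : Type*) [NormedAddCommGroup E] [InnerProductSpace ℝ E] (n : ℕ) where
  v : ℤˣ → Fin 2 → E
  σ : ℤˣ → Fin 2 → ℝ
  x : Fin n → E
  ξ : Fin n → E
  y : Fin n → ℝ
  I : ℤˣ → Finset (Fin n)
  J : Finset (Fin n)

namespace FeatureSample

/-- The sample behaves as its population up to an error `ε`. -/
structure Regular (D : FeatureSample E n) (K c₀ ε : ℝ) : Prop where
  n_pos : 0 < n
  orthogonal : ∀ c j c' j', (c, j) ≠ (c', j') → inner ℝ (D.v c j) (D.v c' j') = 0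
  v_ne : ∀ c j, D.v c j ≠ 0
  σ_nonneg : ∀ c j, 0 ≤ D.σ c j
  nsr_eq : ∀ c c' j, D.σ c j / ‖D.v c j‖ = D.σ c' j / ‖D.v c' j‖
  x_maj : ∀ c, ∀ i ∈ D.I c, D.x i = D.v c 0 + D.v c 1 + D.ξ i
  y_maj : ∀ c, ∀ i ∈ D.I c, D.y i = ((c : ℤ) : ℝ)
  y_sq : ∀ i, D.y i ^ 2 = 1
  x_min : ∀ i ∈ D.J, ∀ c j, ∃ a : ℝ, 0 ≤ a ∧ a ≤ 1 ∧
    inner ℝ (D.v c j) (D.x i) = a * ‖D.v c j‖ ^ 2 + inner ℝ (D.v c j) (D.ξ i)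
  sum_eq : ∀ f : Fin n → ℝ, ∑ i, f i = ∑ i ∈ D.I 1, f i + ∑ i ∈ D.I (-1), f i + ∑ i ∈ D.J, f i
  card_le : ∀ c, ((D.I c).card : ℝ) ≤ n / 2
  card_ge : ∀ c, (n : ℝ) / 2 - ε * n ≤ (D.I c).card
  card_J : (D.J.card : ℝ) ≤ ε * n
  noise_sum : ∀ c, ‖∑ i ∈ D.I c, D.ξ i‖ ≤ ε * n
  noise_cov : ∀ c c' j, ‖∑ i ∈ D.I c', (inner ℝ (D.v c j) (D.ξ i) • D.ξ i -
    D.σ c j ^ 2 • D.v c j)‖ ≤ ε * n * (D.σ c j * ‖D.v c j‖)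
  noise_cov_J : ∀ c j, ‖∑ i ∈ D.J, (inner ℝ (D.v c j) (D.ξ i) • D.ξ i -
    D.σ c j ^ 2 • D.v c j)‖ ≤ ε * n * (D.σ c j * ‖D.v c j‖)
  upper : ∀ u, ∑ i, inner ℝ u (D.x i) ^ 2 ≤ K * n * ‖u‖ ^ 2
  lower : ∀ u t, c₀ * n * ‖u‖ ^ 2 ≤ ∑ i, (inner ℝ u (D.x i) - t) ^ 2

variable {D : FeatureSample E n} {K c₀ ε : ℝ}

lemma sum_inner_mul_inner (s : Finset (Fin n)) (u : E) (c : ℤˣ) (j : Fin 2) :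
    ∑ i ∈ s, inner ℝ (D.v c j) (D.ξ i) * inner ℝ u (D.ξ i) =
      s.card * (D.σ c j ^ 2 * inner ℝ u (D.v c j)) +
      inner ℝ u (∑ i ∈ s, (inner ℝ (D.v c j) (D.ξ i) • D.ξ i - D.σ c j ^ 2 • D.v c j)) := by
  rw [inner_sum]
  simp only [inner_sub_right, inner_smul_right, Finset.sum_sub_distrib, Finset.sum_const,
    nsmul_eq_mul]
  ring

lemma sum_le_sum_univ (s : Finset (Fin n)) {f : Fin n → ℝ} (hf : ∀ i, 0 ≤ f i) :
    ∑ i ∈ s, f i ≤ ∑ i, f i :=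
  Finset.sum_le_sum_of_subset_of_nonneg (Finset.subset_univ _) fun i _ _ => hf i

namespace Regular

section Basic

variable (h : D.Regular K c₀ ε)
include h

lemma natCast_pos : (0 : ℝ) < n := by exact_mod_cast h.n_pos

lemma v_norm_pos (c : ℤˣ) (j : Fin 2) : 0 < ‖D.v c j‖ := norm_pos_iff.2 (h.v_ne c j)

lemma inner_v_self (c c' : ℤˣ) (j : Fin 2) :
    inner ℝ (D.v c j) (D.v c' 0 + D.v c' 1) = if c' = c then ‖D.v c j‖ ^ 2 else 0 := by
  rw [inner_add_right]
  by_cases hc : c' = c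
  · subst hc
    fin_cases j
    · simp [h.orthogonal c' 0 c' 1 (by simp)]
    · simp [h.orthogonal c' 1 c' 0 (by simp)]
  · rw [h.orthogonal c j c' 0 (by simp [Ne.symm hc]), h.orthogonal c j c' 1 (by simp [Ne.symm hc])]
    simp [hc]

lemma inner_v_x {c c' : ℤˣ} {i : Fin n} (hi : i ∈ D.I c') (j : Fin 2) :
    inner ℝ (D.v c j) (D.x i) =
      (if c' = c then ‖D.v c j‖ ^ 2 else 0) + inner ℝ (D.v c j) (D.ξ i) := by
  rw [h.x_maj c' i hi, inner_add_right, h.inner_v_self]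

/-- The empirical covariance of the noise along a feature and along `u` matches σ²⟨u, v⟩. The error
is proportional to σ‖v‖; in particular, directions orthogonal to `v` see only this error. -/
lemma abs_sum_inner_mul_inner_sub_le {s : Finset (Fin n)} (hs : (∃ c, s = D.I c) ∨ s = D.J) (u : E)
    (c : ℤˣ) (j : Fin 2) :
    |∑ i ∈ s, inner ℝ (D.v c j) (D.ξ i) * inner ℝ u (D.ξ i) -
      s.card * (D.σ c j ^ 2 * inner ℝ u (D.v c j))| ≤ ‖u‖ * (ε * n * (D.σ c j * ‖D.v c j‖)) := by
  rw [sum_inner_mul_inner, add_sub_cancel_left]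
  refine abs_inner_le_of_norm_le le_rfl ?_
  rcases hs with ⟨c', rfl⟩ | rfl
  · exact h.noise_cov c c' j
  · exact h.noise_cov_J c j

lemma abs_sum_inner_sq_sub_le {s : Finset (Fin n)} (hs : (∃ c, s = D.I c) ∨ s = D.J)
    (c : ℤˣ) (j : Fin 2) :
    |∑ i ∈ s, inner ℝ (D.v c j) (D.ξ i) ^ 2 - s.card * (D.σ c j ^ 2 * ‖D.v c j‖ ^ 2)| ≤
      ε * n * D.σ c j * ‖D.v c j‖ ^ 2 := by
  have := h.abs_sum_inner_mul_inner_sub_le hs (D.v c j) c j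
  rw [real_inner_self_eq_norm_sq] at this
  simp only [← pow_two] at this
  refine this.trans (le_of_eq ?_)
  ring

lemma eps_nonneg : 0 ≤ ε := by
  have := (norm_nonneg _).trans (h.noise_sum 1)
  exact nonneg_of_mul_nonneg_left this h.natCast_pos

lemma quarter_le_card (hε : ε ≤ 1 / 4) (c : ℤˣ) : (n : ℝ) / 4 ≤ (D.I c).card := by
  have := h.card_ge c
  have hn := h.natCast_pos
  nlinarith

/-- On the majority group of the other class the feature does not occur, so ⟨v, x⟩ is pure noise
there, and the upper bound on the second moments of the inputs bounds the noise variance. -/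
lemma σ_sq_le (hε : ε ≤ 1 / 16) (c : ℤˣ) (j : Fin 2) : D.σ c j ^ 2 ≤ 8 * K + 1 := by
  have hn := h.natCast_pos
  have hv := h.v_norm_pos c j
  have hc := h.quarter_le_card (hε.trans (by norm_num)) (-c)
  have h1 := (abs_le.1 (h.abs_sum_inner_sq_sub_le (Or.inl ⟨-c, rfl⟩) c j)).1
  have h2 : ∑ i ∈ D.I (-c), inner ℝ (D.v c j) (D.ξ i) ^ 2 ≤ K * n * ‖D.v c j‖ ^ 2 := by
    calc _ = ∑ i ∈ D.I (-c), inner ℝ (D.v c j) (D.x i) ^ 2 := by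
          refine Finset.sum_congr rfl fun i hi => ?_
          rw [h.inner_v_x hi, if_neg (by rcases Int.units_eq_one_or c with rfl | rfl <;> decide), zero_add]
      _ ≤ _ := sum_le_sum_univ _ fun i => sq_nonneg _
      _ ≤ _ := h.upper _
  have h3 : (D.I (-c)).card * D.σ c j ^ 2 * ‖D.v c j‖ ^ 2 ≤
      (K * n + ε * n * D.σ c j) * ‖D.v c j‖ ^ 2 := by linarith
  have h4 := le_of_mul_le_mul_right h3 (by positivity)
  have h5 : (n : ℝ) / 4 * D.σ c j ^ 2 ≤ (D.I (-c)).card * D.σ c j ^ 2 := by gcongr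
  have h6 : ε * n * D.σ c j ≤ 1 / 16 * n * D.σ c j := by
    have := h.σ_nonneg c j
    gcongr
  have h7 : n * (D.σ c j ^ 2 / 4) ≤ n * (K + 1 / 16 * D.σ c j) := by linarith
  have h8 := le_of_mul_le_mul_left h7 hn
  nlinarith [sq_nonneg (D.σ c j - 1)]

/-- The sum of ⟨v, x⟩ over the majority group is about |I|‖v‖². Cauchy–Schwarz and the upper bound
on second moments make it at most of order n‖v‖. -/
lemma v_norm_le (hK : 0 ≤ K) (hε : ε ≤ 1 / 4) (c : ℤˣ) (j : Fin 2) :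
    ‖D.v c j‖ ≤ 4 * √K + 1 := by
  have hn := h.natCast_pos
  have hv := h.v_norm_pos c j
  have hc := h.quarter_le_card hε c
  have h1 : ∑ i ∈ D.I c, inner ℝ (D.v c j) (D.x i) =
      (D.I c).card * ‖D.v c j‖ ^ 2 + inner ℝ (D.v c j) (∑ i ∈ D.I c, D.ξ i) := by
    rw [inner_sum, ← nsmul_eq_mul, ← Finset.sum_const, ← Finset.sum_add_distrib]
    refine Finset.sum_congr rfl fun i hi => ?_
    rw [h.inner_v_x hi, if_pos rfl]
  have h2 := (abs_le.1 (abs_inner_le_of_norm_le (le_refl ‖D.v c j‖) (h.noise_sum c))).1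
  have h3 : |∑ i ∈ D.I c, 1 * inner ℝ (D.v c j) (D.x i)| ≤ √n * (√(K * n) * ‖D.v c j‖) := by
    refine abs_sum_mul_le (by positivity) (by positivity) ?_ ?_
    · rw [Real.sq_sqrt hn.le]
      have := h.card_le c
      simp only [one_pow, Finset.sum_const, nsmul_eq_mul, mul_one]
      linarith
    · rw [mul_pow, Real.sq_sqrt (by positivity)]
      exact (sum_le_sum_univ _ fun i => sq_nonneg _).trans (h.upper _)
  simp only [one_mul] at h3
  have h4 := (abs_le.1 h3).2
  have h5 : √(n : ℝ) * (√(K * n) * ‖D.v c j‖) = n * √K * ‖D.v c j‖ := by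
    rw [Real.sqrt_mul hK]
    have := Real.mul_self_sqrt hn.le
    linear_combination √K * ‖D.v c j‖ * this
  have h6 : (n : ℝ) / 4 * ‖D.v c j‖ ^ 2 ≤ (D.I c).card * ‖D.v c j‖ ^ 2 := by gcongr
  have h7 : (n * ‖D.v c j‖) * (‖D.v c j‖ / 4) ≤ (n * ‖D.v c j‖) * (√K + ε) := by nlinarith
  have h8 := le_of_mul_le_mul_left h7 (by positivity)
  linarith

lemma sum_inner_sq_le {M : ℝ} (hσ : ∀ c j, D.σ c j ≤ M) (c : ℤˣ) (j : Fin 2) :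
    ∑ i, inner ℝ (D.v c j) (D.ξ i) ^ 2 ≤
      n * (D.σ c j ^ 2 + 3 * ε * M) * ‖D.v c j‖ ^ 2 := by
  have hn := h.natCast_pos
  have hε := h.eps_nonneg
  have h1 := (abs_le.1 (h.abs_sum_inner_sq_sub_le (Or.inl ⟨1, rfl⟩) c j)).2
  have h2 := (abs_le.1 (h.abs_sum_inner_sq_sub_le (Or.inl ⟨-1, rfl⟩) c j)).2
  have h3 := (abs_le.1 (h.abs_sum_inner_sq_sub_le (Or.inr rfl) c j)).2
  have hcard : (n : ℝ) = (D.I 1).card + (D.I (-1)).card + D.J.card := by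
    simpa using h.sum_eq fun _ => 1
  rw [h.sum_eq]
  have h4 : ε * n * D.σ c j * ‖D.v c j‖ ^ 2 ≤ ε * n * M * ‖D.v c j‖ ^ 2 := by
    gcongr; exact hσ c j
  have h5 : (n : ℝ) * (D.σ c j ^ 2 * ‖D.v c j‖ ^ 2) =
    ((D.I 1).card + (D.I (-1)).card + D.J.card) * (D.σ c j ^ 2 * ‖D.v c j‖ ^ 2) := by rw [← hcard]
  nlinarith

/-- A direction is chosen along which the signal has no variance across the majority groups: u =
v/‖v‖² + v'/‖v'‖², with v and v' the features of the same kind in the two classes, takes the value 1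
on the signal of either group. The covariance lower bound must then be paid by the noise. The common
noise-to-signal ratio turns the resulting bound on a sum over both classes into a bound for each
feature. -/
lemma le_σ_sq {M : ℝ} (hM : 1 ≤ M) (hσ : ∀ c j, D.σ c j ≤ M) (hv : ∀ c j, ‖D.v c j‖ ≤ M)
    (hε : 48 * M ^ 2 * ε ≤ c₀) (c : ℤˣ) (j : Fin 2) : c₀ / 16 ≤ D.σ c j ^ 2 := by
  have hn := h.natCast_pos
  have hε0 := h.eps_nonneg
  have hc0 : 0 ≤ c₀ := le_trans (by positivity) hε
  have p1 := h.v_norm_pos 1 j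
  have p2 := h.v_norm_pos (-1) j
  set v := D.v 1 j with hvdef
  set v' := D.v (-1) j with hvdef'
  set α := (‖v‖ ^ 2)⁻¹ with hα
  set α' := (‖v'‖ ^ 2)⁻¹ with hα'
  have a1 : α * ‖v‖ ^ 2 = 1 := inv_mul_cancel₀ (by positivity)
  have a2 : α' * ‖v'‖ ^ 2 = 1 := inv_mul_cancel₀ (by positivity)
  -- Here `α` and `α'` are ‖v‖⁻² and ‖v'‖⁻², the weights of the test direction.
  have a0 : 0 < α := by positivity
  have a0' : 0 < α' := by positivity
  have horth : inner ℝ v v' = 0 := h.orthogonal 1 j (-1) j (by simp)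
  let u := α • v + α' • v'
  have hu : ‖u‖ ^ 2 = α + α' := by
    rw [← real_inner_self_eq_norm_sq]
    simp only [u, inner_add_left, inner_add_right, inner_smul_left, inner_smul_right,
      real_inner_self_eq_norm_sq, horth, real_inner_comm v v', RCLike.conj_to_real]
    linear_combination α * a1 + α' * a2
  have hux (z : E) : inner ℝ u z = α * inner ℝ v z + α' * inner ℝ v' z := by
    simp [u, inner_add_left, inner_smul_left]
  have h1 := h.lower u 1
  have hterm : ∀ i, (inner ℝ u (D.ξ i)) ^ 2 ≤
      2 * (α ^ 2 * inner ℝ v (D.ξ i) ^ 2) + 2 * (α' ^ 2 * inner ℝ v' (D.ξ i) ^ 2) := by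
    intro i
    rw [hux]
    nlinarith [sq_nonneg (α * inner ℝ v (D.ξ i) - α' * inner ℝ v' (D.ξ i))]
  have hI : ∀ c', ∑ i ∈ D.I c', (inner ℝ u (D.x i) - 1) ^ 2 ≤
      ∑ i ∈ D.I c', 2 * (inner ℝ u (D.ξ i)) ^ 2 := by
    intro c'
    refine Finset.sum_le_sum fun i hi => ?_
    have e : inner ℝ u (D.x i) - 1 = inner ℝ u (D.ξ i) := by
      rw [hux, hux, h.inner_v_x hi, h.inner_v_x hi]
      rcases Int.units_eq_one_or c' with rfl | rfl
      · rw [if_pos rfl, if_neg (by decide)]; linear_combination a1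
      · rw [if_pos rfl, if_neg (by decide)]; linear_combination a2
    rw [e]; nlinarith [sq_nonneg (inner ℝ u (D.ξ i))]
  have hJ : ∑ i ∈ D.J, (inner ℝ u (D.x i) - 1) ^ 2 ≤
      ∑ i ∈ D.J, (2 + 2 * (inner ℝ u (D.ξ i)) ^ 2) := by
    refine Finset.sum_le_sum fun i hi => ?_
    obtain ⟨b, b0, b1, hb⟩ := h.x_min i hi 1 j
    obtain ⟨b', b0', b1', hb'⟩ := h.x_min i hi (-1) j
    have e : inner ℝ u (D.x i) - 1 = (b + b' - 1) + inner ℝ u (D.ξ i) := by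
      rw [hux, hux, hb, hb']; linear_combination b * a1 + b' * a2
    rw [e]
    have : (b + b' - 1) ^ 2 ≤ 1 := by nlinarith
    nlinarith [sq_nonneg (b + b' - 1 - inner ℝ u (D.ξ i))]
  have hsum : ∑ i, (inner ℝ u (D.x i) - 1) ^ 2 ≤ 2 * (ε * n) + ∑ i, 2 * (inner ℝ u (D.ξ i)) ^ 2 := by
    rw [h.sum_eq, h.sum_eq]
    rw [Finset.sum_add_distrib] at hJ
    have := h.card_J
    simp only [Finset.sum_const, nsmul_eq_mul] at hJ
    linarith [hI 1, hI (-1)]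
  have hsum2 : ∑ i, 2 * (inner ℝ u (D.ξ i)) ^ 2 ≤
      4 * (n * (D.σ 1 j ^ 2 + 3 * ε * M) * α) + 4 * (n * (D.σ (-1) j ^ 2 + 3 * ε * M) * α') := by
    have s1 := h.sum_inner_sq_le hσ 1 j
    have s2 := h.sum_inner_sq_le hσ (-1) j
    calc _ ≤ ∑ i, (4 * (α ^ 2 * inner ℝ v (D.ξ i) ^ 2) + 4 * (α' ^ 2 * inner ℝ v' (D.ξ i) ^ 2)) :=
          Finset.sum_le_sum fun i _ => by linarith [hterm i]
      _ = 4 * α ^ 2 * ∑ i, inner ℝ v (D.ξ i) ^ 2 + 4 * α' ^ 2 * ∑ i, inner ℝ v' (D.ξ i) ^ 2 := by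
          rw [Finset.sum_add_distrib, Finset.mul_sum, Finset.mul_sum]
          congr 1 <;> exact Finset.sum_congr rfl fun i _ => by ring
      _ ≤ 4 * α ^ 2 * (n * (D.σ 1 j ^ 2 + 3 * ε * M) * ‖v‖ ^ 2) +
          4 * α' ^ 2 * (n * (D.σ (-1) j ^ 2 + 3 * ε * M) * ‖v'‖ ^ 2) := by gcongr
      _ = _ := by
          linear_combination 4 * (n * (D.σ 1 j ^ 2 + 3 * ε * M) * α) * a1 +
            4 * (n * (D.σ (-1) j ^ 2 + 3 * ε * M) * α') * a2
  rw [hu] at h1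
  have h2 : n * (c₀ * (α + α')) ≤ n * (2 * ε + 4 * (D.σ 1 j ^ 2 + 3 * ε * M) * α +
      4 * (D.σ (-1) j ^ 2 + 3 * ε * M) * α') := by linarith
  have h3 := le_of_mul_le_mul_left h2 hn
  have hαM : 1 ≤ α * M ^ 2 := by
    rw [← a1]; gcongr; exact hv 1 j
  have hεM : 2 * ε ≤ c₀ / 24 * α := by
    have : 2 * ε * 1 ≤ 2 * ε * (α * M ^ 2) := by gcongr
    nlinarith
  have hεM' : 12 * ε * M ≤ c₀ / 4 := by nlinarith
  have r1 : D.σ 1 j ^ 2 * α = (D.σ 1 j / ‖v‖) ^ 2 := by rw [div_pow]; rfl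
  have r2 : D.σ (-1) j ^ 2 * α' = (D.σ 1 j / ‖v‖) ^ 2 := by rw [h.nsr_eq 1 (-1) j, div_pow]; rfl
  -- Both terms σ²/‖v‖² are the same squared noise-to-signal ratio, so the sum collapses to a
  -- multiple of it. The terms in ε are absorbed into half of the left side.
  have h4 : c₀ * (α + α') / 2 ≤ 8 * (D.σ 1 j / ‖v‖) ^ 2 := by
    have := mul_le_mul_of_nonneg_right hεM' (add_nonneg a0.le a0'.le)
    have := mul_nonneg hc0 a0'.le
    have := mul_nonneg hc0 a0.le
    linarith
  have hc : (D.σ c j / ‖D.v c j‖) ^ 2 = D.σ c j ^ 2 * (‖D.v c j‖ ^ 2)⁻¹ := by rw [div_pow]; rfl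
  have pc := h.v_norm_pos c j
  have hle : (‖D.v c j‖ ^ 2)⁻¹ ≤ α + α' := by
    rcases Int.units_eq_one_or c with rfl | rfl
    · linarith
    · linarith
  have h5 : c₀ / 16 * (‖D.v c j‖ ^ 2)⁻¹ ≤ D.σ c j ^ 2 * (‖D.v c j‖ ^ 2)⁻¹ := by
    rw [← hc, h.nsr_eq c 1 j]
    have := mul_le_mul_of_nonneg_left hle hc0
    linarith
  exact le_of_mul_le_mul_right h5 (by positivity)

end Basic

end Regular
end FeatureSample

/-! ### Near-critical affine predictors and a priori bounds -/

variable {E : Type*} [NormedAddCommGroup E] [InnerProductSpace ℝ E] {n : ℕ}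

namespace FeatureSample

/-- The affine predictor `⟨w, x⟩ + b`, perturbed by `e`, is an approximate critical point of the
square loss on the sample, with residuals `r`. -/
structure NearCritical (D : FeatureSample E n) (ε : ℝ) (w : E) (b : ℝ) (e r : Fin n → ℝ) :
    Prop where
  res : ∀ i, r i = inner ℝ w (D.x i) + b + e i - D.y i
  sum_sq : ∑ i, r i ^ 2 ≤ n
  grad : ‖∑ i, r i • D.x i‖ ≤ ε * n
  bias : b = 0 ∨ |∑ i, r i| ≤ ε * n
  err : ∀ i, |e i| ≤ ε * (1 + |b|)

variable {D : FeatureSample E n} {K c₀ ε : ℝ}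

/-- The residuals and labels have mean square at most 1, so ⟨w, x⟩ + b has bounded mean square up to
the error `e`. The covariance lower bound allows an arbitrary shift, so it bounds `w` without
knowledge of `b`; the upper bound then controls `b`. As `e` may grow with |b|, its contribution has
to be absorbed, which is what the condition on `ε` provides. -/
lemma NearCritical.norm_le (h : D.Regular K c₀ ε) {w : E} {b : ℝ} {e r : Fin n → ℝ}
    (hr : D.NearCritical ε w b e r) (hc : 0 < c₀) (hK : 0 ≤ K)
    (hε : ε ^ 2 * (24 * (1 + K / c₀)) ≤ 1) :
    b ^ 2 ≤ 24 * (1 + K / c₀) + 1 ∧ ‖w‖ ^ 2 ≤ 13 / c₀ := by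
  have hn := h.natCast_pos
  set A := 1 + K / c₀ with hA
  have hA1 : 1 ≤ A := by have : 0 ≤ K / c₀ := by positivity
                         linarith
  have he : ∑ i, e i ^ 2 ≤ n * (ε * (1 + |b|)) ^ 2 := by
    calc _ ≤ ∑ _i : Fin n, (ε * (1 + |b|)) ^ 2 :=
          Finset.sum_le_sum fun i _ => sq_le_sq' (abs_le.1 (hr.err i)).1 (abs_le.1 (hr.err i)).2
      _ = _ := by simp
  have hb2 : (ε * (1 + |b|)) ^ 2 ≤ ε ^ 2 * (2 + 2 * b ^ 2) := by
    rw [mul_pow]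
    gcongr
    have := sq_abs b
    nlinarith [sq_nonneg (1 - |b|)]
  have h1 : ∑ i, (inner ℝ w (D.x i) + b) ^ 2 ≤ n * (6 + 3 * (ε ^ 2 * (2 + 2 * b ^ 2))) := by
    calc _ ≤ ∑ i, (3 * r i ^ 2 + 3 * D.y i ^ 2 + 3 * e i ^ 2) := by
          refine Finset.sum_le_sum fun i _ => ?_
          have : inner ℝ w (D.x i) + b = r i + D.y i - e i := by rw [hr.res]; ring
          rw [this]
          nlinarith [sq_nonneg (r i - D.y i), sq_nonneg (r i + e i), sq_nonneg (D.y i + e i)]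
      _ = 3 * ∑ i, r i ^ 2 + 3 * n + 3 * ∑ i, e i ^ 2 := by
          simp only [h.y_sq, Finset.sum_add_distrib, Finset.mul_sum]
          simp; ring
      _ ≤ 3 * n + 3 * n + 3 * (n * (ε ^ 2 * (2 + 2 * b ^ 2))) := by
          have := hr.sum_sq
          have := mul_le_mul_of_nonneg_left hb2 hn.le
          linarith
      _ = _ := by ring
  set B := 6 + 3 * (ε ^ 2 * (2 + 2 * b ^ 2)) with hB
  -- The free shift in `lower` is taken to be -b.
  have hw : c₀ * ‖w‖ ^ 2 ≤ B := by
    have := h.lower w (-b)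
    simp only [sub_neg_eq_add] at this
    have h2 : n * (c₀ * ‖w‖ ^ 2) ≤ n * B := by linarith
    exact le_of_mul_le_mul_left h2 hn
  have h3 : n * b ^ 2 ≤ n * (2 * B + 2 * (K * ‖w‖ ^ 2)) := by
    calc n * b ^ 2 = ∑ _i : Fin n, b ^ 2 := by simp
      _ ≤ ∑ i, (2 * (inner ℝ w (D.x i) + b) ^ 2 + 2 * inner ℝ w (D.x i) ^ 2) := by
          refine Finset.sum_le_sum fun i _ => ?_
          nlinarith [sq_nonneg (2 * inner ℝ w (D.x i) + b)]
      _ = 2 * ∑ i, (inner ℝ w (D.x i) + b) ^ 2 + 2 * ∑ i, inner ℝ w (D.x i) ^ 2 := by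
          rw [Finset.sum_add_distrib, Finset.mul_sum, Finset.mul_sum]
      _ ≤ _ := by linarith [h.upper w]
  have h4 := le_of_mul_le_mul_left h3 hn
  have h5 : K * ‖w‖ ^ 2 ≤ K / c₀ * B := by
    calc K * ‖w‖ ^ 2 = K / c₀ * (c₀ * ‖w‖ ^ 2) := by field_simp
      _ ≤ _ := by gcongr
  have h6 : b ^ 2 ≤ 2 * A * B := by rw [hA]; linarith
  have h7 : ε ^ 2 * A ≤ 1 / 24 := by linarith
  have h8 : b ^ 2 ≤ 24 * A + 1 := by
    have : (ε ^ 2 * A) * (1 + b ^ 2) ≤ 1 / 24 * (1 + b ^ 2) := by gcongr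
    rw [hB] at h6
    nlinarith
  refine ⟨h8, ?_⟩
  rw [le_div_iff₀ hc, mul_comm]
  refine hw.trans ?_
  have e1 : ε ^ 2 ≤ 1 / 24 := by
    have := mul_le_mul_of_nonneg_left hA1 (sq_nonneg ε)
    linarith
  have e2 : ε ^ 2 * b ^ 2 ≤ ε ^ 2 * (24 * A + 1) := by gcongr
  rw [hB]
  nlinarith

/-- Common bounds for the quantities attached to a sample and a predictor. -/
structure BoundedBy (D : FeatureSample E n) (K M : ℝ) (w : E) (b : ℝ) : Prop where
  one_le : 1 ≤ M
  K_nonneg : 0 ≤ K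
  K_le : K ≤ M
  σ_le : ∀ c j, D.σ c j ≤ M
  inv_σ : ∀ c j, 1 ≤ M * D.σ c j ^ 2
  v_le : ∀ c j, ‖D.v c j‖ ≤ M
  inv_nsr : ∀ c j, ‖D.v c j‖ ^ 2 ≤ M * D.σ c j ^ 2
  w_le : ‖w‖ ≤ M
  b_le : |b| ≤ M

/-- The component of `w` in the span of the features. -/
def proj (D : FeatureSample E n) (w : E) : E :=
  ∑ c, ∑ j, (inner ℝ w (D.v c j) / ‖D.v c j‖ ^ 2) • D.v c j

lemma inner_proj (w z : E) :
    inner ℝ (D.proj w) z =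
      ∑ c, ∑ j, inner ℝ w (D.v c j) / ‖D.v c j‖ ^ 2 * inner ℝ (D.v c j) z := by
  simp only [proj, sum_inner, inner_smul_left, RCLike.conj_to_real]

namespace Regular

lemma inner_proj_v (h : D.Regular K c₀ ε) (w : E) (c : ℤˣ) (j : Fin 2) :
    inner ℝ (D.proj w) (D.v c j) = inner ℝ w (D.v c j) := by
  have hv := h.v_norm_pos c j
  rw [inner_proj, Finset.sum_eq_single c, Finset.sum_eq_single j, real_inner_self_eq_norm_sq]
  · field_simp
  · intro j' _ hj
    rw [h.orthogonal c j' c j (by simp [hj]), mul_zero]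
  · exact fun hj => absurd (Finset.mem_univ _) hj
  · intro c' _ hc
    refine Finset.sum_eq_zero fun j' _ => ?_
    rw [h.orthogonal c' j' c j (by simp [hc]), mul_zero]
  · exact fun hc => absurd (Finset.mem_univ _) hc

lemma inner_sub_proj_v (h : D.Regular K c₀ ε) (w : E) (c : ℤˣ) (j : Fin 2) :
    inner ℝ (w - D.proj w) (D.v c j) = 0 := by
  rw [inner_sub_left, h.inner_proj_v, sub_self]

lemma norm_sub_proj_le (h : D.Regular K c₀ ε) (w : E) : ‖w - D.proj w‖ ≤ ‖w‖ := by
  have h0 : inner ℝ (w - D.proj w) (D.proj w) = 0 := by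
    rw [proj, inner_sum]
    refine Finset.sum_eq_zero fun c _ => ?_
    rw [inner_sum]
    refine Finset.sum_eq_zero fun j _ => ?_
    rw [inner_smul_right]
    exact mul_eq_zero_of_right _ (h.inner_sub_proj_v w c j)
  have h1 : ‖w‖ ^ 2 = ‖w - D.proj w‖ ^ 2 + ‖D.proj w‖ ^ 2 := by
    have := norm_add_sq_real (w - D.proj w) (D.proj w)
    rw [h0, sub_add_cancel] at this
    linarith
  refine le_of_sq_le_sq ?_ (norm_nonneg w)
  nlinarith [sq_nonneg ‖D.proj w‖]

/-- The bounds that hold for every near-critical predictor. -/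
lemma boundedBy (h : D.Regular K c₀ ε) (hc : 0 < c₀) (hK : 0 ≤ K) {w : E} {b : ℝ} {e r : Fin n → ℝ}
    (hr : D.NearCritical ε w b e r) (h1 : ε ≤ 1 / 16) (h2 : ε ^ 2 * (24 * (1 + K / c₀)) ≤ 1)
    (h3 : 48 * (8 * K + 4 * √K + 2) ^ 2 * ε ≤ c₀) :
    D.BoundedBy K (16 / c₀ * (8 * K + 4 * √K + 2) ^ 2 + (8 * K + 4 * √K + 2) +
      24 * (1 + K / c₀) + 13 / c₀) w b := by
  set M₀ := 8 * K + 4 * √K + 2 with hM₀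
  have hs := Real.sqrt_nonneg K
  have hM1 : 1 ≤ M₀ := by linarith
  have hσ : ∀ c j, D.σ c j ≤ M₀ := fun c j => by
    have := h.σ_sq_le h1 c j
    nlinarith [sq_nonneg (D.σ c j - 1)]
  have hv : ∀ c j, ‖D.v c j‖ ≤ M₀ := fun c j => by
    have := h.v_norm_le hK (h1.trans (by norm_num)) c j
    linarith
  obtain ⟨hb, hw⟩ := hr.norm_le h hc hK h2
  have hle := h.le_σ_sq hM1 hσ hv h3
  have q : 0 ≤ K / c₀ := by positivity
  have q2 : 0 ≤ 13 / c₀ := by positivity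
  have q3 : 0 ≤ 16 / c₀ * M₀ ^ 2 := by positivity
  set M := 16 / c₀ * M₀ ^ 2 + M₀ + 24 * (1 + K / c₀) + 13 / c₀
  have hM : 16 / c₀ * M₀ ^ 2 ≤ M := by simp only [M]; linarith
  have hinv : ∀ c j, M₀ ^ 2 ≤ M * D.σ c j ^ 2 := fun c j => by
    calc M₀ ^ 2 = (16 / c₀ * M₀ ^ 2) * (c₀ / 16) := by field_simp
      _ ≤ M * D.σ c j ^ 2 := by gcongr; exact hle c j
  refine ⟨by linarith, hK, by simp only [M]; linarith, fun c j => (hσ c j).trans (by simp only [M]; linarith),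
    fun c j => le_trans (by nlinarith) (hinv c j),
    fun c j => (hv c j).trans (by simp only [M]; linarith), fun c j => le_trans ?_ (hinv c j), ?_, ?_⟩
  · have := hv c j
    gcongr
  · have : ‖w‖ ≤ 13 / c₀ + 1 := by nlinarith [norm_nonneg w]
    simp only [M]; linarith
  · have : |b| ≤ 24 * (1 + K / c₀) + 1 := by
      have := sq_abs b
      nlinarith [abs_nonneg b]
    simp only [M]; linarith

end Regular
end FeatureSample

/-! ### The part of the predictor orthogonal to the features -/

variable {E : Type*} [NormedAddCommGroup E] [InnerProductSpace ℝ E] {n : ℕ}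

namespace FeatureSample

variable {D : FeatureSample E n} {K c₀ ε M : ℝ} {w : E} {b : ℝ} {e r : Fin n → ℝ}

/-- The mean residual of a predictor on the majority group of class `c`. -/
def meanRes (D : FeatureSample E n) (w : E) (b : ℝ) (c : ℤˣ) : ℝ :=
  inner ℝ w (D.v c 0) + inner ℝ w (D.v c 1) + b - ((c : ℤ) : ℝ)

lemma BoundedBy.abs_inner_w_le (hb : D.BoundedBy K M w b) (c : ℤˣ) (j : Fin 2) :
    |inner ℝ w (D.v c j)| ≤ M * ‖D.v c j‖ := abs_inner_le_of_norm_le hb.w_le le_rfl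

lemma abs_units_cast (c : ℤˣ) : |((c : ℤ) : ℝ)| = 1 := by
  rcases Int.units_eq_one_or c with rfl | rfl <;> simp

lemma BoundedBy.abs_meanRes_le (hb : D.BoundedBy K M w b) (c : ℤˣ) :
    |D.meanRes w b c| ≤ 4 * M ^ 2 := by
  have h0 : |inner ℝ w (D.v c 0)| ≤ M * M := abs_inner_le_of_norm_le hb.w_le (hb.v_le c 0)
  have h1 : |inner ℝ w (D.v c 1)| ≤ M * M := abs_inner_le_of_norm_le hb.w_le (hb.v_le c 1)
  have h2 := hb.b_le
  have h3 := (abs_units_cast c).le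
  have hM := hb.one_le
  rw [abs_le] at *
  unfold meanRes
  constructor <;> nlinarith

namespace Regular

lemma inner_add_maj (h : D.Regular K c₀ ε) (u : E) (b : ℝ) {c : ℤˣ} {i : Fin n} (hi : i ∈ D.I c) :
    inner ℝ u (D.x i) + b - D.y i = D.meanRes u b c + inner ℝ u (D.ξ i) := by
  rw [h.x_maj c i hi, h.y_maj c i hi, inner_add_right, inner_add_right, meanRes]
  ring

lemma meanRes_proj (h : D.Regular K c₀ ε) (w : E) (b : ℝ) (c : ℤˣ) :
    D.meanRes (D.proj w) b c = D.meanRes w b c := by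
  simp only [meanRes, h.inner_proj_v]

/-- A minority example carries at most one copy of the feature, and there are at most εn of them.
The noise on the minority examples is controlled by its own concentration bound. -/
lemma sum_J_inner_v_sq_le (h : D.Regular K c₀ ε) (hb : D.BoundedBy K M w b) (c : ℤˣ) (j : Fin 2) :
    ∑ i ∈ D.J, inner ℝ (D.v c j) (D.x i) ^ 2 ≤ 6 * M ^ 2 * (ε * n) * ‖D.v c j‖ ^ 2 := by
  have hn := h.natCast_pos
  have hε := h.eps_nonneg
  have hM := hb.one_le
  have hσ0 := h.σ_nonneg c j
  have h1 := (abs_le.1 (h.abs_sum_inner_sq_sub_le (Or.inr rfl) c j)).2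
  have hJ := h.card_J
  set V := ‖D.v c j‖ ^ 2 with hV
  have hV0 : 0 ≤ V := sq_nonneg _
  have hVM : V ≤ M ^ 2 := by have := hb.v_le c j; rw [hV]; gcongr
  have hs : D.σ c j ^ 2 ≤ M ^ 2 := by have := hb.σ_le c j; gcongr
  have h2 : ∑ i ∈ D.J, inner ℝ (D.v c j) (D.x i) ^ 2 ≤
      ∑ i ∈ D.J, (2 * V ^ 2 + 2 * inner ℝ (D.v c j) (D.ξ i) ^ 2) := by
    refine Finset.sum_le_sum fun i hi => ?_
    obtain ⟨a, a0, a1, ha⟩ := h.x_min i hi c j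
    rw [ha]
    have : (a * V) ^ 2 ≤ V ^ 2 := by
      rw [mul_pow]
      have : a ^ 2 ≤ 1 := by nlinarith
      nlinarith [sq_nonneg V]
    nlinarith [sq_nonneg (a * V - inner ℝ (D.v c j) (D.ξ i))]
  rw [Finset.sum_add_distrib, Finset.sum_const, nsmul_eq_mul, ← Finset.mul_sum] at h2
  have h3 : (D.J.card : ℝ) * (2 * V ^ 2) ≤ 2 * M ^ 2 * (ε * n) * V := by
    calc _ ≤ (ε * n) * (2 * (M ^ 2 * V)) := by rw [pow_two V]; gcongr
      _ = _ := by ring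
  have h4 : (D.J.card : ℝ) * (D.σ c j ^ 2 * V) ≤ (ε * n) * (M ^ 2 * V) := by gcongr
  have h5 : ε * n * D.σ c j * V ≤ ε * n * M ^ 2 * V := by
    have : D.σ c j ≤ M ^ 2 := (hb.σ_le c j).trans (by nlinarith)
    gcongr
  linarith

/-- The part of the residual explained by the features is small on the minority groups. -/
lemma sum_J_sq_le (h : D.Regular K c₀ ε) (hb : D.BoundedBy K M w b) :
    ∑ i ∈ D.J, (inner ℝ (D.proj w) (D.x i) + b - D.y i) ^ 2 ≤ 156 * M ^ 4 * (ε * n) := by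
  have hn := h.natCast_pos
  have hε := h.eps_nonneg
  have hM := hb.one_le
  let g (c : ℤˣ) (j : Fin 2) (i : Fin n) : ℝ :=
    inner ℝ w (D.v c j) / ‖D.v c j‖ ^ 2 * inner ℝ (D.v c j) (D.x i)
  have hg c j : ∑ i ∈ D.J, g c j i ^ 2 ≤ 6 * M ^ 4 * (ε * n) := by
    have hv := h.v_norm_pos c j
    have h1 := h.sum_J_inner_v_sq_le hb c j
    have h2 := sq_le_sq' (abs_le.1 (hb.abs_inner_w_le c j)).1 (abs_le.1 (hb.abs_inner_w_le c j)).2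
    calc ∑ i ∈ D.J, g c j i ^ 2 = inner ℝ w (D.v c j) ^ 2 / ‖D.v c j‖ ^ 4 *
          ∑ i ∈ D.J, inner ℝ (D.v c j) (D.x i) ^ 2 := by
          rw [Finset.mul_sum]
          exact Finset.sum_congr rfl fun i _ => by simp only [g]; ring
      _ ≤ (M * ‖D.v c j‖) ^ 2 / ‖D.v c j‖ ^ 4 * (6 * M ^ 2 * (ε * n) * ‖D.v c j‖ ^ 2) := by gcongr
      _ = _ := by field_simp
  have hk : ∀ i, inner ℝ (D.proj w) (D.x i) + b - D.y i =
      g 1 0 i + g 1 1 i + g (-1) 0 i + g (-1) 1 i + b - D.y i := by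
    intro i
    rw [inner_proj]
    simp [g]
    ring
  have hb2 : b ^ 2 ≤ M ^ 2 := sq_le_sq' (abs_le.1 hb.b_le).1 (abs_le.1 hb.b_le).2
  have hJ := h.card_J
  calc _ ≤ ∑ i ∈ D.J, (6 * g 1 0 i ^ 2 + 6 * g 1 1 i ^ 2 + 6 * g (-1) 0 i ^ 2 + 6 * g (-1) 1 i ^ 2
          + (6 * b ^ 2 + 6)) := by
        refine Finset.sum_le_sum fun i _ => ?_
        rw [hk]
        have hy := h.y_sq i
        have := Finset.sum_mul_sq_le_sq_mul_sq Finset.univ (fun _ : Fin 6 => (1 : ℝ))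
          ![g 1 0 i, g 1 1 i, g (-1) 0 i, g (-1) 1 i, b, - D.y i]
        simp [Fin.sum_univ_six] at this
        linarith
    _ = 6 * ∑ i ∈ D.J, g 1 0 i ^ 2 + 6 * ∑ i ∈ D.J, g 1 1 i ^ 2 + 6 * ∑ i ∈ D.J, g (-1) 0 i ^ 2 +
        6 * ∑ i ∈ D.J, g (-1) 1 i ^ 2 + D.J.card * (6 * b ^ 2 + 6) := by
        simp only [Finset.sum_add_distrib, Finset.mul_sum, Finset.sum_const, nsmul_eq_mul]
        ring
    _ ≤ 4 * (6 * (6 * M ^ 4 * (ε * n))) + (ε * n) * (6 * M ^ 4 + 6 * M ^ 4) := by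
        have : (D.J.card : ℝ) * (6 * b ^ 2 + 6) ≤ (ε * n) * (6 * M ^ 4 + 6 * M ^ 4) := by
          have e1 : M ^ 2 ≤ M ^ 4 := pow_le_pow_right₀ hM (by norm_num)
          have e2 : 1 ≤ M ^ 4 := one_le_pow₀ hM
          gcongr
          · linarith
          · linarith
        linarith [hg 1 0, hg 1 1, hg (-1) 0, hg (-1) 1]
    _ = _ := by ring

lemma sum_err_sq_le (h : D.Regular K c₀ ε) (hr : D.NearCritical ε w b e r)
    (hb : D.BoundedBy K M w b) : ∑ i, e i ^ 2 ≤ (2 * M * ε) ^ 2 * n := by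
  have hε := h.eps_nonneg
  have hM := hb.one_le
  calc _ ≤ ∑ _i : Fin n, (2 * M * ε) ^ 2 := by
        refine Finset.sum_le_sum fun i _ => sq_le_sq' ?_ ?_
        all_goals
          have h1 := abs_le.1 (hr.err i)
          have h2 := hb.b_le
          have : ε * (1 + |b|) ≤ ε * (2 * M) := by gcongr; linarith
          linarith
    _ = _ := by simp; ring

/-- The component of the predictor orthogonal to the features contributes little. -/
lemma sum_inner_orth_sq_le (h : D.Regular K c₀ ε) (hr : D.NearCritical ε w b e r)
    (hb : D.BoundedBy K M w b) (hε1 : ε ≤ 1) :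
    ∑ i, inner ℝ (w - D.proj w) (D.x i) ^ 2 ≤ 400 * M ^ 4 * (ε * n) := by
  have hn := h.natCast_pos
  have hε := h.eps_nonneg
  have hM := hb.one_le
  set o := w - D.proj w with ho
  have hoM : ‖o‖ ≤ M := (h.norm_sub_proj_le w).trans hb.w_le
  have hov : ∀ c j, inner ℝ o (D.v c j) = 0 := h.inner_sub_proj_v w
  let k (i : Fin n) : ℝ := inner ℝ (D.proj w) (D.x i) + b - D.y i
  -- Stationarity is tested in the direction `o` itself. Writing the residual as the feature part
  -- `k`, plus ⟨o, x⟩, plus the error `e`, isolates the quantity to be bounded.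
  have hdec : ∑ i, inner ℝ o (D.x i) ^ 2 = ∑ i, r i * inner ℝ o (D.x i) -
      ∑ i, k i * inner ℝ o (D.x i) - ∑ i, e i * inner ℝ o (D.x i) := by
    rw [← Finset.sum_sub_distrib, ← Finset.sum_sub_distrib]
    refine Finset.sum_congr rfl fun i _ => ?_
    have : r i = k i + inner ℝ o (D.x i) + e i := by
      rw [hr.res, ho, inner_sub_left]; simp only [k]; ring
    rw [this]; ring
  have hgrad : |∑ i, r i * inner ℝ o (D.x i)| ≤ M * (ε * n) := by
    have : ∑ i, r i * inner ℝ o (D.x i) = inner ℝ o (∑ i, r i • D.x i) := by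
      simp [inner_sum, inner_smul_right]
    rw [this]
    exact abs_inner_le_of_norm_le hoM hr.grad
  have hmaj (c : ℤˣ) : |∑ i ∈ D.I c, k i * inner ℝ o (D.x i)| ≤ 8 * M ^ 3 * (ε * n) := by
    have hterm c' j : |∑ i ∈ D.I c, (inner ℝ w (D.v c' j) / ‖D.v c' j‖ ^ 2 *
        inner ℝ (D.v c' j) (D.ξ i)) * inner ℝ o (D.ξ i)| ≤ M ^ 3 * (ε * n) := by
      have hv := h.v_norm_pos c' j
      have h1 := h.abs_sum_inner_mul_inner_sub_le (Or.inl ⟨c, rfl⟩) o c' j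
      -- The population covariance of the noise along a feature and along `o` vanishes, since the
      -- feature is an eigenvector and `o` is orthogonal to it.
      rw [hov, mul_zero, mul_zero, sub_zero] at h1
      simp_rw [mul_assoc]
      rw [← Finset.mul_sum, abs_mul, abs_div, abs_of_nonneg (sq_nonneg ‖D.v c' j‖)]
      have hs := hb.σ_le c' j
      have hs0 := h.σ_nonneg c' j
      calc _ ≤ M * ‖D.v c' j‖ / ‖D.v c' j‖ ^ 2 * (M * (ε * n * (M * ‖D.v c' j‖))) := by
            have := hb.abs_inner_w_le c' j
            gcongr
            exact h1.trans (by gcongr)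
        _ = _ := by field_simp
    have e1 : ∑ i ∈ D.I c, k i * inner ℝ o (D.x i) =
        D.meanRes w b c * inner ℝ o (∑ i ∈ D.I c, D.ξ i) +
        ∑ c', ∑ j, ∑ i ∈ D.I c, (inner ℝ w (D.v c' j) / ‖D.v c' j‖ ^ 2 *
          inner ℝ (D.v c' j) (D.ξ i)) * inner ℝ o (D.ξ i) := by
      have e2 : ∑ c', ∑ j, ∑ i ∈ D.I c, (inner ℝ w (D.v c' j) / ‖D.v c' j‖ ^ 2 *
          inner ℝ (D.v c' j) (D.ξ i)) * inner ℝ o (D.ξ i) =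
          ∑ i ∈ D.I c, inner ℝ (D.proj w) (D.ξ i) * inner ℝ o (D.ξ i) := by
        simp only [inner_proj, Finset.sum_mul]
        symm
        rw [Finset.sum_comm]
        exact Finset.sum_congr rfl fun c' _ => Finset.sum_comm
      rw [e2, inner_sum, Finset.mul_sum, ← Finset.sum_add_distrib]
      refine Finset.sum_congr rfl fun i hi => ?_
      have e3 : k i = D.meanRes w b c + inner ℝ (D.proj w) (D.ξ i) := by
        simp only [k]; rw [h.inner_add_maj _ _ hi, h.meanRes_proj]
      have e4 : inner ℝ o (D.x i) = inner ℝ o (D.ξ i) := by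
        rw [h.x_maj c i hi, inner_add_right, inner_add_right, hov, hov]; ring
      rw [e3, e4]; ring
    have e5 : |D.meanRes w b c * inner ℝ o (∑ i ∈ D.I c, D.ξ i)| ≤ 4 * M ^ 2 * (M * (ε * n)) := by
      rw [abs_mul]
      have := hb.abs_meanRes_le c
      have := abs_inner_le_of_norm_le hoM (h.noise_sum c)
      gcongr
    rw [e1]
    have t1 := hterm 1 0
    have t2 := hterm 1 1
    have t3 := hterm (-1) 0
    have t4 := hterm (-1) 1
    rw [abs_le] at *
    simp [-Finset.sum_neg_distrib]
    constructor <;> linarith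
  -- The minority groups and the error term each cost a quarter of the left-hand side. Half of it
  -- remains, and the resulting bound is linear in ε.
  have hJ : |∑ i ∈ D.J, k i * inner ℝ o (D.x i)| ≤
      ∑ i ∈ D.J, k i ^ 2 + 1 / 4 * ∑ i, inner ℝ o (D.x i) ^ 2 := by
    calc _ ≤ ∑ i ∈ D.J, |k i * inner ℝ o (D.x i)| := Finset.abs_sum_le_sum_abs _ _
      _ ≤ ∑ i ∈ D.J, (k i ^ 2 + 1 / 4 * inner ℝ o (D.x i) ^ 2) := by
          refine Finset.sum_le_sum fun i _ => abs_le.2 ⟨?_, ?_⟩ <;>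
          nlinarith [sq_nonneg (k i - 1 / 2 * inner ℝ o (D.x i)),
            sq_nonneg (k i + 1 / 2 * inner ℝ o (D.x i))]
      _ ≤ _ := by
          rw [Finset.sum_add_distrib, ← Finset.mul_sum]
          have := sum_le_sum_univ D.J fun i => sq_nonneg (inner ℝ o (D.x i))
          linarith
  have hE : |∑ i, e i * inner ℝ o (D.x i)| ≤
      ∑ i, e i ^ 2 + 1 / 4 * ∑ i, inner ℝ o (D.x i) ^ 2 := by
    calc _ ≤ ∑ i, |e i * inner ℝ o (D.x i)| := Finset.abs_sum_le_sum_abs _ _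
      _ ≤ ∑ i, (e i ^ 2 + 1 / 4 * inner ℝ o (D.x i) ^ 2) := by
          refine Finset.sum_le_sum fun i _ => abs_le.2 ⟨?_, ?_⟩ <;>
          nlinarith [sq_nonneg (e i - 1 / 2 * inner ℝ o (D.x i)),
            sq_nonneg (e i + 1 / 2 * inner ℝ o (D.x i))]
      _ = _ := by rw [Finset.sum_add_distrib, ← Finset.mul_sum]
  have hk := h.sum_J_sq_le hb
  have he := h.sum_err_sq_le hr hb
  rw [h.sum_eq fun i => k i * inner ℝ o (D.x i)] at hdec
  have m1 := abs_le.1 (hmaj 1)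
  have m2 := abs_le.1 (hmaj (-1))
  have m3 := abs_le.1 hJ
  have m4 := abs_le.1 hE
  have m5 := abs_le.1 hgrad
  have hεn : 0 ≤ ε * n := by positivity
  have f1 : M * (ε * n) ≤ M ^ 4 * (ε * n) := by
    gcongr
    exact le_self_pow₀ hM (by norm_num)
  have f2 : M ^ 3 * (ε * n) ≤ M ^ 4 * (ε * n) := by
    gcongr M ^ ?_ * (ε * n)
    norm_num
  have f3 : (2 * M * ε) ^ 2 * n ≤ 4 * M ^ 4 * (ε * n) := by
    calc (2 * M * ε) ^ 2 * n = 4 * M ^ 2 * (ε * (ε * n)) := by ring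
      _ ≤ 4 * M ^ 4 * (1 * (ε * n)) := by
        gcongr 4 * M ^ ?_ * (?_ * (ε * n))
        norm_num
      _ = _ := by ring
  simp only [k] at *
  linarith

end Regular
end FeatureSample

/-! ### Approximate normal equations and their solution -/

variable {E : Type*} [NormedAddCommGroup E] [InnerProductSpace ℝ E] {n : ℕ}

namespace FeatureSample

variable {D : FeatureSample E n} {K c₀ ε M : ℝ} {w : E} {b : ℝ} {e r : Fin n → ℝ}

namespace Regular

lemma sum_J_affine_sq_le (h : D.Regular K c₀ ε) (hr : D.NearCritical ε w b e r)
    (hb : D.BoundedBy K M w b) (hε1 : ε ≤ 1) :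
    ∑ i ∈ D.J, (inner ℝ w (D.x i) + b - D.y i) ^ 2 ≤ (35 * M ^ 2) ^ 2 * (ε * n) := by
  have hn := h.natCast_pos
  have hε := h.eps_nonneg
  have h1 := h.sum_J_sq_le hb
  have h2 := h.sum_inner_orth_sq_le hr hb hε1
  have h3 := sum_le_sum_univ D.J fun i => sq_nonneg (inner ℝ (w - D.proj w) (D.x i))
  calc _ ≤ ∑ i ∈ D.J, (2 * (inner ℝ (D.proj w) (D.x i) + b - D.y i) ^ 2 +
        2 * inner ℝ (w - D.proj w) (D.x i) ^ 2) := by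
        refine Finset.sum_le_sum fun i _ => ?_
        rw [inner_sub_left]
        nlinarith [sq_nonneg ((inner ℝ (D.proj w) (D.x i) + b - D.y i) -
          (inner ℝ w (D.x i) - inner ℝ (D.proj w) (D.x i)))]
    _ = 2 * ∑ i ∈ D.J, (inner ℝ (D.proj w) (D.x i) + b - D.y i) ^ 2 +
        2 * ∑ i ∈ D.J, inner ℝ (w - D.proj w) (D.x i) ^ 2 := by
        rw [Finset.sum_add_distrib, Finset.mul_sum, Finset.mul_sum]
    _ ≤ 1112 * (M ^ 4 * (ε * n)) := by linarith
    _ ≤ 1225 * (M ^ 4 * (ε * n)) := by gcongr; norm_num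
    _ = _ := by ring

lemma abs_card_sub_le (h : D.Regular K c₀ ε) (c : ℤˣ) :
    |((D.I c).card : ℝ) - n / 2| ≤ ε * n := by
  have h1 := h.card_le c
  have h2 := h.card_ge c
  have h3 : 0 ≤ ε * n := mul_nonneg h.eps_nonneg h.natCast_pos.le
  rw [abs_le]
  constructor <;> linarith

/-- The residual on a majority group is its mean plus noise ⟨w, ξ⟩. The mean correlates with the
feature only in the feature's own class, while the noise contributes σ²⟨w, v⟩ in both classes. That
asymmetry is the source of the factor ½ in the feature equation. -/
lemma sum_maj_eq (h : D.Regular K c₀ ε) (hb : D.BoundedBy K M w b) (c c' : ℤˣ) (j : Fin 2) :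
    |∑ i ∈ D.I c', (inner ℝ w (D.x i) + b - D.y i) * inner ℝ (D.v c j) (D.x i) -
      n / 2 * ((if c' = c then D.meanRes w b c * ‖D.v c j‖ ^ 2 else 0) +
        D.σ c j ^ 2 * inner ℝ w (D.v c j))| ≤ 11 * M ^ 3 * (ε * n) * ‖D.v c j‖ := by
  have hn := h.natCast_pos
  have hε := h.eps_nonneg
  have hM := hb.one_le
  have hv := h.v_norm_pos c j
  have hvM := hb.v_le c j
  have hρ := hb.abs_meanRes_le c'
  have hs := h.noise_sum c'
  have hεn : 0 ≤ ε * n := by positivity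
  have hσ := hb.σ_le c j
  have hσ0 := h.σ_nonneg c j
  let δ : ℝ := if c' = c then 1 else 0
  have hδ : |δ| ≤ 1 := by simp only [δ]; split_ifs <;> simp
  have hδV : (if c' = c then ‖D.v c j‖ ^ 2 else 0) = δ * ‖D.v c j‖ ^ 2 := by
    simp only [δ]; split_ifs <;> simp
  have hδρ : (if c' = c then D.meanRes w b c * ‖D.v c j‖ ^ 2 else 0) =
      δ * D.meanRes w b c' * ‖D.v c j‖ ^ 2 := by
    simp only [δ]; split_ifs with hc <;> simp [hc]
  rw [hδρ]
  set V := ‖D.v c j‖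
  set ρ := D.meanRes w b c'
  set a := inner ℝ w (D.v c j)
  have haM : |a| ≤ M * V := hb.abs_inner_w_le c j
  have hcov := h.abs_sum_inner_mul_inner_sub_le (Or.inl ⟨c', rfl⟩) w c j
  have e1 : ∑ i ∈ D.I c', (inner ℝ w (D.x i) + b - D.y i) * inner ℝ (D.v c j) (D.x i) =
      (D.I c').card * (δ * ρ * V ^ 2) + δ * V ^ 2 * inner ℝ w (∑ i ∈ D.I c', D.ξ i) +
      ρ * inner ℝ (D.v c j) (∑ i ∈ D.I c', D.ξ i) +
      ∑ i ∈ D.I c', inner ℝ (D.v c j) (D.ξ i) * inner ℝ w (D.ξ i) := by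
    rw [inner_sum, inner_sum, Finset.mul_sum, Finset.mul_sum, ← nsmul_eq_mul, ← Finset.sum_const,
      ← Finset.sum_add_distrib, ← Finset.sum_add_distrib, ← Finset.sum_add_distrib]
    refine Finset.sum_congr rfl fun i hi => ?_
    rw [h.inner_add_maj w b hi, h.inner_v_x hi, hδV]
    ring
  have t1 : |((D.I c').card - n / 2) * (δ * ρ * V ^ 2)| ≤ ε * n * (1 * (4 * M ^ 2) * (M * V)) := by
    rw [abs_mul, abs_mul, abs_mul, abs_of_nonneg (sq_nonneg V)]
    have := h.abs_card_sub_le c'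
    gcongr
    rw [pow_two]; gcongr
  have t2 : |δ * V ^ 2 * inner ℝ w (∑ i ∈ D.I c', D.ξ i)| ≤ 1 * (M * V) * (M * (ε * n)) := by
    rw [abs_mul, abs_mul, abs_of_nonneg (sq_nonneg V)]
    have := abs_inner_le_of_norm_le hb.w_le hs
    gcongr
    rw [pow_two]; gcongr
  have t3 : |ρ * inner ℝ (D.v c j) (∑ i ∈ D.I c', D.ξ i)| ≤ 4 * M ^ 2 * (V * (ε * n)) := by
    rw [abs_mul]
    have := abs_inner_le_of_norm_le (le_refl V) hs
    gcongr
  have t4 : |∑ i ∈ D.I c', inner ℝ (D.v c j) (D.ξ i) * inner ℝ w (D.ξ i) -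
      (D.I c').card * (D.σ c j ^ 2 * a)| ≤ M * (ε * n * (M * V)) := by
    refine hcov.trans ?_
    have := hb.w_le
    gcongr
  have t5 : |((D.I c').card - n / 2) * (D.σ c j ^ 2 * a)| ≤ ε * n * (M ^ 2 * (M * V)) := by
    rw [abs_mul, abs_mul, abs_of_nonneg (sq_nonneg (D.σ c j))]
    have := h.abs_card_sub_le c'
    gcongr
  have p2 : M ^ 2 * (ε * n * V) ≤ M ^ 3 * (ε * n * V) := by
    gcongr M ^ ?_ * (ε * n * V)
    norm_num
  rw [e1]
  have hp3 : 0 ≤ M ^ 3 * (ε * n * V) := by positivity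
  rw [abs_le] at *
  constructor <;> nlinarith

/-- Approximate stationarity in the direction of a feature. -/
lemma feature_equation (h : D.Regular K c₀ ε) (hr : D.NearCritical ε w b e r)
    (hb : D.BoundedBy K M w b) (hε1 : ε ≤ 1) (c : ℤˣ) (j : Fin 2) :
    |1 / 2 * D.meanRes w b c * ‖D.v c j‖ ^ 2 + D.σ c j ^ 2 * inner ℝ w (D.v c j)| ≤
      140 * M ^ 3 * ε * ‖D.v c j‖ := by
  have hn := h.natCast_pos
  have hε := h.eps_nonneg
  have hM := hb.one_le
  have hv := h.v_norm_pos c j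
  have hεn : 0 ≤ ε * n := by positivity
  let f (i : Fin n) : ℝ := (inner ℝ w (D.x i) + b - D.y i) * inner ℝ (D.v c j) (D.x i)
  have hdec : ∑ i, r i * inner ℝ (D.v c j) (D.x i) =
      ∑ i ∈ D.I 1, f i + ∑ i ∈ D.I (-1), f i + ∑ i ∈ D.J, f i +
        ∑ i, e i * inner ℝ (D.v c j) (D.x i) := by
    rw [← h.sum_eq, ← Finset.sum_add_distrib]
    refine Finset.sum_congr rfl fun i _ => ?_
    rw [hr.res]; simp only [f]; ring
  have hgrad : |∑ i, r i * inner ℝ (D.v c j) (D.x i)| ≤ ‖D.v c j‖ * (ε * n) := by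
    have : ∑ i, r i * inner ℝ (D.v c j) (D.x i) = inner ℝ (D.v c j) (∑ i, r i • D.x i) := by
      simp [inner_sum, inner_smul_right]
    rw [this]
    exact abs_inner_le_of_norm_le le_rfl hr.grad
  have hE : |∑ i, e i * inner ℝ (D.v c j) (D.x i)| ≤ (2 * M * ε * √n) * (M * √n * ‖D.v c j‖) := by
    refine abs_sum_mul_le (by positivity) (by positivity) ?_ ?_
    · rw [mul_pow, Real.sq_sqrt hn.le]; exact h.sum_err_sq_le hr hb
    · refine (h.upper _).trans ?_
      rw [mul_pow, mul_pow, Real.sq_sqrt hn.le]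
      have := hb.K_le.trans (le_self_pow₀ hM two_ne_zero)
      gcongr
  -- Both factors have root sum of squares of order √(εn) over the minority examples, so the product
  -- is of order εn. A merely bounded first factor would leave √ε.
  have hJ : |∑ i ∈ D.J, f i| ≤ (35 * M ^ 2 * √(ε * n)) * (3 * M * √(ε * n) * ‖D.v c j‖) := by
    refine abs_sum_mul_le (by positivity) (by positivity) ?_ ?_
    · rw [mul_pow, Real.sq_sqrt hεn]; exact h.sum_J_affine_sq_le hr hb hε1
    · refine (h.sum_J_inner_v_sq_le hb c j).trans ?_
      rw [mul_pow, mul_pow, mul_pow, Real.sq_sqrt hεn]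
      gcongr
      norm_num
  have m1 := h.sum_maj_eq hb c 1 j
  have m2 := h.sum_maj_eq hb c (-1) j
  have hs : (if (1 : ℤˣ) = c then D.meanRes w b c * ‖D.v c j‖ ^ 2 else 0) +
      (if (-1 : ℤˣ) = c then D.meanRes w b c * ‖D.v c j‖ ^ 2 else 0) =
      D.meanRes w b c * ‖D.v c j‖ ^ 2 := by
    rcases Int.units_eq_one_or c with rfl | rfl
    · rw [if_pos rfl, if_neg (by decide), add_zero]
    · rw [if_pos rfl, if_neg (by decide), zero_add]
  have hE2 : (2 * M * ε * √n) * (M * √n * ‖D.v c j‖) = 2 * M ^ 2 * (ε * n) * ‖D.v c j‖ := by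
    linear_combination 2 * M ^ 2 * ε * ‖D.v c j‖ * Real.mul_self_sqrt hn.le
  have hJ2 : (35 * M ^ 2 * √(ε * n)) * (3 * M * √(ε * n) * ‖D.v c j‖) =
      105 * M ^ 3 * (ε * n) * ‖D.v c j‖ := by
    linear_combination 105 * M ^ 3 * ‖D.v c j‖ * Real.mul_self_sqrt hεn
  rw [hE2] at hE
  rw [hJ2] at hJ
  have p0 : 1 * (ε * n * ‖D.v c j‖) ≤ M ^ 3 * (ε * n * ‖D.v c j‖) := by
    gcongr; exact one_le_pow₀ hM
  have p2 : M ^ 2 * (ε * n * ‖D.v c j‖) ≤ M ^ 3 * (ε * n * ‖D.v c j‖) := by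
    gcongr M ^ ?_ * (ε * n * ‖D.v c j‖)
    norm_num
  rw [← mul_le_mul_iff_of_pos_left hn, ← abs_of_pos hn, ← abs_mul, abs_of_pos hn]
  have e2 : n * (1 / 2 * D.meanRes w b c * ‖D.v c j‖ ^ 2 + D.σ c j ^ 2 * inner ℝ w (D.v c j)) =
      n / 2 * ((if (1 : ℤˣ) = c then D.meanRes w b c * ‖D.v c j‖ ^ 2 else 0) +
        D.σ c j ^ 2 * inner ℝ w (D.v c j)) +
      n / 2 * ((if (-1 : ℤˣ) = c then D.meanRes w b c * ‖D.v c j‖ ^ 2 else 0) +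
        D.σ c j ^ 2 * inner ℝ w (D.v c j)) := by
    linear_combination (-(n : ℝ) / 2) * hs
  rw [e2]
  change |∑ i ∈ D.I 1, f i - _| ≤ _ at m1
  change |∑ i ∈ D.I (-1), f i - _| ≤ _ at m2
  rw [abs_le] at *
  constructor <;> linarith

/-- Approximate stationarity in the direction of the intercept. -/
lemma bias_equation (h : D.Regular K c₀ ε) (hr : D.NearCritical ε w b e r)
    (hb : D.BoundedBy K M w b) (hε1 : ε ≤ 1) (hbias : |∑ i, r i| ≤ ε * n) :
    |D.meanRes w b 1 + D.meanRes w b (-1)| ≤ 100 * M ^ 2 * ε := by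
  have hn := h.natCast_pos
  have hε := h.eps_nonneg
  have hM := hb.one_le
  have hεn : 0 ≤ ε * n := by positivity
  let f (i : Fin n) : ℝ := inner ℝ w (D.x i) + b - D.y i
  have hdec : ∑ i, r i = ∑ i ∈ D.I 1, f i + ∑ i ∈ D.I (-1), f i + ∑ i ∈ D.J, f i + ∑ i, e i := by
    rw [← h.sum_eq, ← Finset.sum_add_distrib]
    refine Finset.sum_congr rfl fun i _ => ?_
    rw [hr.res]; simp only [f]; ring
  have hE : |∑ i, e i * 1| ≤ (2 * M * ε * √n) * √n := by
    refine abs_sum_mul_le (by positivity) (by positivity) ?_ ?_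
    · rw [mul_pow, Real.sq_sqrt hn.le]; exact h.sum_err_sq_le hr hb
    · rw [Real.sq_sqrt hn.le]; simp
  have hJ : |∑ i ∈ D.J, f i * 1| ≤ (35 * M ^ 2 * √(ε * n)) * √(ε * n) := by
    refine abs_sum_mul_le (by positivity) (by positivity) ?_ ?_
    · rw [mul_pow, Real.sq_sqrt hεn]; exact h.sum_J_affine_sq_le hr hb hε1
    · rw [Real.sq_sqrt hεn]
      have := h.card_J
      simpa using this
  have hmaj (c : ℤˣ) : |∑ i ∈ D.I c, f i - n / 2 * D.meanRes w b c| ≤ 5 * M ^ 2 * (ε * n) := by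
    have e1 : ∑ i ∈ D.I c, f i = (D.I c).card * D.meanRes w b c +
        inner ℝ w (∑ i ∈ D.I c, D.ξ i) := by
      rw [inner_sum, ← nsmul_eq_mul, ← Finset.sum_const, ← Finset.sum_add_distrib]
      exact Finset.sum_congr rfl fun i hi => h.inner_add_maj w b hi
    have t1 : |((D.I c).card - n / 2) * D.meanRes w b c| ≤ ε * n * (4 * M ^ 2) := by
      rw [abs_mul]
      have := h.abs_card_sub_le c
      have := hb.abs_meanRes_le c
      gcongr
    have t2 := abs_inner_le_of_norm_le hb.w_le (h.noise_sum c)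
    have p : M * (ε * n) ≤ M ^ 2 * (ε * n) := by
      gcongr
      exact le_self_pow₀ hM two_ne_zero
    rw [e1]
    rw [abs_le] at *
    constructor <;> linarith
  simp only [mul_one] at hE hJ
  rw [mul_assoc, Real.mul_self_sqrt hn.le] at hE
  rw [mul_assoc, Real.mul_self_sqrt hεn] at hJ
  have p1 : M * (ε * n) ≤ M ^ 2 * (ε * n) := by
    gcongr
    exact le_self_pow₀ hM two_ne_zero
  have p0 : 1 * (ε * n) ≤ M ^ 2 * (ε * n) := by
    gcongr
    exact one_le_pow₀ hM
  have m1 := hmaj 1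
  have m2 := hmaj (-1)
  rw [← mul_le_mul_iff_of_pos_left hn, ← abs_of_pos hn, ← abs_mul, abs_of_pos hn]
  rw [abs_le] at *
  constructor <;> linarith

/-- The outputs of a near-critical predictor on the features. -/
theorem predictor_on_features (h : D.Regular K c₀ ε) (hr : D.NearCritical ε w b e r)
    (hb : D.BoundedBy K M w b) (hε1 : ε ≤ 1) {R : Fin 2 → ℝ}
    (hR : ∀ c j, R j = D.σ c j / ‖D.v c j‖) :
    |b| ≤ 1000 * M ^ 5 * ε ∧ ∀ c j, |inner ℝ w (D.v c j) -
      ((c : ℤ) : ℝ) * ((R j ^ 2)⁻¹ / (2 + (R 0 ^ 2)⁻¹ + (R 1 ^ 2)⁻¹))| ≤ 2000 * M ^ 6 * ε := by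
  have hn := h.natCast_pos
  have hε := h.eps_nonneg
  have hM := hb.one_le
  set Q : Fin 2 → ℝ := fun j => (R j ^ 2)⁻¹ with hQ
  have hσpos c j : 0 < D.σ c j ^ 2 := by
    have := hb.inv_σ c j
    by_contra hc
    nlinarith
  have hQe c j : Q j = ‖D.v c j‖ ^ 2 / D.σ c j ^ 2 := by
    simp only [hQ]; rw [hR c j, div_pow, inv_div]
  have hQ0 j : 0 ≤ Q j := by simp only [hQ]; positivity
  have hQM j : Q j ≤ M := by
    rw [hQe 1 j, div_le_iff₀ (hσpos 1 j)]; exact hb.inv_nsr 1 j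
  have heq c j : |inner ℝ w (D.v c j) + Q j / 2 * D.meanRes w b c| ≤ 140 * M ^ 5 * ε := by
    have h1 := h.feature_equation hr hb hε1 c j
    have e1 : inner ℝ w (D.v c j) + Q j / 2 * D.meanRes w b c =
        (1 / 2 * D.meanRes w b c * ‖D.v c j‖ ^ 2 + D.σ c j ^ 2 * inner ℝ w (D.v c j)) /
          D.σ c j ^ 2 := by
      rw [hQe c j]
      have := (hσpos c j).ne'
      rw [eq_div_iff this]
      generalize D.σ c j ^ 2 = S at this ⊢
      field_simp
      ring
    rw [e1, abs_div, abs_of_pos (hσpos c j), div_le_iff₀ (hσpos c j)]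
    calc _ ≤ 140 * M ^ 3 * ε * ‖D.v c j‖ := h1
      _ ≤ 140 * M ^ 3 * ε * M := by gcongr; exact hb.v_le c j
      _ ≤ 140 * M ^ 4 * ε * (M * D.σ c j ^ 2) := by
          have := mul_le_mul_of_nonneg_left (hb.inv_σ c j) (by positivity : 0 ≤ 140 * M ^ 4 * ε)
          linarith
      _ = _ := by ring
  set q := 1 + (Q 0 + Q 1) / 2 with hq
  have hq1 : 1 ≤ q := by have := hQ0 0; have := hQ0 1; linarith
  have hqM : q ≤ 2 * M := by have := hQM 0; have := hQM 1; linarith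
  -- Adding the two feature equations of a class eliminates `w` and leaves q ρ_c ≈ b - c.
  have hρ c : |q * D.meanRes w b c - (b - ((c : ℤ) : ℝ))| ≤ 280 * M ^ 5 * ε := by
    have h0 := heq c 0
    have h1 := heq c 1
    have e1 : q * D.meanRes w b c - (b - ((c : ℤ) : ℝ)) =
        (inner ℝ w (D.v c 0) + Q 0 / 2 * D.meanRes w b c) +
        (inner ℝ w (D.v c 1) + Q 1 / 2 * D.meanRes w b c) := by
      rw [hq, meanRes]; ring
    rw [e1]
    refine (abs_add_le _ _).trans ?_
    linarith
  -- Either the model has no intercept, or the equations of the two classes are added: the labels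
  -- cancel, and 2b ≈ q(ρ_1 + ρ_{-1}) ≈ 0.
  have hbb : |b| ≤ 380 * M ^ 5 * ε := by
    rcases hr.bias with h0 | h0
    · rw [h0, abs_zero]; positivity
    · have h1 := h.bias_equation hr hb hε1 h0
      have h2 : |q * (D.meanRes w b 1 + D.meanRes w b (-1))| ≤ 2 * M * (100 * M ^ 2 * ε) := by
        rw [abs_mul, abs_of_nonneg (by linarith)]
        gcongr
      have h3 := hρ 1
      have h4 := hρ (-1)
      have p : M ^ 3 * ε ≤ M ^ 5 * ε := by
        gcongr M ^ ?_ * ε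
        norm_num
      simp only [Units.val_one, Int.cast_one, Units.val_neg, Int.cast_neg] at h3 h4
      rw [abs_le] at *
      constructor <;> linarith
  have hp5 : 0 ≤ M ^ 5 * ε := by positivity
  refine ⟨by linarith, fun c j => ?_⟩
  have h1 : |q * D.meanRes w b c + ((c : ℤ) : ℝ)| ≤ 660 * M ^ 5 * ε := by
    have := hρ c
    rw [abs_le] at *
    constructor <;> linarith
  have h2 : |D.meanRes w b c + ((c : ℤ) : ℝ) / q| ≤ 660 * M ^ 5 * ε := by
    have e1 : D.meanRes w b c + ((c : ℤ) : ℝ) / q = (q * D.meanRes w b c + ((c : ℤ) : ℝ)) / q := by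
      field_simp
    rw [e1, abs_div, abs_of_pos (by linarith : 0 < q)]
    exact (div_le_self (abs_nonneg _) hq1).trans h1
  -- Substituting ρ_c ≈ -c/q in the feature equation; note 2q = 2 + Q_0 + Q_1.
  have e2 : inner ℝ w (D.v c j) - ((c : ℤ) : ℝ) * (Q j / (2 + Q 0 + Q 1)) =
      (inner ℝ w (D.v c j) + Q j / 2 * D.meanRes w b c) -
        Q j / 2 * (D.meanRes w b c + ((c : ℤ) : ℝ) / q) := by
    have : 2 + Q 0 + Q 1 = 2 * q := by rw [hq]; ring
    rw [this]
    have : q ≠ 0 := by linarith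
    field_simp
    ring
  change |inner ℝ w (D.v c j) - ((c : ℤ) : ℝ) * (Q j / (2 + Q 0 + Q 1))| ≤ _
  rw [e2]
  have h3 : |Q j / 2 * (D.meanRes w b c + ((c : ℤ) : ℝ) / q)| ≤ M * (660 * M ^ 5 * ε) := by
    rw [abs_mul, abs_of_nonneg (by have := hQ0 j; linarith)]
    have := hQM j
    have := hQ0 j
    gcongr
    linarith
  have p : M ^ 5 * ε ≤ M ^ 6 * ε := by
    gcongr M ^ ?_ * ε
    norm_num
  have hp6 : 0 ≤ M ^ 6 * ε := by positivity
  have := heq c j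
  refine (abs_sub _ _).trans ?_
  linarith

end Regular
end FeatureSample

/-! ### Gradient descent for linear least squares in residual form -/

section ResidualDynamics

variable {F : Type*} [NormedAddCommGroup F] [InnerProductSpace ℝ F] {n : ℕ}

/-- The gradient direction `∑ i, r i • ψ i` in feature space. -/
def featGrad (ψ : Fin n → F) (r : EuclideanSpace ℝ (Fin n)) : F := ∑ i, r i • ψ i

/-- The Gram operator of a family of feature vectors. -/
def gramOp (ψ : Fin n → F) (r : EuclideanSpace ℝ (Fin n)) : EuclideanSpace ℝ (Fin n) :=
  WithLp.toLp 2 fun i => inner ℝ (ψ i) (featGrad ψ r)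

variable (ψ : Fin n → F)

lemma featGrad_sub (r q : EuclideanSpace ℝ (Fin n)) :
    featGrad ψ (r - q) = featGrad ψ r - featGrad ψ q := by
  simp [featGrad, sub_smul, Finset.sum_sub_distrib]

lemma featGrad_smul (a : ℝ) (r : EuclideanSpace ℝ (Fin n)) :
    featGrad ψ (a • r) = a • featGrad ψ r := by
  simp [featGrad, mul_smul, Finset.smul_sum]

lemma gramOp_sub (r q : EuclideanSpace ℝ (Fin n)) :
    gramOp ψ (r - q) = gramOp ψ r - gramOp ψ q := by
  ext i; simp [gramOp, featGrad_sub, inner_sub_right]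

lemma inner_gramOp (q r : EuclideanSpace ℝ (Fin n)) :
    inner ℝ q (gramOp ψ r) = inner ℝ (featGrad ψ q) (featGrad ψ r) := by
  rw [PiLp.inner_apply, featGrad, sum_inner]
  refine Finset.sum_congr rfl fun i _ => ?_
  simp [gramOp, inner_smul_left, mul_comm]

variable {ψ}

/-- Write Ψᵀ for `featGrad` and G = ΨΨᵀ. Then ‖Gr‖² = ⟨ΨᵀGr, Ψᵀr⟩, and the bound on Ψᵀ applied to Gr
cancels one factor ‖Gr‖. -/
lemma norm_gramOp_sq_le {L : ℝ} (hL : ∀ r, ‖featGrad ψ r‖ ^ 2 ≤ L * ‖r‖ ^ 2)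
    (r : EuclideanSpace ℝ (Fin n)) : ‖gramOp ψ r‖ ^ 2 ≤ L * ‖featGrad ψ r‖ ^ 2 := by
  set q := gramOp ψ r with hq
  have h1 : ‖q‖ ^ 2 ≤ ‖featGrad ψ q‖ * ‖featGrad ψ r‖ := by
    rw [← real_inner_self_eq_norm_sq]
    nth_rw 2 [hq]
    rw [inner_gramOp]
    exact real_inner_le_norm _ _
  rcases (norm_nonneg q).eq_or_lt with h0 | h0
  · rw [← h0]
    rcases (norm_nonneg r).eq_or_lt with hr | hr
    · have : r = 0 := norm_eq_zero.1 hr.symm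
      simp [this, featGrad]
    · have : 0 ≤ L := by
        have := (sq_nonneg _).trans (hL r)
        exact nonneg_of_mul_nonneg_left this (by positivity)
      rw [zero_pow two_ne_zero]
      positivity
  · have h2 : (‖q‖ ^ 2) ^ 2 ≤ (L * ‖q‖ ^ 2) * ‖featGrad ψ r‖ ^ 2 := by
      calc (‖q‖ ^ 2) ^ 2 ≤ (‖featGrad ψ q‖ * ‖featGrad ψ r‖) ^ 2 := by gcongr
        _ = ‖featGrad ψ q‖ ^ 2 * ‖featGrad ψ r‖ ^ 2 := by ring
        _ ≤ _ := by gcongr; exact hL q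
    have h3 : ‖q‖ ^ 2 * ‖q‖ ^ 2 ≤ ‖q‖ ^ 2 * (L * ‖featGrad ψ r‖ ^ 2) := by linarith
    exact le_of_mul_le_mul_left h3 (by positivity)

/-- Duality: an operator and its transpose have the same norm. -/
lemma sum_inner_sq_le_of_norm_featGrad_le {L : ℝ} (hL0 : 0 ≤ L)
    (hL : ∀ r, ‖featGrad ψ r‖ ^ 2 ≤ L * ‖r‖ ^ 2) (v : F) :
    ∑ i, inner ℝ v (ψ i) ^ 2 ≤ L * ‖v‖ ^ 2 := by
  let q : EuclideanSpace ℝ (Fin n) := WithLp.toLp 2 fun i => inner ℝ v (ψ i)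
  have hq : ‖q‖ ^ 2 = ∑ i, inner ℝ v (ψ i) ^ 2 := by
    rw [EuclideanSpace.norm_sq_eq]
    exact Finset.sum_congr rfl fun i _ => by rw [Real.norm_eq_abs, sq_abs]
  have hq2 : ‖q‖ ^ 2 = inner ℝ v (featGrad ψ q) := by
    rw [hq, featGrad, inner_sum]
    exact Finset.sum_congr rfl fun i _ => by rw [inner_smul_right, pow_two]
  have hq3 : ‖q‖ ^ 2 ≤ ‖v‖ * ‖featGrad ψ q‖ := by
    rw [hq2]; exact real_inner_le_norm _ _
  have hq4 : (‖q‖ ^ 2) ^ 2 ≤ ‖v‖ ^ 2 * (L * ‖q‖ ^ 2) := by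
    calc _ ≤ (‖v‖ * ‖featGrad ψ q‖) ^ 2 := by gcongr
      _ = ‖v‖ ^ 2 * ‖featGrad ψ q‖ ^ 2 := by ring
      _ ≤ _ := by gcongr; exact hL q
  rw [← hq]
  rcases (norm_nonneg q).eq_or_lt with hz | hz
  · rw [← hz, zero_pow two_ne_zero]; positivity
  · have h3 : ‖q‖ ^ 2 * ‖q‖ ^ 2 ≤ ‖q‖ ^ 2 * (L * ‖v‖ ^ 2) := by linarith
    exact le_of_mul_le_mul_left h3 (by positivity)

/-- The usual stability condition: the quadratic term s²‖Gr‖² is at most the decrease 2s‖Ψᵀr‖²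
produced by the linear term. -/
lemma norm_sub_smul_gramOp_le {L s : ℝ} (hL : ∀ r, ‖featGrad ψ r‖ ^ 2 ≤ L * ‖r‖ ^ 2) (hs : 0 ≤ s)
    (hsL : s * L ≤ 2) (r : EuclideanSpace ℝ (Fin n)) : ‖r - s • gramOp ψ r‖ ≤ ‖r‖ := by
  refine le_of_sq_le_sq ?_ (norm_nonneg _)
  rw [norm_sub_sq_real, inner_smul_right, inner_gramOp, real_inner_self_eq_norm_sq, norm_smul,
    mul_pow, Real.norm_eq_abs, sq_abs]
  have h1 := norm_gramOp_sq_le hL r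
  have h2 : s ^ 2 * ‖gramOp ψ r‖ ^ 2 ≤ s * 2 * ‖featGrad ψ r‖ ^ 2 := by
    calc s ^ 2 * ‖gramOp ψ r‖ ^ 2 ≤ s ^ 2 * (L * ‖featGrad ψ r‖ ^ 2) := by gcongr
      _ = s * (s * L) * ‖featGrad ψ r‖ ^ 2 := by ring
      _ ≤ _ := by gcongr
  linarith

/-- Under the step condition 3/2 instead of 2, a decrease of s/2 · ‖Gr‖² is left over, and the
curvature bound `hΛ` converts it into a contraction factor. The curvature is required only on the
range of Ψᵀ, so directions in the kernel of G are harmless. -/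
lemma norm_featGrad_step_sq_le {L s Λ : ℝ} (hL : ∀ r, ‖featGrad ψ r‖ ^ 2 ≤ L * ‖r‖ ^ 2)
    (hs : 0 ≤ s) (hsL : s * L ≤ 3 / 2)
    (hΛ : ∀ r, Λ * ‖featGrad ψ r‖ ^ 2 ≤ ‖gramOp ψ r‖ ^ 2) (r : EuclideanSpace ℝ (Fin n)) :
    ‖featGrad ψ (r - s • gramOp ψ r)‖ ^ 2 ≤ Real.exp (-(s * Λ / 2)) * ‖featGrad ψ r‖ ^ 2 := by
  have h1 : s ^ 2 * ‖featGrad ψ (gramOp ψ r)‖ ^ 2 ≤ s * (3 / 2) * ‖gramOp ψ r‖ ^ 2 := by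
    calc _ ≤ s ^ 2 * (L * ‖gramOp ψ r‖ ^ 2) := by gcongr; exact hL _
      _ = s * (s * L) * ‖gramOp ψ r‖ ^ 2 := by ring
      _ ≤ _ := by gcongr
  have h2 : inner ℝ (featGrad ψ r) (featGrad ψ (gramOp ψ r)) = ‖gramOp ψ r‖ ^ 2 := by
    rw [real_inner_comm, ← inner_gramOp, real_inner_self_eq_norm_sq]
  have h3 := mul_le_mul_of_nonneg_left (hΛ r) hs
  have h4 : 1 - s * Λ / 2 ≤ Real.exp (-(s * Λ / 2)) := by
    have := Real.add_one_le_exp (-(s * Λ / 2))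
    linarith
  have h5 := mul_le_mul_of_nonneg_right h4 (sq_nonneg ‖featGrad ψ r‖)
  rw [featGrad_sub, featGrad_smul, norm_sub_sq_real, inner_smul_right, h2, norm_smul, mul_pow,
    Real.norm_eq_abs, sq_abs]
  linarith

/-- Residuals of gradient descent with features `ψ` stay close to those with features `ϕ` if the
Gram operators are close; the gradients of the latter decay exponentially. -/
lemma residual_dynamics {F' : Type*} [NormedAddCommGroup F'] [InnerProductSpace ℝ F']
    {ϕ : Fin n → F'} {L s Λ L' κ : ℝ} (hs : 0 ≤ s)
    (hL : ∀ r, ‖featGrad ψ r‖ ^ 2 ≤ L * ‖r‖ ^ 2) (hsL : s * L ≤ 2)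
    (hL' : ∀ r, ‖featGrad ϕ r‖ ^ 2 ≤ L' * ‖r‖ ^ 2) (hsL' : s * L' ≤ 3 / 2)
    (hΛ : ∀ r, Λ * ‖featGrad ϕ r‖ ^ 2 ≤ ‖gramOp ϕ r‖ ^ 2)
    (hκ : ∀ r, ‖gramOp ψ r - gramOp ϕ r‖ ≤ κ * ‖r‖) (hκ0 : 0 ≤ κ)
    {r : ℕ → EuclideanSpace ℝ (Fin n)} (hr : ∀ t, r (t + 1) = r t - s • gramOp ψ (r t)) (T : ℕ) :
    ‖r T‖ ≤ ‖r 0‖ ∧ ∃ r' : EuclideanSpace ℝ (Fin n), ‖r T - r'‖ ≤ T * (s * κ * ‖r 0‖) ∧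
      ‖featGrad ϕ r'‖ ^ 2 ≤ Real.exp (-(s * Λ / 2) * T) * ‖featGrad ϕ (r 0)‖ ^ 2 := by
  induction T with
  | zero => exact ⟨le_rfl, r 0, by simp, by simp⟩
  | succ T ih =>
    obtain ⟨h1, r', h2, h3⟩ := ih
    refine ⟨?_, r' - s • gramOp ϕ r', ?_, ?_⟩
    · rw [hr]; exact (norm_sub_smul_gramOp_le hL hs hsL _).trans h1
    -- The old discrepancy goes through a nonexpansive step of the ϕ-dynamics, and the fresh error
    -- is the difference of Gram operators at r_T, whose norm is at most ‖r_0‖. Hence errors only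
    -- add up.
    · have e : r (T + 1) - (r' - s • gramOp ϕ r') =
          ((r T - r') - s • gramOp ϕ (r T - r')) - s • (gramOp ψ (r T) - gramOp ϕ (r T)) := by
        rw [hr, gramOp_sub]; module
      rw [e]
      refine (norm_sub_le _ _).trans ?_
      have h4 := norm_sub_smul_gramOp_le hL' hs (hsL'.trans (by norm_num)) (r T - r')
      have h5 : ‖s • (gramOp ψ (r T) - gramOp ϕ (r T))‖ ≤ s * κ * ‖r 0‖ := by
        rw [norm_smul, Real.norm_of_nonneg hs, mul_assoc]
        gcongr
        exact (hκ _).trans (by gcongr)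
      push_cast
      linarith
    · refine (norm_featGrad_step_sq_le hL' hs hsL' hΛ r').trans ?_
      calc _ ≤ Real.exp (-(s * Λ / 2)) * (Real.exp (-(s * Λ / 2) * T) * ‖featGrad ϕ (r 0)‖ ^ 2) := by
            gcongr
        _ = _ := by
            rw [← mul_assoc, ← Real.exp_add]
            push_cast
            ring_nf

end ResidualDynamics

/-! ### Three-block features -/

section BlockFeatures

variable {d n : ℕ}

/-- A feature vector with an input block, a bias coordinate and a norm coordinate. -/
def blockFeat (u : EuclideanSpace ℝ (Fin d)) (a b : ℝ) : EuclideanSpace ℝ (Fin d ⊕ Fin 2) :=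
  WithLp.toLp 2 (Sum.elim u.ofLp ![a, b])

lemma inner_blockFeat (u u' : EuclideanSpace ℝ (Fin d)) (a b a' b' : ℝ) :
    inner ℝ (blockFeat u a b) (blockFeat u' a' b') = inner ℝ u u' + a * a' + b * b' := by
  simp [blockFeat, PiLp.inner_apply, Fintype.sum_sum_type, Fin.sum_univ_two]
  ring

lemma norm_blockFeat_sq (u : EuclideanSpace ℝ (Fin d)) (a b : ℝ) :
    ‖blockFeat u a b‖ ^ 2 = ‖u‖ ^ 2 + a ^ 2 + b ^ 2 := by
  rw [← real_inner_self_eq_norm_sq, inner_blockFeat, real_inner_self_eq_norm_sq]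
  ring

lemma featGrad_blockFeat (u : Fin n → EuclideanSpace ℝ (Fin d)) (a b : Fin n → ℝ)
    (r : EuclideanSpace ℝ (Fin n)) :
    featGrad (fun i => blockFeat (u i) (a i) (b i)) r =
      blockFeat (featGrad u r) (∑ i, a i * r i) (∑ i, b i * r i) := by
  ext j
  rcases j with j | j
  · simp [featGrad, blockFeat]
  · fin_cases j <;> simp [featGrad, blockFeat, mul_comm]

lemma featGrad_const_smul (s : ℝ) (x : Fin n → EuclideanSpace ℝ (Fin d))
    (r : EuclideanSpace ℝ (Fin n)) : featGrad (fun i => s • x i) r = s • featGrad x r := by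
  simp only [featGrad, Finset.smul_sum]
  exact Finset.sum_congr rfl fun i _ => smul_comm _ _ _

lemma sq_sum_mul_le_of_abs_le {a : Fin n → ℝ} {A : ℝ} (ha : ∀ i, |a i| ≤ A)
    (r : EuclideanSpace ℝ (Fin n)) : (∑ i, a i * r i) ^ 2 ≤ A ^ 2 * n * ‖r‖ ^ 2 := by
  refine (Finset.sum_mul_sq_le_sq_mul_sq _ _ _).trans ?_
  rw [EuclideanSpace.norm_sq_eq]
  simp only [Real.norm_eq_abs, sq_abs]
  gcongr
  calc _ ≤ ∑ _i : Fin n, A ^ 2 :=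
        Finset.sum_le_sum fun i _ => sq_le_sq' (abs_le.1 (ha i)).1 (abs_le.1 (ha i)).2
    _ = _ := by simp; ring

lemma abs_sum_mul_le_of_abs_le {a : Fin n → ℝ} {A : ℝ} (hA : 0 ≤ A) (ha : ∀ i, |a i| ≤ A)
    (r : EuclideanSpace ℝ (Fin n)) : |∑ i, a i * r i| ≤ A * √n * ‖r‖ := by
  refine abs_le_of_sq_le_sq ?_ (by positivity)
  refine (sq_sum_mul_le_of_abs_le ha r).trans (le_of_eq ?_)
  rw [mul_pow, mul_pow, Real.sq_sqrt (Nat.cast_nonneg n)]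

end BlockFeatures

/-! ### Least squares with nearly collinear bias and norm coordinates -/

variable {d n : ℕ}

/-- Regular inputs for least squares on the features `(s x, k₀, θ₀ + p)`. -/
structure LinRegular (x : Fin n → EuclideanSpace ℝ (Fin d)) (p : Fin n → ℝ)
    (s k₀ θ₀ P K c₀ η : ℝ) : Prop where
  n_pos : 0 < n
  c₀_pos : 0 < c₀
  K_nonneg : 0 ≤ K
  η_pos : 0 < η
  P_nonneg : 0 ≤ P
  upper : ∀ r, ‖featGrad x r‖ ^ 2 ≤ K * n * ‖r‖ ^ 2
  lower : ∀ u t, c₀ * n * ‖u‖ ^ 2 ≤ ∑ i, (inner ℝ u (x i) - t) ^ 2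
  p_le : ∀ i, |p i| ≤ P
  P_le : P ≤ |θ₀|
  degenerate : θ₀ = 0 → k₀ = 0
  P_small : (6 + 12 * (K / c₀)) * P ^ 2 ≤ θ₀ ^ 2
  s_small : θ₀ ≠ 0 → s ^ 2 * c₀ * (6 + 12 * (K / c₀)) ≤ 4 * θ₀ ^ 2
  step : η * (s ^ 2 * K + k₀ ^ 2 + (1 + k₀ ^ 2 / θ₀ ^ 2) * (|θ₀| + P) ^ 2) ≤ 3 / 2

namespace LinRegular

variable {x : Fin n → EuclideanSpace ℝ (Fin d)} {p : Fin n → ℝ} {s k₀ θ₀ P K c₀ η : ℝ}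

/-- The features of the linear model. -/
def feat (x : Fin n → EuclideanSpace ℝ (Fin d)) (p : Fin n → ℝ) (s k₀ θ₀ : ℝ) (i : Fin n) :
    EuclideanSpace ℝ (Fin d ⊕ Fin 2) :=
  blockFeat (s • x i) k₀ (θ₀ + p i)

/-- Features in which the bias coordinate is absorbed into the norm coordinate. -/
def feat' (x : Fin n → EuclideanSpace ℝ (Fin d)) (p : Fin n → ℝ) (s k₀ θ₀ : ℝ) (i : Fin n) :
    EuclideanSpace ℝ (Fin d ⊕ Fin 2) :=
  blockFeat (s • x i) 0 (√(1 + k₀ ^ 2 / θ₀ ^ 2) * (θ₀ + p i))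

lemma featGrad_feat (r : EuclideanSpace ℝ (Fin n)) :
    featGrad (feat x p s k₀ θ₀) r =
      blockFeat (s • featGrad x r) (∑ i, k₀ * r i) (∑ i, (θ₀ + p i) * r i) := by
  unfold feat
  rw [featGrad_blockFeat, featGrad_const_smul]

lemma featGrad_feat' (r : EuclideanSpace ℝ (Fin n)) :
    featGrad (feat' x p s k₀ θ₀) r =
      blockFeat (s • featGrad x r) 0 (√(1 + k₀ ^ 2 / θ₀ ^ 2) * ∑ i, (θ₀ + p i) * r i) := by
  unfold feat'
  rw [featGrad_blockFeat, featGrad_const_smul]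
  simp [Finset.mul_sum, mul_assoc]

lemma τ_sq : √(1 + k₀ ^ 2 / θ₀ ^ 2) ^ 2 = 1 + k₀ ^ 2 / θ₀ ^ 2 := Real.sq_sqrt (by positivity)

lemma gramOp_feat_apply (r : EuclideanSpace ℝ (Fin n)) (i : Fin n) :
    gramOp (feat x p s k₀ θ₀) r i =
      s ^ 2 * inner ℝ (x i) (featGrad x r) + k₀ ^ 2 * ∑ j, r j +
        (θ₀ + p i) * ∑ j, (θ₀ + p j) * r j := by
  simp only [gramOp, featGrad_feat, feat, inner_blockFeat, inner_smul_left, inner_smul_right,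
    RCLike.conj_to_real, ← Finset.mul_sum]
  ring

lemma gramOp_feat'_apply (r : EuclideanSpace ℝ (Fin n)) (i : Fin n) :
    gramOp (feat' x p s k₀ θ₀) r i =
      s ^ 2 * inner ℝ (x i) (featGrad x r) +
        (1 + k₀ ^ 2 / θ₀ ^ 2) * ((θ₀ + p i) * ∑ j, (θ₀ + p j) * r j) := by
  simp only [gramOp, featGrad_feat', feat', inner_blockFeat, inner_smul_left, inner_smul_right,
    RCLike.conj_to_real]
  linear_combination ((θ₀ + p i) * ∑ j, (θ₀ + p j) * r j) * τ_sq (k₀ := k₀) (θ₀ := θ₀)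

lemma abs_sum_le (r : EuclideanSpace ℝ (Fin n)) : |∑ i, r i| ≤ √n * ‖r‖ := by
  have := abs_sum_mul_le_of_abs_le (a := fun _ : Fin n => 1) zero_le_one (fun _ => by simp) r
  simpa using this

section

variable (h : LinRegular x p s k₀ θ₀ P K c₀ η)
include h

lemma natCast_pos : (0 : ℝ) < n := by exact_mod_cast h.n_pos

lemma norm_coord_le (i : Fin n) : |θ₀ + p i| ≤ |θ₀| + P :=
  (abs_add_le _ _).trans (by linarith [h.p_le i])

lemma norm_featGrad_feat_le (r : EuclideanSpace ℝ (Fin n)) :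
    ‖featGrad (feat x p s k₀ θ₀) r‖ ^ 2 ≤
      n * (s ^ 2 * K + k₀ ^ 2 + (|θ₀| + P) ^ 2) * ‖r‖ ^ 2 := by
  rw [featGrad_feat, norm_blockFeat_sq, norm_smul, mul_pow, Real.norm_eq_abs, sq_abs]
  have h1 := mul_le_mul_of_nonneg_left (h.upper r) (sq_nonneg s)
  have h2 := sq_sum_mul_le_of_abs_le (a := fun _ => k₀) (fun _ => le_refl |k₀|) r
  have h3 := sq_sum_mul_le_of_abs_le h.norm_coord_le r
  rw [sq_abs] at h2
  linarith

lemma norm_featGrad_feat'_le (r : EuclideanSpace ℝ (Fin n)) :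
    ‖featGrad (feat' x p s k₀ θ₀) r‖ ^ 2 ≤
      n * (s ^ 2 * K + (1 + k₀ ^ 2 / θ₀ ^ 2) * (|θ₀| + P) ^ 2) * ‖r‖ ^ 2 := by
  rw [featGrad_feat', norm_blockFeat_sq, norm_smul, mul_pow, mul_pow, τ_sq, Real.norm_eq_abs, sq_abs]
  have h1 := mul_le_mul_of_nonneg_left (h.upper r) (sq_nonneg s)
  have h3 := sq_sum_mul_le_of_abs_le h.norm_coord_le r
  have h4 : 0 ≤ 1 + k₀ ^ 2 / θ₀ ^ 2 := by positivity
  have h5 := mul_le_mul_of_nonneg_left h3 h4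
  linarith

/-- If every `p i` were zero, both constant coordinates would give rank-one operators proportional
to 11ᵀ, with the same total weight k₀² + θ₀². The difference is therefore first order in p/θ₀ and
carries the factor k₀². -/
lemma gramOp_close (r : EuclideanSpace ℝ (Fin n)) :
    ‖gramOp (feat x p s k₀ θ₀) r - gramOp (feat' x p s k₀ θ₀) r‖ ≤
      3 * k₀ ^ 2 * n * (P / |θ₀|) * ‖r‖ := by
  have hP := h.P_nonneg
  -- With θ₀ = 0 also k₀ = 0, and division by zero being zero makes the absorbing factor 1, so the
  -- operators coincide.
  by_cases h0 : θ₀ = 0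
  · have hk := h.degenerate h0
    have : gramOp (feat x p s k₀ θ₀) r - gramOp (feat' x p s k₀ θ₀) r = 0 := by
      ext i
      rw [PiLp.sub_apply, gramOp_feat_apply, gramOp_feat'_apply, hk]
      simp
    rw [this, hk]; simp
  · have hθ : 0 < |θ₀| := abs_pos.2 h0
    set ρ := P / |θ₀| with hρ
    have hρ0 : 0 ≤ ρ := by positivity
    have hρ1 : ρ ≤ 1 := by rw [hρ, div_le_one hθ]; exact h.P_le
    have hbound : ∀ i, |(gramOp (feat x p s k₀ θ₀) r - gramOp (feat' x p s k₀ θ₀) r) i| ≤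
        3 * k₀ ^ 2 * √n * ρ * ‖r‖ := by
      intro i
      have e : (gramOp (feat x p s k₀ θ₀) r - gramOp (feat' x p s k₀ θ₀) r) i =
          -(k₀ ^ 2 * (p i / θ₀ * ∑ j, r j + (1 + p i / θ₀) * ((∑ j, p j * r j) / θ₀))) := by
        have e2 : ∑ j, (θ₀ + p j) * r j = θ₀ * ∑ j, r j + ∑ j, p j * r j := by
          simp only [add_mul, Finset.sum_add_distrib, Finset.mul_sum]
        rw [PiLp.sub_apply, gramOp_feat_apply, gramOp_feat'_apply, e2]
        field_simp
        ring
      have hp : |p i / θ₀| ≤ ρ := by rw [abs_div]; exact div_le_div_of_nonneg_right (h.p_le i) hθ.le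
      have h1 : |1 + p i / θ₀| ≤ 2 := (abs_add_le _ _).trans (by rw [abs_one]; linarith)
      have h2 : |(∑ j, p j * r j) / θ₀| ≤ ρ * (√n * ‖r‖) := by
        rw [abs_div, div_le_iff₀ hθ]
        refine (abs_sum_mul_le_of_abs_le hP h.p_le r).trans (le_of_eq ?_)
        rw [hρ]; field_simp
      rw [e, abs_neg, abs_mul, abs_of_nonneg (sq_nonneg k₀)]
      calc _ ≤ k₀ ^ 2 * (ρ * (√n * ‖r‖) + 2 * (ρ * (√n * ‖r‖))) := by
            gcongr
            refine (abs_add_le _ _).trans ?_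
            rw [abs_mul, abs_mul]
            have := abs_sum_le r
            gcongr
        _ = _ := by ring
    refine le_of_sq_le_sq ?_ (by positivity)
    rw [EuclideanSpace.norm_sq_eq]
    calc _ ≤ ∑ _i : Fin n, (3 * k₀ ^ 2 * √n * ρ * ‖r‖) ^ 2 := by
          refine Finset.sum_le_sum fun i _ => ?_
          rw [Real.norm_eq_abs]
          have := hbound i
          gcongr
      _ = n * (3 * k₀ ^ 2 * √n * ρ * ‖r‖) ^ 2 := by simp
      _ = n * (√n) ^ 2 * (3 * k₀ ^ 2 * ρ * ‖r‖) ^ 2 := by ring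
      _ = _ := by rw [Real.sq_sqrt (Nat.cast_nonneg n)]; ring

/-- The entries of Gr are the values on the data of the predictor with weights (su, τb). Its input
part is recovered from the covariance lower bound, with the constant part as free shift; its
constant part is then recovered by subtraction, using the upper bound. Smallness of `P` against `θ₀`
absorbs the fluctuation of the norm coordinate, and smallness of `s` makes the input block the slow
one. -/
lemma le_norm_gramOp (r : EuclideanSpace ℝ (Fin n)) :
    n * (c₀ * s ^ 2 / 8) * ‖featGrad (feat' x p s k₀ θ₀) r‖ ^ 2 ≤
      ‖gramOp (feat' x p s k₀ θ₀) r‖ ^ 2 := by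
  have hn := h.natCast_pos
  have hc := h.c₀_pos
  have hK := h.K_nonneg
  set τ := √(1 + k₀ ^ 2 / θ₀ ^ 2) with hτ
  have hτ1 : 1 ≤ τ ^ 2 := by rw [τ_sq]; have : 0 ≤ k₀ ^ 2 / θ₀ ^ 2 := by positivity
                             linarith
  set u := s • featGrad x r with hu
  set b := τ * ∑ i, (θ₀ + p i) * r i with hb
  let t (i : Fin n) : ℝ := inner ℝ (s • u) (x i) + τ * b * (θ₀ + p i)
  have hgr : ∀ i, gramOp (feat' x p s k₀ θ₀) r i = t i := by
    intro i
    simp only [gramOp, featGrad_feat', feat', inner_blockFeat, t, inner_smul_left, RCLike.conj_to_real,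
      ← hu, ← hb, ← hτ]
    rw [real_inner_comm]
    ring
  have hQ : ‖gramOp (feat' x p s k₀ θ₀) r‖ ^ 2 = ∑ i, t i ^ 2 := by
    rw [EuclideanSpace.norm_sq_eq]
    exact Finset.sum_congr rfl fun i _ => by rw [hgr, Real.norm_eq_abs, sq_abs]
  rw [hQ, featGrad_feat', norm_blockFeat_sq, ← hu, ← hτ, ← hb]
  set Q := ∑ i, t i ^ 2 with hQdef
  have hQ0 : 0 ≤ Q := Finset.sum_nonneg fun i _ => sq_nonneg _
  have hp2 : ∑ i, p i ^ 2 ≤ n * P ^ 2 := by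
    calc _ ≤ ∑ _i : Fin n, P ^ 2 :=
          Finset.sum_le_sum fun i _ => sq_le_sq' (abs_le.1 (h.p_le i)).1 (abs_le.1 (h.p_le i)).2
      _ = _ := by simp
  have hsu : ‖s • u‖ ^ 2 = s ^ 2 * ‖u‖ ^ 2 := by
    rw [norm_smul, mul_pow, Real.norm_eq_abs, sq_abs]
  -- The shift is -τbθ₀, the constant part of the predictor; only the fluctuation `p` remains as an
  -- error.
  have h1 : c₀ * n * (s ^ 2 * ‖u‖ ^ 2) ≤ 2 * Q + 2 * ((τ * b) ^ 2 * (n * P ^ 2)) := by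
    have := h.lower (s • u) (-(τ * b * θ₀))
    rw [hsu] at this
    refine this.trans ?_
    calc _ ≤ ∑ i, (2 * t i ^ 2 + 2 * (τ * b) ^ 2 * p i ^ 2) := by
          refine Finset.sum_le_sum fun i _ => ?_
          have : inner ℝ (s • u) (x i) - -(τ * b * θ₀) = t i - τ * b * p i := by
            simp only [t]; ring
          rw [this]
          nlinarith [sq_nonneg (t i + τ * b * p i)]
      _ = 2 * Q + 2 * (τ * b) ^ 2 * ∑ i, p i ^ 2 := by
          rw [Finset.sum_add_distrib, ← Finset.mul_sum, ← Finset.mul_sum]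
      _ ≤ 2 * Q + 2 * (τ * b) ^ 2 * (n * P ^ 2) := by gcongr
      _ = _ := by ring
  by_cases h0 : θ₀ = 0
  · have hP : P = 0 := le_antisymm (by simpa [h0] using h.P_le) h.P_nonneg
    have hb0 : b = 0 := by
      have hp0 : ∀ i, p i = 0 := fun i => abs_nonpos_iff.1 (hP ▸ h.p_le i)
      simp [hb, h0, hp0]
    rw [hP, hb0] at h1
    rw [hb0]
    have h3 : 0 ≤ c₀ * n * (s ^ 2 * ‖u‖ ^ 2) := by positivity
    linarith
  · have hθ2 : 0 < θ₀ ^ 2 := by positivity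
    set B := (τ * b) ^ 2 with hB
    have hB0 : 0 ≤ B := sq_nonneg _
    have hbB : b ^ 2 ≤ B := by
      rw [hB, mul_pow]
      nlinarith [sq_nonneg b]
    have hup : ∑ i, inner ℝ (s • u) (x i) ^ 2 ≤ K * n * (s ^ 2 * ‖u‖ ^ 2) := by
      rw [← hsu]; exact sum_inner_sq_le_of_norm_featGrad_le (by positivity) h.upper _
    have h2 : n * (θ₀ ^ 2 * B) ≤ 3 * Q + 3 * (K * n * (s ^ 2 * ‖u‖ ^ 2)) + 3 * (B * (n * P ^ 2)) := by
      calc n * (θ₀ ^ 2 * B) = ∑ _i : Fin n, (τ * b * θ₀) ^ 2 := by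
            rw [Finset.sum_const, Finset.card_univ, Fintype.card_fin, nsmul_eq_mul, hB]; ring
        _ ≤ ∑ i, (3 * t i ^ 2 + 3 * inner ℝ (s • u) (x i) ^ 2 + 3 * B * p i ^ 2) := by
            refine Finset.sum_le_sum fun i _ => ?_
            have : τ * b * θ₀ = t i - inner ℝ (s • u) (x i) - τ * b * p i := by simp only [t]; ring
            rw [this, hB]
            nlinarith [sq_nonneg (t i + inner ℝ (s • u) (x i)), sq_nonneg (t i + τ * b * p i),
              sq_nonneg (inner ℝ (s • u) (x i) - τ * b * p i)]
        _ = 3 * Q + 3 * ∑ i, inner ℝ (s • u) (x i) ^ 2 + 3 * B * ∑ i, p i ^ 2 := by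
            rw [Finset.sum_add_distrib, Finset.sum_add_distrib, ← Finset.mul_sum, ← Finset.mul_sum,
              ← Finset.mul_sum]
        _ ≤ 3 * Q + 3 * (K * n * (s ^ 2 * ‖u‖ ^ 2)) + 3 * B * (n * P ^ 2) := by gcongr
        _ = _ := by ring
    set Z := s ^ 2 * ‖u‖ ^ 2 with hZ
    set k := K / c₀ with hk
    have hKk : K = k * c₀ := by rw [hk]; field_simp
    have hk0 : 0 ≤ k := by positivity
    have h3 : 3 * (K * n * Z) ≤ 3 * k * (2 * Q + 2 * (B * (n * P ^ 2))) := by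
      have := mul_le_mul_of_nonneg_left h1 (by positivity : 0 ≤ 3 * k)
      rw [hKk]; linarith
    -- With `h1` inserted in `h2`, the fluctuations enter with the factor (3 + 6k)P², at most half
    -- of θ₀², so they are absorbed. This fixes the constant 6 + 12K/c₀ in `P_small`.
    have h4 : (n * B) * ((6 + 12 * k) * P ^ 2) ≤ (n * B) * θ₀ ^ 2 := by
      have := h.P_small
      gcongr
    have h5 : n * (θ₀ ^ 2 * B) ≤ (6 + 12 * k) * Q := by linarith
    have h6 : n * (P ^ 2 * B) ≤ Q := by
      have h7 : (6 + 12 * k) * (n * (P ^ 2 * B)) ≤ (6 + 12 * k) * Q := by linarith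
      exact le_of_mul_le_mul_left h7 (by positivity)
    have h7 : c₀ * n * Z ≤ 4 * Q := by linarith
    have h8 : n * c₀ * s ^ 2 * B ≤ 4 * Q := by
      have h9 := mul_le_mul_of_nonneg_left (h.s_small h0) (by positivity : 0 ≤ n * B)
      have h10 : (6 + 12 * k) * (n * c₀ * s ^ 2 * B) ≤ (6 + 12 * k) * (4 * Q) := by
        linarith
      exact le_of_mul_le_mul_left h10 (by positivity)
    have h9 : n * c₀ * s ^ 2 * b ^ 2 ≤ n * c₀ * s ^ 2 * B := by gcongr
    have h10 : n * (c₀ * s ^ 2 / 8) * (‖u‖ ^ 2 + 0 ^ 2 + b ^ 2) =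
        1 / 8 * (c₀ * n * Z) + 1 / 8 * (n * c₀ * s ^ 2 * b ^ 2) := by rw [hZ]; ring
    rw [h10]
    linarith

/-- The residuals of gradient descent after `T` steps are almost orthogonal to the inputs and,
unless `θ₀ = 0`, to the constants. -/
theorem residual_bounds (hs : s ≠ 0) {y : Fin n → ℝ} (hy : ∀ i, y i ^ 2 = 1) (hy0 : ∑ i, y i = 0)
    {r : ℕ → EuclideanSpace ℝ (Fin n)} (hr0 : ∀ i, r 0 i = -y i)
    (hr : ∀ t, r (t + 1) = r t - (η / n) • gramOp (feat x p s k₀ θ₀) (r t)) (T : ℕ) {μ δ₁ : ℝ}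
    (hμ : Real.exp (-(η * (c₀ * s ^ 2 / 8) / 2) * T) ≤ μ ^ 2) (hμ0 : 0 ≤ μ)
    (hδ₁ : 3 * (η * T) * k₀ ^ 2 * (P / |θ₀|) ≤ δ₁) :
    ‖r T‖ ^ 2 ≤ n ∧
    ‖featGrad x (r T)‖ ≤
      (μ * √(K + (1 + k₀ ^ 2 / θ₀ ^ 2) * P ^ 2 / s ^ 2) + √K * δ₁) * n ∧
    |θ₀| * |∑ i, r T i| ≤
      (μ * √(s ^ 2 * K + (1 + k₀ ^ 2 / θ₀ ^ 2) * P ^ 2) + 2 * |θ₀| * δ₁ + P) * n := by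
  have hn := h.natCast_pos
  have hη := h.η_pos
  have hP := h.P_nonneg
  have hK := h.K_nonneg
  set τ2 := 1 + k₀ ^ 2 / θ₀ ^ 2 with hτ2
  have hτ1 : 1 ≤ τ2 := by have : 0 ≤ k₀ ^ 2 / θ₀ ^ 2 := by positivity
                          linarith
  have hnorm0 : ‖r 0‖ ^ 2 = n := by
    rw [EuclideanSpace.norm_sq_eq]
    simp [hr0, hy]
  have hr0n : ‖r 0‖ = √n := by rw [← hnorm0, Real.sqrt_sq (norm_nonneg _)]
  have hnn : √(n : ℝ) * √n = n := Real.mul_self_sqrt hn.le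
  have hδ0 : 0 ≤ δ₁ := le_trans (by positivity) hδ₁
  have step1 : η / n * (n * (s ^ 2 * K + k₀ ^ 2 + (|θ₀| + P) ^ 2)) ≤ 2 := by
    calc _ = η * (s ^ 2 * K + k₀ ^ 2 + 1 * (|θ₀| + P) ^ 2) := by field_simp
      _ ≤ η * (s ^ 2 * K + k₀ ^ 2 + τ2 * (|θ₀| + P) ^ 2) := by gcongr
      _ ≤ 2 := h.step.trans (by norm_num)
  have step2 : η / n * (n * (s ^ 2 * K + τ2 * (|θ₀| + P) ^ 2)) ≤ 3 / 2 := by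
    calc _ = η * (s ^ 2 * K + 0 + τ2 * (|θ₀| + P) ^ 2) := by field_simp; ring
      _ ≤ η * (s ^ 2 * K + k₀ ^ 2 + τ2 * (|θ₀| + P) ^ 2) := by gcongr; positivity
      _ ≤ _ := h.step
  obtain ⟨h1, r', h2, h3⟩ := residual_dynamics (s := η / n) (by positivity) h.norm_featGrad_feat_le
    step1 h.norm_featGrad_feat'_le step2 h.le_norm_gramOp h.gramOp_close (by positivity) hr T
  have hrT : ‖r T‖ ≤ √n := h1.trans hr0n.le
  have hclose : ‖r T - r'‖ ≤ δ₁ * √n := by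
    refine h2.trans ?_
    rw [hr0n]
    calc _ = 3 * (η * T) * k₀ ^ 2 * (P / |θ₀|) * √n := by field_simp
      _ ≤ _ := by gcongr
  have hexp : Real.exp (-(η / n * (n * (c₀ * s ^ 2 / 8)) / 2) * T) ≤ μ ^ 2 := by
    have : η / n * (n * (c₀ * s ^ 2 / 8)) = η * (c₀ * s ^ 2 / 8) := by field_simp
    rw [this]; exact hμ
  have hg0 : ‖featGrad (feat' x p s k₀ θ₀) (r 0)‖ ^ 2 ≤ n ^ 2 * (s ^ 2 * K + τ2 * P ^ 2) := by
    rw [featGrad_feat', norm_blockFeat_sq, norm_smul, mul_pow, mul_pow, τ_sq, ← hτ2, Real.norm_eq_abs,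
      sq_abs]
    have a1 : ‖featGrad x (r 0)‖ ^ 2 ≤ K * n * n := by rw [← hnorm0]; simpa [hnorm0] using h.upper (r 0)
    -- The labels sum to zero, so θ₀ drops out of the initial gradient, which is then of size s²K +
    -- P² up to constants. Otherwise division by s² would cost a factor d.
    have a2 : ∑ i, (θ₀ + p i) * r 0 i = ∑ i, p i * r 0 i := by
      simp only [add_mul, Finset.sum_add_distrib, ← Finset.mul_sum]
      have : ∑ i, r 0 i = 0 := by simp [hr0, hy0]
      rw [this]; ring
    have a3 := sq_sum_mul_le_of_abs_le h.p_le (r 0)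
    rw [hnorm0] at a3
    rw [a2]
    calc _ ≤ s ^ 2 * (K * n * n) + 0 ^ 2 + τ2 * (P ^ 2 * n * n) := by gcongr
      _ = _ := by ring
  have hgT : ‖featGrad (feat' x p s k₀ θ₀) r'‖ ^ 2 ≤
      (μ * n) ^ 2 * (s ^ 2 * K + τ2 * P ^ 2) := by
    refine h3.trans ?_
    calc _ ≤ μ ^ 2 * (n ^ 2 * (s ^ 2 * K + τ2 * P ^ 2)) := by gcongr
      _ = _ := by ring
  rw [featGrad_feat', norm_blockFeat_sq, norm_smul, mul_pow, mul_pow, τ_sq, ← hτ2, Real.norm_eq_abs,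
      sq_abs] at hgT
  refine ⟨?_, ?_, ?_⟩
  · rw [← Real.sq_sqrt hn.le]
    gcongr
  · have b1 : ‖featGrad x r'‖ ≤ μ * √(K + τ2 * P ^ 2 / s ^ 2) * n := by
      refine le_of_sq_le_sq ?_ (by positivity)
      rw [mul_pow, mul_pow, Real.sq_sqrt (by positivity)]
      have hs2 : 0 < s ^ 2 := by positivity
      have : s ^ 2 * ‖featGrad x r'‖ ^ 2 ≤ s ^ 2 * (μ ^ 2 * (K + τ2 * P ^ 2 / s ^ 2) * n ^ 2) := by
        have e : s ^ 2 * (μ ^ 2 * (K + τ2 * P ^ 2 / s ^ 2) * n ^ 2) =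
            (μ * n) ^ 2 * (s ^ 2 * K + τ2 * P ^ 2) := by field_simp
        rw [e]
        have : 0 ≤ τ2 * (∑ i, (θ₀ + p i) * r' i) ^ 2 := by positivity
        linarith
      exact le_of_mul_le_mul_left this hs2
    have b2 : ‖featGrad x (r T - r')‖ ≤ √K * δ₁ * n := by
      refine le_of_sq_le_sq ?_ (by positivity)
      refine (h.upper _).trans ?_
      calc K * n * ‖r T - r'‖ ^ 2 ≤ K * n * (δ₁ * √n) ^ 2 := by gcongr
        _ = K * δ₁ ^ 2 * n * (√n * √n) := by ring
        _ = K * δ₁ ^ 2 * n * n := by rw [hnn]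
        _ = _ := by rw [mul_pow, mul_pow, Real.sq_sqrt hK]; ring
    have e : featGrad x (r T) = featGrad x r' + featGrad x (r T - r') := by
      rw [featGrad_sub]; abel
    rw [e]
    refine (norm_add_le _ _).trans ?_
    linarith
  · have b1 : |∑ i, (θ₀ + p i) * r' i| ≤ μ * √(s ^ 2 * K + τ2 * P ^ 2) * n := by
      refine abs_le_of_sq_le_sq ?_ (by positivity)
      rw [mul_pow, mul_pow, Real.sq_sqrt (by positivity)]
      have a1 : 0 ≤ s ^ 2 * ‖featGrad x r'‖ ^ 2 := by positivity
      have a2 : (∑ i, (θ₀ + p i) * r' i) ^ 2 ≤ τ2 * (∑ i, (θ₀ + p i) * r' i) ^ 2 :=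
        le_mul_of_one_le_left (sq_nonneg _) hτ1
      linarith
    have b2 : |∑ i, (θ₀ + p i) * (r T - r') i| ≤ 2 * |θ₀| * δ₁ * n := by
      refine (abs_sum_mul_le_of_abs_le (by positivity) h.norm_coord_le _).trans ?_
      have := h.P_le
      calc (|θ₀| + P) * √n * ‖r T - r'‖ ≤ (2 * |θ₀|) * √n * (δ₁ * √n) := by gcongr; linarith
        _ = 2 * |θ₀| * δ₁ * (√n * √n) := by ring
        _ = _ := by rw [hnn]
    have b3 : |∑ i, p i * r T i| ≤ P * n := by
      refine (abs_sum_mul_le_of_abs_le hP h.p_le _).trans ?_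
      calc P * √n * ‖r T‖ ≤ P * √n * √n := by gcongr
        _ = _ := by rw [mul_assoc, hnn]
    have e : θ₀ * ∑ i, r T i = ∑ i, (θ₀ + p i) * r' i + ∑ i, (θ₀ + p i) * (r T - r') i -
        ∑ i, p i * r T i := by
      rw [Finset.mul_sum, ← Finset.sum_add_distrib, ← Finset.sum_sub_distrib]
      refine Finset.sum_congr rfl fun i _ => ?_
      rw [PiLp.sub_apply]; ring
    rw [← abs_mul, e]
    refine (abs_sub _ _).trans ((add_le_add_left (abs_add_le _ _) _).trans ?_)
    linarith

end
end LinRegular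

/-! ### The linear model in residual form -/

section LinearModel

variable {d n : ℕ} (φ : ℝ → ℝ)

/-- The scale of the input block of `psi`. -/
def inputScale (d : ℕ) : ℝ := √(2 / d : ℝ) * zeta φ

/-- The bias coordinate of `psi`. -/
def biasCoord (S : Matrix (Fin d) (Fin d) ℝ) : ℝ :=
  √(3 / (2 * d) : ℝ) * (theta1 φ * √((S ^ 2).trace / d))

/-- The variable part of the norm coordinate of `psi`. -/
def normDev (x : EuclideanSpace ℝ (Fin d)) : ℝ :=
  theta1 φ * (‖x‖ / √(d : ℝ) - 1) + theta2 φ * (‖x‖ / √(d : ℝ) - 1) ^ 2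

lemma psi_eq (S : Matrix (Fin d) (Fin d) ℝ) (x : EuclideanSpace ℝ (Fin d)) :
    WithLp.toLp 2 (psi φ S x) =
      blockFeat (inputScale φ d • x) (biasCoord φ S) (theta0 φ + normDev φ x) := by
  ext j
  rcases j with j | j
  · simp [psi, blockFeat, inputScale]
  · fin_cases j <;> simp [psi, blockFeat, biasCoord, normDev, add_assoc]

lemma linOut_eq (S : Matrix (Fin d) (Fin d) ℝ) (β : Fin d ⊕ Fin 2 → ℝ)
    (x : EuclideanSpace ℝ (Fin d)) :
    linOut φ S β x =
      inner ℝ (inputScale φ d • (WithLp.toLp 2 fun j => β (Sum.inl j) : EuclideanSpace ℝ (Fin d))) x +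
      biasCoord φ S * β (Sum.inr 0) + β (Sum.inr 1) * (theta0 φ + normDev φ x) := by
  simp only [linOut, psi, dotProduct, Fintype.sum_sum_type, Fin.sum_univ_two, PiLp.inner_apply]
  simp [biasCoord, normDev, inputScale]
  have : ∀ j, √2 / √d * zeta φ * x j * β (Sum.inl j) =
      x j * (√2 / √d * zeta φ * β (Sum.inl j)) := fun j => by ring
  simp only [this]
  ring

lemma toLp_mulVec_transpose (x : Fin n → EuclideanSpace ℝ (Fin d)) (r : EuclideanSpace ℝ (Fin n)) :
    WithLp.toLp 2 ((psiMatrix φ x)ᵀ *ᵥ r.ofLp) =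
      featGrad (fun i => (WithLp.toLp 2 (psi φ (dataCov x) (x i)) :
        EuclideanSpace ℝ (Fin d ⊕ Fin 2))) r := by
  ext a
  simp [featGrad, Matrix.mulVec, dotProduct, psiMatrix, mul_comm]

/-- The residuals of the linear model. -/
def linRes (η : ℝ) (x : Fin n → EuclideanSpace ℝ (Fin d)) (y : Fin n → ℝ) (t : ℕ) :
    EuclideanSpace ℝ (Fin n) :=
  WithLp.toLp 2 (psiMatrix φ x *ᵥ linGD φ η x y t - y)

lemma linGD_succ (η : ℝ) (x : Fin n → EuclideanSpace ℝ (Fin d)) (y : Fin n → ℝ) (t : ℕ) :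
    linGD φ η x y (t + 1) =
      linGD φ η x y t - (η / n) • ((psiMatrix φ x)ᵀ *ᵥ (linRes φ η x y t).ofLp) := by
  simp only [linGD, Function.iterate_succ_apply', linRes]

lemma linRes_zero (η : ℝ) (x : Fin n → EuclideanSpace ℝ (Fin d)) (y : Fin n → ℝ) (i : Fin n) :
    linRes φ η x y 0 i = -y i := by
  simp [linRes, linGD]

lemma linRes_succ (η : ℝ) (x : Fin n → EuclideanSpace ℝ (Fin d)) (y : Fin n → ℝ) (t : ℕ) :
    linRes φ η x y (t + 1) = linRes φ η x y t - (η / n) •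
      gramOp (LinRegular.feat x (fun i => normDev φ (x i)) (inputScale φ d)
        (biasCoord φ (dataCov x)) (theta0 φ)) (linRes φ η x y t) := by
  have hf : LinRegular.feat x (fun i => normDev φ (x i)) (inputScale φ d)
      (biasCoord φ (dataCov x)) (theta0 φ) =
      fun i => (WithLp.toLp 2 (psi φ (dataCov x) (x i)) : EuclideanSpace ℝ (Fin d ⊕ Fin 2)) := by
    funext i; rw [psi_eq]; rfl
  rw [hf]
  ext i
  simp only [linRes, linGD_succ, gramOp, Matrix.mulVec_sub, Matrix.mulVec_smul, PiLp.sub_apply,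
    PiLp.smul_apply, Pi.sub_apply, Pi.smul_apply, smul_eq_mul]
  have e : inner ℝ (WithLp.toLp 2 (psi φ (dataCov x) (x i)) : EuclideanSpace ℝ (Fin d ⊕ Fin 2))
      (featGrad (fun i => (WithLp.toLp 2 (psi φ (dataCov x) (x i)) :
        EuclideanSpace ℝ (Fin d ⊕ Fin 2))) (linRes φ η x y t)) =
      (psiMatrix φ x *ᵥ ((psiMatrix φ x)ᵀ *ᵥ (linRes φ η x y t).ofLp)) i := by
    rw [← toLp_mulVec_transpose]
    simp [PiLp.inner_apply, Matrix.mulVec, dotProduct, psiMatrix, mul_comm]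
  simp only [linRes] at e
  rw [e]
  simp only [Matrix.mulVec_sub, Pi.sub_apply]
  ring

lemma linGD_succ_inr (η : ℝ) (x : Fin n → EuclideanSpace ℝ (Fin d)) (y : Fin n → ℝ) (t : ℕ) :
    linGD φ η x y (t + 1) (Sum.inr 0) = linGD φ η x y t (Sum.inr 0) -
      η / n * (biasCoord φ (dataCov x) * ∑ i, linRes φ η x y t i) ∧
    linGD φ η x y (t + 1) (Sum.inr 1) = linGD φ η x y t (Sum.inr 1) -
      η / n * ∑ i, (theta0 φ + normDev φ (x i)) * linRes φ η x y t i := by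
  rw [linGD_succ]
  constructor
  · simp only [Pi.sub_apply, Pi.smul_apply, smul_eq_mul, Matrix.mulVec, dotProduct,
      Matrix.transpose_apply, psiMatrix, Matrix.of_apply, psi, Sum.elim_inr, Finset.mul_sum]
    rfl
  · simp only [Pi.sub_apply, Pi.smul_apply, smul_eq_mul, Matrix.mulVec, dotProduct,
      Matrix.transpose_apply, psiMatrix, Matrix.of_apply, psi, Sum.elim_inr, normDev, ← add_assoc]
    rfl

variable {φ}

/-- Up to a small error the bias weight is determined by the weight of the norm coordinate. -/
lemma bias_weight_close {x : Fin n → EuclideanSpace ℝ (Fin d)} {P K c₀ η : ℝ}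
    (h : LinRegular x (fun i => normDev φ (x i)) (inputScale φ d) (biasCoord φ (dataCov x))
      (theta0 φ) P K c₀ η) {y : Fin n → ℝ} (hr : ∀ t, ‖linRes φ η x y t‖ ^ 2 ≤ n) (t : ℕ) :
    |theta0 φ * (biasCoord φ (dataCov x) * linGD φ η x y t (Sum.inr 0)) -
      biasCoord φ (dataCov x) ^ 2 * linGD φ η x y t (Sum.inr 1)| ≤
      η * t * (biasCoord φ (dataCov x) ^ 2 * P) := by
  have hn := h.natCast_pos
  have hη := h.η_pos
  have hP := h.P_nonneg
  induction t with
  | zero => simp [linGD]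
  | succ t ih =>
    obtain ⟨h1, h2⟩ := linGD_succ_inr φ η x y t
    set k := biasCoord φ (dataCov x)
    have hb : |∑ i, normDev φ (x i) * linRes φ η x y t i| ≤ P * n := by
      refine (abs_sum_mul_le_of_abs_le hP h.p_le _).trans ?_
      have : ‖linRes φ η x y t‖ ≤ √n := Real.le_sqrt_of_sq_le (hr t)
      calc P * √n * ‖linRes φ η x y t‖ ≤ P * √n * √n := by gcongr
        _ = _ := by rw [mul_assoc, Real.mul_self_sqrt hn.le]
    -- The updates of the two weights are driven by k∑r and θ₀∑r + ∑pr. In this combination ∑r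
    -- cancels, so it would be conserved if the norm coordinate were constant on the data.
    have e : theta0 φ * (k * linGD φ η x y (t + 1) (Sum.inr 0)) -
        k ^ 2 * linGD φ η x y (t + 1) (Sum.inr 1) =
        (theta0 φ * (k * linGD φ η x y t (Sum.inr 0)) - k ^ 2 * linGD φ η x y t (Sum.inr 1)) +
          η / n * k ^ 2 * ∑ i, normDev φ (x i) * linRes φ η x y t i := by
      rw [h1, h2]
      simp only [add_mul, Finset.sum_add_distrib, ← Finset.mul_sum]
      ring
    rw [e]
    refine (abs_add_le _ _).trans ?_
    have h3 : |η / n * k ^ 2 * ∑ i, normDev φ (x i) * linRes φ η x y t i| ≤ η * (k ^ 2 * P) := by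
      rw [abs_mul, abs_of_nonneg (by positivity : 0 ≤ η / n * k ^ 2)]
      calc _ ≤ η / n * k ^ 2 * (P * n) := by gcongr
        _ = _ := by field_simp
    push_cast
    linarith

end LinearModel

/-! ### The linear model as a near-critical affine predictor -/

section LinearModelCritical

variable {d n : ℕ} {φ : ℝ → ℝ}

/-- A constant for the outputs of the linear model away from the training sphere. -/
def normConst (φ : ℝ → ℝ) : ℝ := 1 + 2 * (|theta1 φ| + |theta2 φ|) / |theta0 φ|

lemma normConst_pos : 0 < normConst φ := by unfold normConst; positivity

/-- Features lie far from the sphere of radius √d, so the variable part of the norm coordinate is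
not small there. Boundedness is enough, as its weight will be small. -/
lemma abs_normDev_le (hd : 1 ≤ d) (v : EuclideanSpace ℝ (Fin d)) :
    |normDev φ v| ≤ (|theta1 φ| + |theta2 φ|) * (1 + ‖v‖) ^ 2 := by
  have hd' : 1 ≤ √(d : ℝ) := Real.one_le_sqrt.2 (by exact_mod_cast hd)
  have h0 : 0 ≤ ‖v‖ / √(d : ℝ) := by positivity
  have h1 : ‖v‖ / √(d : ℝ) ≤ ‖v‖ := div_le_self (norm_nonneg v) hd'
  have h2 : |‖v‖ / √(d : ℝ) - 1| ≤ 1 + ‖v‖ := by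
    rw [abs_le]; constructor <;> linarith [norm_nonneg v]
  have h3 : (‖v‖ / √(d : ℝ) - 1) ^ 2 ≤ (1 + ‖v‖) ^ 2 := by
    rw [← sq_abs]; gcongr
  have h4 : 1 + ‖v‖ ≤ (1 + ‖v‖) ^ 2 := le_self_pow₀ (by linarith [norm_nonneg v]) two_ne_zero
  unfold normDev
  refine (abs_add_le _ _).trans ?_
  rw [abs_mul, abs_mul, abs_of_nonneg (sq_nonneg (‖v‖ / √(d : ℝ) - 1)), add_mul]
  gcongr
  exact h2.trans h4

/-- After `T` steps the linear model is an approximate critical point of the least squares problem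
with intercept. -/
theorem linGD_nearCritical {x : Fin n → EuclideanSpace ℝ (Fin d)} {P K c₀ η : ℝ}
    (h : LinRegular x (fun i => normDev φ (x i)) (inputScale φ d) (biasCoord φ (dataCov x))
      (theta0 φ) P K c₀ η) (hd : 1 ≤ d) (hs : inputScale φ d ≠ 0)
    (hθ : theta0 φ = 0 → theta1 φ = 0 ∧ theta2 φ = 0)
    {y : Fin n → ℝ} (hy : ∀ i, y i ^ 2 = 1) (hy0 : ∑ i, y i = 0)
    (T : ℕ) {kb μ δ₁ δ : ℝ} (hkb : biasCoord φ (dataCov x) ^ 2 ≤ kb)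
    (hμ : Real.exp (-(η * (c₀ * inputScale φ d ^ 2 / 8) / 2) * T) ≤ μ ^ 2) (hμ0 : 0 ≤ μ)
    (hδ₁ : 3 * (η * T) * kb * (P / |theta0 φ|) ≤ δ₁) (hδ₁1 : δ₁ ≤ 1)
    (hgrad : μ * √(K + (1 + kb / theta0 φ ^ 2) * P ^ 2 / inputScale φ d ^ 2) + √K * δ₁ ≤ δ)
    (hbias : theta0 φ ≠ 0 → μ * √(inputScale φ d ^ 2 * K + (1 + kb / theta0 φ ^ 2) * P ^ 2) +
      2 * |theta0 φ| * δ₁ + P ≤ |theta0 φ| * δ)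
    (hkb2 : 2 * kb ≤ theta0 φ ^ 2) (hPδ : 2 * (P / |theta0 φ|) ≤ δ) :
    ∃ (w : EuclideanSpace ℝ (Fin d)) (b : ℝ) (e r : Fin n → ℝ),
      (∀ i, r i = inner ℝ w (x i) + b + e i - y i) ∧ ∑ i, r i ^ 2 ≤ n ∧
      ‖∑ i, r i • x i‖ ≤ δ * n ∧ (b = 0 ∨ |∑ i, r i| ≤ δ * n) ∧
      (∀ i, |e i| ≤ δ * (1 + |b|)) ∧
      ∀ v, |linOut φ (dataCov x) (linGD φ η x y T) v - inner ℝ w v| ≤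
        normConst φ * (|b| + δ₁) * (1 + ‖v‖) ^ 2 := by
  have hn := h.natCast_pos
  have hη := h.η_pos
  have hP := h.P_nonneg
  have hkb0 : 0 ≤ kb := (sq_nonneg _).trans hkb
  set θ := theta0 φ with hθdef
  set k := biasCoord φ (dataCov x) with hk
  set s := inputScale φ d with hsdef
  have hratio : 1 + k ^ 2 / θ ^ 2 ≤ 1 + kb / θ ^ 2 := by gcongr
  have hδ₁0 : 0 ≤ δ₁ := le_trans (by positivity) hδ₁
  obtain ⟨-, b2, b3⟩ := h.residual_bounds hs hy hy0 (linRes_zero φ η x y) (linRes_succ φ η x y) T hμ hμ0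
    (le_trans (by gcongr) hδ₁)
  -- Only the bound on ‖r_t‖ is wanted here, for every t, so `μ` is chosen to make the decay
  -- hypothesis trivially true.
  have b1 := fun t => (h.residual_bounds hs hy hy0 (linRes_zero φ η x y) (linRes_succ φ η x y) t
    (μ := 1 + Real.exp (-(η * (c₀ * s ^ 2 / 8) / 2) * t))
    (by nlinarith [Real.exp_pos (-(η * (c₀ * s ^ 2 / 8) / 2) * t)])
    (by positivity) le_rfl).1
  have hhb := bias_weight_close h b1 T
  set β := linGD φ η x y T with hβ
  let w : EuclideanSpace ℝ (Fin d) := s • (WithLp.toLp 2 fun j => β (Sum.inl j) : EuclideanSpace ℝ (Fin d))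
  set hb := k * β (Sum.inr 0) with hhbdef
  set B := β (Sum.inr 1) with hB
  have hlin : ∀ v, linOut φ (dataCov x) β v = inner ℝ w v + hb + B * (θ + normDev φ v) :=
    fun v => linOut_eq φ (dataCov x) β v
  -- The total intercept on the data: the bias output plus the constant part of the norm coordinate.
  let c := hb + B * θ
  have hres : ∀ i, linRes φ η x y T i = inner ℝ w (x i) + c + B * normDev φ (x i) - y i := by
    intro i
    have : linRes φ η x y T i = linOut φ (dataCov x) β (x i) - y i := rfl
    rw [this, hlin]; simp only [c]; ring
  -- Near conservation gives hb ≈ (k²/θ)B with k² ≤ θ²/2. The bias output thus cannot cancel Bθ, and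
  -- a small intercept forces a small weight of the norm coordinate.
  have hB : |B| * |θ| ≤ 2 * (|c| + δ₁) ∨ θ = 0 := by
    by_cases h0 : θ = 0
    · exact Or.inr h0
    left
    have hθ0 : 0 < |θ| := abs_pos.2 h0
    have h1 : |θ| * |hb| ≤ kb * |B| + |θ| * δ₁ := by
      rw [← abs_mul]
      have e1 : θ * hb = (θ * hb - k ^ 2 * B) + k ^ 2 * B := by ring
      have e2 : |k ^ 2 * B| ≤ kb * |B| := by
        rw [abs_mul, abs_of_nonneg (sq_nonneg k)]; gcongr
      have e3 : η * T * (k ^ 2 * P) ≤ |θ| * δ₁ := by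
        calc η * T * (k ^ 2 * P) ≤ η * T * (kb * P) := by gcongr
          _ = |θ| * ((η * T) * kb * (P / |θ|)) := by field_simp
          _ ≤ |θ| * (3 * (η * T) * kb * (P / |θ|)) := by
              have h1 : 0 ≤ (η * T) * kb * (P / |θ|) := by positivity
              have h2 : 3 * (η * T) * kb * (P / |θ|) = 3 * ((η * T) * kb * (P / |θ|)) := by ring
              exact mul_le_mul_of_nonneg_left (by linarith) hθ0.le
          _ ≤ _ := by gcongr
      rw [e1]
      refine (abs_add_le _ _).trans ?_
      linarith
    have h2 : |θ| * (|B| * |θ|) ≤ |θ| * |c| + |θ| * |hb| := by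
      have : B * θ = c - hb := by simp only [c]; ring
      have := abs_sub c hb
      rw [← mul_add, ← abs_mul B θ, ‹B * θ = c - hb›]
      gcongr
    have h3 : kb * |B| ≤ |θ| * (|B| * |θ|) / 2 := by
      have := mul_le_mul_of_nonneg_right hkb2 (abs_nonneg B)
      rw [← sq_abs] at this
      nlinarith
    have h4 : |θ| * (|B| * |θ|) ≤ |θ| * (2 * (|c| + δ₁)) := by linarith
    exact le_of_mul_le_mul_left h4 hθ0
  have hzero : θ = 0 → hb = 0 ∧ ∀ v : EuclideanSpace ℝ (Fin d), normDev φ v = 0 := by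
    intro h0
    obtain ⟨t1, t2⟩ := hθ h0
    refine ⟨?_, fun v => by simp [normDev, t1, t2]⟩
    rw [hhbdef, h.degenerate h0, zero_mul]
  refine ⟨w, c, fun i => B * normDev φ (x i), linRes φ η x y T, hres, ?_, ?_, ?_, ?_, ?_⟩
  · have := b1 T
    rw [EuclideanSpace.norm_sq_eq] at this
    simpa using this
  · refine b2.trans ?_
    gcongr
    refine le_trans ?_ hgrad
    gcongr
  · by_cases h0 : θ = 0
    · left
      simp [c, h0, (hzero h0).1]
    · right
      have hθ0 : 0 < |θ| := abs_pos.2 h0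
      have h1 : |θ| * |∑ i, linRes φ η x y T i| ≤ |θ| * (δ * n) := by
        refine b3.trans ?_
        rw [← mul_assoc]
        gcongr
        refine le_trans ?_ (hbias h0)
        gcongr
      exact le_of_mul_le_mul_left h1 hθ0
  · intro i
    have hδ0 : 0 ≤ δ := le_trans (by positivity) hPδ
    show |B * normDev φ (x i)| ≤ _
    rcases hB with hB | h0
    · by_cases h0 : θ = 0
      · rw [(hzero h0).2, mul_zero, abs_zero]; positivity
      have hθ0 : 0 < |θ| := abs_pos.2 h0
      rw [abs_mul]
      calc |B| * |normDev φ (x i)| ≤ |B| * P := by gcongr; exact h.p_le i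
        _ = (|B| * |θ|) * (P / |θ|) := by field_simp
        _ ≤ 2 * (|c| + δ₁) * (P / |θ|) := by gcongr
        _ = 2 * (P / |θ|) * (δ₁ + |c|) := by ring
        _ ≤ δ * (1 + |c|) := by gcongr
    · rw [(hzero h0).2, mul_zero, abs_zero]; positivity
  · intro v
    have e1 : linOut φ (dataCov x) β v - inner ℝ w v = c + B * normDev φ v := by
      rw [hlin]; simp only [c]; ring
    rw [e1]
    have hv1 : 1 ≤ (1 + ‖v‖) ^ 2 := one_le_pow₀ (by linarith [norm_nonneg v])
    by_cases h0 : θ = 0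
    · rw [(hzero h0).2, (by simp [c, h0, (hzero h0).1] : c = 0)]
      have := normConst_pos (φ := φ)
      simp
      positivity
    · have hθ0 : 0 < |θ| := abs_pos.2 h0
      have hB' := hB.resolve_right h0
      have h1 := abs_normDev_le (φ := φ) hd v
      refine (abs_add_le _ _).trans ?_
      rw [abs_mul]
      set A := |theta1 φ| + |theta2 φ| with hA
      have hA0 : 0 ≤ A := by positivity
      calc |c| + |B| * |normDev φ v| ≤ (|c| + δ₁) * (1 + ‖v‖) ^ 2 + |B| * (A * (1 + ‖v‖) ^ 2) := by
            gcongr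
            calc |c| ≤ (|c| + δ₁) * 1 := by linarith
              _ ≤ _ := by gcongr
        _ = (|c| + δ₁) * (1 + ‖v‖) ^ 2 + (|B| * |θ|) * (A / |θ| * (1 + ‖v‖) ^ 2) := by field_simp
        _ ≤ (|c| + δ₁) * (1 + ‖v‖) ^ 2 + (2 * (|c| + δ₁)) * (A / |θ| * (1 + ‖v‖) ^ 2) := by gcongr
        _ = _ := by rw [normConst, ← hθdef, ← hA]; ring

end LinearModelCritical

/-! ### Consequences of input regularity -/

section InputRegular

variable {d n : ℕ} {x : Fin n → EuclideanSpace ℝ (Fin d)} {K c₀ : ℝ}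

lemma norm_featGrad_sq_le_of_opNorm (hX : ‖dataMatrix x * (dataMatrix x)ᵀ‖ ≤ K * n)
    (r : EuclideanSpace ℝ (Fin n)) : ‖featGrad x r‖ ^ 2 ≤ K * n * ‖r‖ ^ 2 := by
  have h1 := Matrix.l2_opNorm_mulVec (dataMatrix x * (dataMatrix x)ᵀ) r
  have h2 : (EuclideanSpace.equiv (Fin n) ℝ).symm ((dataMatrix x * (dataMatrix x)ᵀ) *ᵥ r.ofLp) =
      gramOp x r := by
    ext i
    show ((dataMatrix x * (dataMatrix x)ᵀ) *ᵥ r.ofLp) i = inner ℝ (x i) (featGrad x r)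
    rw [← Matrix.mulVec_mulVec]
    simp only [Matrix.mulVec, dotProduct, dataMatrix, Matrix.of_apply, Matrix.transpose_apply,
      PiLp.inner_apply, featGrad, WithLp.ofLp_sum, WithLp.ofLp_smul, Finset.sum_apply, Pi.smul_apply,
      smul_eq_mul, RCLike.inner_apply, conj_trivial]
    refine Finset.sum_congr rfl fun j _ => ?_
    rw [mul_comm]
    simp only [mul_comm]
  rw [h2] at h1
  rw [← real_inner_self_eq_norm_sq, ← inner_gramOp]
  calc _ ≤ ‖r‖ * ‖gramOp x r‖ := real_inner_le_norm _ _
    _ ≤ ‖r‖ * (‖dataMatrix x * (dataMatrix x)ᵀ‖ * ‖r‖) := by gcongr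
    _ ≤ ‖r‖ * (K * n * ‖r‖) := by gcongr
    _ = _ := by ring

/-- The mean of the inputs. -/
def dataMean (x : Fin n → EuclideanSpace ℝ (Fin d)) : EuclideanSpace ℝ (Fin d) :=
  (1 / (n : ℝ)) • ∑ i, x i

lemma dataCov_apply (a b : Fin d) :
    dataCov x a b = 1 / n * ∑ i, (x i - dataMean x) a * (x i - dataMean x) b := by
  simp [dataCov, dataMean, Matrix.sum_apply, Matrix.vecMulVec_apply]

lemma dotProduct_dataCov (u : EuclideanSpace ℝ (Fin d)) :
    u.ofLp ⬝ᵥ (dataCov x *ᵥ u.ofLp) = 1 / n * ∑ i, inner ℝ u (x i - dataMean x) ^ 2 := by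
  have h1 : ∀ i, inner ℝ u (x i - dataMean x) ^ 2 =
      ∑ a, ∑ b, u a * (u b * ((x i - dataMean x) a * (x i - dataMean x) b)) := by
    intro i
    rw [pow_two, PiLp.inner_apply, Finset.sum_mul_sum]
    refine Finset.sum_congr rfl fun a _ => Finset.sum_congr rfl fun b _ => ?_
    simp only [RCLike.inner_apply, conj_trivial]
    ring
  rw [Finset.sum_congr rfl fun i _ => h1 i, Finset.sum_comm, Finset.mul_sum]
  refine Finset.sum_congr rfl fun a _ => ?_
  rw [Finset.sum_comm, Matrix.mulVec, dotProduct, Finset.mul_sum, Finset.mul_sum]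
  refine Finset.sum_congr rfl fun b _ => ?_
  rw [dataCov_apply, ← Finset.mul_sum, ← Finset.mul_sum]
  ring

/-- The mean minimizes the sum of squared deviations. This is why the covariance lower bound holds
with an arbitrary shift. -/
lemma sum_inner_sub_mean_sq_le (hn : 0 < n) (u : EuclideanSpace ℝ (Fin d)) (t : ℝ) :
    ∑ i, inner ℝ u (x i - dataMean x) ^ 2 ≤ ∑ i, (inner ℝ u (x i) - t) ^ 2 := by
  have hn' : (0 : ℝ) < n := by exact_mod_cast hn
  set m := inner ℝ u (dataMean x) with hm
  have h1 : ∑ i, inner ℝ u (x i) = n * m := by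
    rw [hm, dataMean, inner_smul_right, inner_sum]
    field_simp
  have h2 : ∑ i, (inner ℝ u (x i) - t) ^ 2 =
      ∑ i, inner ℝ u (x i - dataMean x) ^ 2 + n * (m - t) ^ 2 := by
    have : ∀ i, (inner ℝ u (x i) - t) ^ 2 = inner ℝ u (x i - dataMean x) ^ 2 +
        (2 * (m - t) * inner ℝ u (x i) + (t ^ 2 - m ^ 2)) := by
      intro i; rw [inner_sub_right, ← hm]; ring
    rw [Finset.sum_congr rfl fun i _ => this i, Finset.sum_add_distrib, Finset.sum_add_distrib,
      ← Finset.mul_sum, h1]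
    simp
    ring
  rw [h2]
  have : 0 ≤ n * (m - t) ^ 2 := by positivity
  linarith

lemma lower_of_posSemidef (hn : 0 < n)
    (hS : (dataCov x - c₀ • (1 : Matrix (Fin d) (Fin d) ℝ)).PosSemidef)
    (u : EuclideanSpace ℝ (Fin d)) (t : ℝ) :
    c₀ * n * ‖u‖ ^ 2 ≤ ∑ i, (inner ℝ u (x i) - t) ^ 2 := by
  have hn' : (0 : ℝ) < n := by exact_mod_cast hn
  have h1 := hS.dotProduct_mulVec_nonneg u.ofLp
  rw [Matrix.sub_mulVec, dotProduct_sub, star_trivial, dotProduct_dataCov, Matrix.smul_mulVec,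
    Matrix.one_mulVec, dotProduct_smul] at h1
  have h2 : u.ofLp ⬝ᵥ u.ofLp = ‖u‖ ^ 2 := by
    rw [EuclideanSpace.norm_sq_eq]; simp [dotProduct, pow_two]
  rw [h2, smul_eq_mul] at h1
  have h3 := sum_inner_sub_mean_sq_le (x := x) hn u t
  have h4 : c₀ * ‖u‖ ^ 2 ≤ 1 / n * ∑ i, (inner ℝ u (x i) - t) ^ 2 := by
    have : 1 / (n : ℝ) * ∑ i, inner ℝ u (x i - dataMean x) ^ 2 ≤
      1 / n * ∑ i, (inner ℝ u (x i) - t) ^ 2 := by gcongr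
    linarith
  calc c₀ * n * ‖u‖ ^ 2 = n * (c₀ * ‖u‖ ^ 2) := by ring
    _ ≤ n * (1 / n * ∑ i, (inner ℝ u (x i) - t) ^ 2) := by gcongr
    _ = _ := by field_simp

/-- A diagonal entry of the squared covariance is the squared norm of a row. The upper bound on the
quadratic form bounds each row by K, so ν stays bounded and the squared bias coordinate is of order
1/d. -/
lemma trace_dataCov_sq_le (hn : 0 < n) (hK : 0 ≤ K)
    (hX : ∀ r, ‖featGrad x r‖ ^ 2 ≤ K * n * ‖r‖ ^ 2) : (dataCov x ^ 2).trace ≤ d * K ^ 2 := by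
  have hn' : (0 : ℝ) < n := by exact_mod_cast hn
  have hup : ∀ v, ∑ i, inner ℝ v (x i - dataMean x) ^ 2 ≤ K * n * ‖v‖ ^ 2 := fun v => by
    refine (sum_inner_sub_mean_sq_le hn v 0).trans ?_
    simpa using sum_inner_sq_le_of_norm_featGrad_le (by positivity) hX v
  have hrow : ∀ a, (dataCov x ^ 2) a a ≤ K ^ 2 := by
    intro a
    let v : EuclideanSpace ℝ (Fin d) := WithLp.toLp 2 fun b => dataCov x a b
    have h1 : (dataCov x ^ 2) a a = ‖v‖ ^ 2 := by
      rw [pow_two, Matrix.mul_apply, EuclideanSpace.norm_sq_eq]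
      refine Finset.sum_congr rfl fun b _ => ?_
      have : dataCov x b a = dataCov x a b := by
        rw [dataCov_apply, dataCov_apply]; simp only [mul_comm]
      rw [this, Real.norm_eq_abs, sq_abs, pow_two]
    have h2 : ‖v‖ ^ 2 = 1 / n * ∑ i, (x i - dataMean x) a * inner ℝ v (x i - dataMean x) := by
      rw [← real_inner_self_eq_norm_sq]
      have : v = (1 / (n : ℝ)) • ∑ i, (x i - dataMean x) a • (x i - dataMean x) := by
        ext b; simp [v, dataCov_apply]
      conv_lhs => rw [this, inner_smul_left, sum_inner, ← this]
      simp only [inner_smul_left, RCLike.conj_to_real, real_inner_comm]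
    have h3 : |∑ i, (x i - dataMean x) a * inner ℝ v (x i - dataMean x)| ≤
        √(K * n) * (√(K * n) * ‖v‖) := by
      refine abs_sum_mul_le (by positivity) (by positivity) ?_ ?_
      · rw [Real.sq_sqrt (by positivity)]
        have := hup (EuclideanSpace.single a 1)
        simpa only [inner_single_eq, PiLp.norm_single, norm_one, one_pow, mul_one] using this
      · rw [mul_pow, Real.sq_sqrt (by positivity)]; exact hup v
    rw [← mul_assoc, Real.mul_self_sqrt (by positivity)] at h3
    have h4 : ‖v‖ * ‖v‖ ≤ ‖v‖ * K := by
      calc ‖v‖ * ‖v‖ = ‖v‖ ^ 2 := by ring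
        _ ≤ 1 / n * (K * n * ‖v‖) := by
            rw [h2]; gcongr; exact (abs_le.1 h3).2
        _ = _ := by field_simp
    rw [h1]
    rcases (norm_nonneg v).eq_or_lt with h0 | h0
    · rw [← h0, zero_pow two_ne_zero]; positivity
    · have := le_of_mul_le_mul_left h4 h0
      gcongr
  calc (dataCov x ^ 2).trace = ∑ a, (dataCov x ^ 2) a a := rfl
    _ ≤ ∑ _a : Fin d, K ^ 2 := Finset.sum_le_sum fun a _ => hrow a
    _ = _ := by simp

lemma biasCoord_sq_le {φ : ℝ → ℝ} (hn : 0 < n) (hd : 0 < d) (hK : 0 ≤ K)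
    (hX : ∀ r, ‖featGrad x r‖ ^ 2 ≤ K * n * ‖r‖ ^ 2) :
    biasCoord φ (dataCov x) ^ 2 ≤ 3 / 2 * theta1 φ ^ 2 * K ^ 2 / d := by
  have hd' : (0 : ℝ) < d := by exact_mod_cast hd
  have h1 : √((dataCov x ^ 2).trace / d) ≤ K := by
    rw [Real.sqrt_le_left hK, div_le_iff₀ hd', mul_comm]
    exact trace_dataCov_sq_le hn hK hX
  have h2 : √((dataCov x ^ 2).trace / d) ^ 2 ≤ K ^ 2 := by gcongr
  rw [biasCoord, mul_pow, mul_pow, Real.sq_sqrt (by positivity)]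
  calc _ ≤ 3 / (2 * d) * (theta1 φ ^ 2 * K ^ 2) := by gcongr
    _ = _ := by field_simp

/-- For t = ‖v‖/√d one has |t - 1| ≤ |t² - 1|, since t + 1 ≥ 1. -/
lemma abs_normDev_le_of_normSq {φ : ℝ → ℝ} {v : EuclideanSpace ℝ (Fin d)} {l : ℝ}
    (h : |‖v‖ ^ 2 / d - 1| ≤ l) : |normDev φ v| ≤ |theta1 φ| * l + |theta2 φ| * l ^ 2 := by
  set t := ‖v‖ / √(d : ℝ) with ht
  have ht0 : 0 ≤ t := by positivity
  have h1 : ‖v‖ ^ 2 / d = t ^ 2 := by rw [ht, div_pow, Real.sq_sqrt (Nat.cast_nonneg d)]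
  have h2 : |t - 1| ≤ l := by
    refine le_trans ?_ h
    rw [h1, show t ^ 2 - 1 = (t - 1) * (t + 1) by ring, abs_mul, abs_of_nonneg (by linarith : 0 ≤ t + 1)]
    nlinarith [abs_nonneg (t - 1)]
  have h3 : (t - 1) ^ 2 ≤ l ^ 2 := by rw [← sq_abs]; gcongr
  unfold normDev
  rw [← ht]
  refine (abs_add_le _ _).trans ?_
  rw [abs_mul, abs_mul, abs_of_nonneg (sq_nonneg (t - 1))]
  gcongr

end InputRegular

/-! ### Asymptotic comparisons -/

section Asymptotics

/-- Any strict loss in the exponent swallows constants and powers of the logarithm. All later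
comparisons of rates rest on this. -/
lemma eventually_log_pow_mul_rpow_le (C : ℝ) (m : ℕ) {x y : ℝ} (h : y < x) :
    ∀ᶠ t : ℝ in atTop, C * (Real.log t ^ m * t ^ (-x)) ≤ t ^ (-y) := by
  have h1 : (fun t : ℝ => C * Real.log t ^ (m : ℝ)) =o[atTop] fun t => t ^ (x - y) :=
    (isLittleO_log_rpow_rpow_atTop (m : ℝ) (by linarith)).const_mul_left C
  filter_upwards [h1.bound one_pos, eventually_gt_atTop 1] with t ht h1t
  have ht0 : 0 < t := by linarith
  rw [one_mul, Real.norm_of_nonneg (by positivity : 0 ≤ t ^ (x - y)), Real.norm_eq_abs, Real.rpow_natCast] at ht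
  calc C * (Real.log t ^ m * t ^ (-x)) = C * Real.log t ^ m * t ^ (-x) := by ring
    _ ≤ t ^ (x - y) * t ^ (-x) := by gcongr; exact (le_abs_self _).trans ht
    _ = t ^ (-y) := by rw [← Real.rpow_add ht0]; ring_nf

lemma eventually_rpow_le (C : ℝ) {x y : ℝ} (h : y < x) :
    ∀ᶠ t : ℝ in atTop, C * t ^ (-x) ≤ t ^ (-y) := by
  simpa using eventually_log_pow_mul_rpow_le C 0 h

lemma sqrt_log_div_le {t : ℝ} (ht : 0 < t) (hL : 1 ≤ Real.log t) :
    √(Real.log t / t) ≤ Real.log t * t ^ (-(1 / 2) : ℝ) := by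
  rw [Real.sqrt_div (by linarith), Real.rpow_neg ht.le, ← Real.sqrt_eq_rpow, ← div_eq_mul_inv]
  gcongr
  rw [Real.sqrt_le_left (by linarith)]
  nlinarith

lemma eventually_sqrt_log_div_le (C : ℝ) {y : ℝ} (h : y < 1 / 2) :
    ∀ᶠ t : ℝ in atTop, C * √(Real.log t / t) ≤ t ^ (-y) := by
  filter_upwards [eventually_log_pow_mul_rpow_le |C| 1 h, eventually_gt_atTop 0,
    Real.tendsto_log_atTop.eventually_ge_atTop 1] with t h1 h2 h3
  refine le_trans ?_ h1
  rw [pow_one]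
  calc C * √(Real.log t / t) ≤ |C| * √(Real.log t / t) := by gcongr; exact le_abs_self C
    _ ≤ _ := by gcongr; exact sqrt_log_div_le h2 h3

lemma eventually_log_mul_sqrt_log_div_le (C : ℝ) {y : ℝ} (h : y < 1 / 2) :
    ∀ᶠ t : ℝ in atTop, C * (Real.log t * √(Real.log t / t)) ≤ t ^ (-y) := by
  filter_upwards [eventually_log_pow_mul_rpow_le |C| 2 h, eventually_gt_atTop 0,
    Real.tendsto_log_atTop.eventually_ge_atTop 1] with t h1 h2 h3
  refine le_trans ?_ h1
  calc C * (Real.log t * √(Real.log t / t)) ≤ |C| * (Real.log t * √(Real.log t / t)) := by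
        gcongr; exact le_abs_self C
    _ ≤ |C| * (Real.log t * (Real.log t * t ^ (-(1 / 2) : ℝ))) := by
        gcongr; exact sqrt_log_div_le h2 h3
    _ = _ := by ring

end Asymptotics

/-! ### Asymptotic verification of the least squares hypotheses -/

section Regime

variable {φ : ℝ → ℝ} {c₀ κ a α γ K : ℝ} {P : ℕ → Problem}

lemma Regime.tendsto_d (h : Regime φ c₀ κ a α γ K P) :
    Tendsto (fun k => ((P k).d : ℝ)) atTop atTop :=
  tendsto_natCast_atTop_atTop.comp h.d_tendsto

lemma Regime.tendsto_n (h : Regime φ c₀ κ a α γ K P) (hα : 0 < α) (hK : 0 < K) :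
    Tendsto (fun k => ((P k).n : ℝ)) atTop atTop := by
  have h1 : Tendsto (fun k => ((P k).d : ℝ) ^ (1 + α) / K) atTop atTop :=
    ((tendsto_rpow_atTop (by linarith)).comp h.tendsto_d).atTop_div_const hK
  refine tendsto_atTop_mono (fun k => ?_) h1
  rw [div_le_iff₀ hK, mul_comm]
  exact h.n_ge k

/-- As n is polynomially bounded in d, deviations of size √(log n/d) may be replaced by √(log d/d).
-/
lemma Regime.eventually_log_n_le (h : Regime φ c₀ κ a α γ K P) (hα : 0 < α) (hK : 0 < K) :
    ∀ᶠ k in atTop, Real.log (P k).n ≤ (|Real.log K| + K) * Real.log (P k).d := by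
  filter_upwards [(h.tendsto_n hα hK).eventually_gt_atTop 0, h.tendsto_d.eventually_gt_atTop 0,
    (Real.tendsto_log_atTop.comp h.tendsto_d).eventually_ge_atTop 1] with k h1 h2 h3
  have h3 : 1 ≤ Real.log (P k).d := h3
  calc Real.log (P k).n ≤ Real.log (K * ((P k).d : ℝ) ^ K) := Real.log_le_log h1 (h.n_le k)
    _ = Real.log K + K * Real.log (P k).d := by
        rw [Real.log_mul hK.ne' (by positivity), Real.log_rpow h2]
    _ ≤ |Real.log K| * Real.log (P k).d + K * Real.log (P k).d := by
        have := abs_nonneg (Real.log K)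
        have := le_abs_self (Real.log K)
        nlinarith
    _ = _ := by ring

/-- A bound for the deviation of the norm coordinate over the training data. -/
def devBound (φ : ℝ → ℝ) (K t : ℝ) : ℝ :=
  (|theta1 φ| + |theta2 φ|) * (K * √(|Real.log K| + K)) * √(Real.log t / t)

lemma devBound_nonneg (hK : 0 < K) (t : ℝ) : 0 ≤ devBound φ K t := by
  unfold devBound; positivity

lemma eventually_devBound_le (C : ℝ) {y : ℝ} (h : y < 1 / 2) :
    ∀ᶠ t : ℝ in atTop, C * devBound φ K t ≤ t ^ (-y) := by
  filter_upwards [eventually_sqrt_log_div_le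
    (C * ((|theta1 φ| + |theta2 φ|) * (K * √(|Real.log K| + K)))) h] with t ht
  refine le_trans (le_of_eq ?_) ht
  unfold devBound; ring

lemma devBound_sq (hK : 0 < K) {t : ℝ} (ht : 0 < t) (hL : 0 ≤ Real.log t) :
    devBound φ K t ^ 2 =
      (|theta1 φ| + |theta2 φ|) ^ 2 * (K ^ 2 * (|Real.log K| + K)) * (Real.log t / t) := by
  unfold devBound
  rw [mul_pow, mul_pow, mul_pow, Real.sq_sqrt (by positivity), Real.sq_sqrt (by positivity)]

lemma Regime.eventually_normDev_le (h : Regime φ c₀ κ a α γ K P) (hα : 0 < α) (hK : 0 < K) :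
    ∀ᶠ k in atTop, ∀ ω, (P k).InputRegular K c₀ ω →
      ∀ i, |normDev φ ((P k).input ω i)| ≤ devBound φ K (P k).d := by
  filter_upwards [h.eventually_log_n_le hα hK, h.tendsto_d.eventually_gt_atTop 0,
    h.tendsto_d.eventually (eventually_sqrt_log_div_le (K * √(|Real.log K| + K))
      (show (0 : ℝ) < 1 / 2 by norm_num)), (Real.tendsto_log_atTop.comp h.tendsto_d).eventually_ge_atTop 1]
    with k h1 h2 h3 h4 ω hω i
  have h4 : 1 ≤ Real.log (P k).d := h4
  rw [neg_zero, Real.rpow_zero] at h3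
  set l := K * √(|Real.log K| + K) * √(Real.log (P k).d / (P k).d) with hl
  have hl0 : 0 ≤ l := by positivity
  have h5 : |‖(P k).input ω i‖ ^ 2 / (P k).d - 1| ≤ l := by
    refine (hω.1 i).trans ?_
    rw [hl, mul_assoc, ← Real.sqrt_mul (by positivity), ← mul_div_assoc]
    gcongr
  refine (abs_normDev_le_of_normSq h5).trans ?_
  have h6 : l ^ 2 ≤ l := by nlinarith
  calc |theta1 φ| * l + |theta2 φ| * l ^ 2 ≤ |theta1 φ| * l + |theta2 φ| * l := by gcongr
    _ = devBound φ K (P k).d := by rw [devBound, hl]; ring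

lemma inputScale_sq (d : ℕ) : inputScale φ d ^ 2 = 2 / d * zeta φ ^ 2 := by
  rw [inputScale, mul_pow, Real.sq_sqrt (by positivity)]

lemma devBound_eq_zero (hθ : theta1 φ = 0 ∧ theta2 φ = 0) (t : ℝ) : devBound φ K t = 0 := by
  simp [devBound, hθ.1, hθ.2]

/-- A bound for the square of the bias coordinate. -/
def biasBound (φ : ℝ → ℝ) (K t : ℝ) : ℝ := 3 / 2 * theta1 φ ^ 2 * K ^ 2 / t

lemma eventually_div_le (C : ℝ) {c : ℝ} (hc : 0 < c) : ∀ᶠ t : ℝ in atTop, C / t ≤ c :=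
  ((tendsto_const_nhds.div_atTop tendsto_id).eventually (gt_mem_nhds hc)).mono fun _ h => le_of_lt h

lemma eventually_biasBound_le (C : ℝ) {c : ℝ} (hc : 0 < c) :
    ∀ᶠ t : ℝ in atTop, C * biasBound φ K t ≤ c := by
  filter_upwards [eventually_div_le (C * (3 / 2 * theta1 φ ^ 2 * K ^ 2)) hc] with t ht
  rwa [biasBound, ← mul_div_assoc]

/-- The input and bias blocks contribute O(η/d), which tends to zero. The norm block contributes
ηθ₀² ≤ 1 up to a factor close to 1. The slack 1/16 + 1/16 + 5/4 keeps the total below 3/2. -/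
lemma Regime.eventually_step (h : Regime φ c₀ κ a α γ K P) (hK : 0 < K)
    (hθ : theta0 φ ≠ 0 ∨ theta1 φ = 0 ∧ theta2 φ = 0) :
    ∀ᶠ k in atTop, ∀ k₀ : ℝ, k₀ ^ 2 ≤ biasBound φ K (P k).d →
      (P k).η * (inputScale φ (P k).d ^ 2 * K + k₀ ^ 2 + (1 + k₀ ^ 2 / theta0 φ ^ 2) *
        (|theta0 φ| + devBound φ K (P k).d) ^ 2) ≤ 3 / 2 := by
  have hsmall : ∀ C c : ℝ, 0 < c → ∀ᶠ k in atTop, C * ((P k).η / (P k).d) ≤ c := fun C c hc => by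
    have := h.eta_small.const_mul C
    rw [mul_zero] at this
    exact (this.eventually (gt_mem_nhds hc)).mono fun _ h => le_of_lt h
  filter_upwards [hsmall (2 * zeta φ ^ 2 * K) (1 / 16) (by norm_num),
    hsmall (3 / 2 * theta1 φ ^ 2 * K ^ 2) (1 / 16) (by norm_num), h.tendsto_d.eventually_gt_atTop 0,
    h.tendsto_d.eventually (eventually_biasBound_le (φ := φ) (K := K) (1 / theta0 φ ^ 2)
      (show (0 : ℝ) < 1 / 16 by norm_num)),
    h.tendsto_d.eventually (eventually_devBound_le (φ := φ) (K := K) (16 / |theta0 φ|)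
      (show (0 : ℝ) < 1 / 2 by norm_num))] with k h1 h2 h3 h4 h5 k₀ hk₀
  have hη := (h.valid k).eta_pos
  have e1 : (P k).η * (inputScale φ (P k).d ^ 2 * K) ≤ 1 / 16 := by
    refine le_trans (le_of_eq ?_) h1
    rw [inputScale_sq]; field_simp
  have e2 : (P k).η * k₀ ^ 2 ≤ 1 / 16 := by
    calc (P k).η * k₀ ^ 2 ≤ (P k).η * biasBound φ K (P k).d := by gcongr
      _ = 3 / 2 * theta1 φ ^ 2 * K ^ 2 * ((P k).η / (P k).d) := by unfold biasBound; field_simp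
      _ ≤ _ := h2
  have e3 : (P k).η * ((1 + k₀ ^ 2 / theta0 φ ^ 2) *
      (|theta0 φ| + devBound φ K (P k).d) ^ 2) ≤ 5 / 4 := by
    rcases eq_or_ne (theta0 φ) 0 with h0 | h0
    · have hd := devBound_eq_zero (K := K) (hθ.resolve_left (by simpa using h0)) (P k).d
      rw [hd, h0]; norm_num
    have hp := devBound_nonneg (φ := φ) hK (P k).d
    set p := devBound φ K (P k).d
    have hθ0 : 0 < |theta0 φ| := abs_pos.2 h0
    rw [neg_zero, Real.rpow_zero, div_mul_eq_mul_div, div_le_one hθ0] at h5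
    have f1 : k₀ ^ 2 / theta0 φ ^ 2 ≤ 1 / 16 := by
      refine le_trans ?_ h4
      rw [one_div_mul_eq_div]; gcongr
    have f2 : (|theta0 φ| + p) ^ 2 ≤ (17 / 16) ^ 2 * theta0 φ ^ 2 := by
      rw [← sq_abs (theta0 φ), ← mul_pow]
      gcongr
      linarith
    calc _ ≤ (P k).η * ((1 + 1 / 16) * ((17 / 16) ^ 2 * theta0 φ ^ 2)) := by gcongr
      _ = (1 + 1 / 16) * (17 / 16) ^ 2 * ((P k).η * theta0 φ ^ 2) := by ring
      _ ≤ (1 + 1 / 16) * (17 / 16) ^ 2 * 1 := by gcongr; exact h.eta_stable k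
      _ ≤ _ := by norm_num
  calc _ = (P k).η * (inputScale φ (P k).d ^ 2 * K) + (P k).η * k₀ ^ 2 + (P k).η *
        ((1 + k₀ ^ 2 / theta0 φ ^ 2) * (|theta0 φ| + devBound φ K (P k).d) ^ 2) := by ring
    _ ≤ _ := by linarith

lemma Regime.eventually_linRegular (h : Regime φ c₀ κ a α γ K P) (hα : 0 < α) (hK : 0 < K)
    (hc : 0 < c₀) (hθ : theta0 φ ≠ 0 ∨ theta1 φ = 0 ∧ theta2 φ = 0) :
    ∀ᶠ k in atTop, ∀ ω, (P k).InputRegular K c₀ ω →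
      LinRegular ((P k).input ω) (fun i => normDev φ ((P k).input ω i)) (inputScale φ (P k).d)
        (biasCoord φ (dataCov ((P k).input ω))) (theta0 φ) (devBound φ K (P k).d) K c₀ (P k).η ∧
      biasCoord φ (dataCov ((P k).input ω)) ^ 2 ≤ biasBound φ K (P k).d := by
  filter_upwards [h.eventually_step hK hθ, h.eventually_normDev_le hα hK,
    h.tendsto_d.eventually_gt_atTop 0, (h.tendsto_n hα hK).eventually_gt_atTop 0,
    h.tendsto_d.eventually (eventually_devBound_le (φ := φ) (K := K) (1 / |theta0 φ|)
      (show (0 : ℝ) < 1 / 2 by norm_num)),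
    h.tendsto_d.eventually (eventually_devBound_le (φ := φ) (K := K)
      (√(6 + 12 * (K / c₀)) / |theta0 φ|) (show (0 : ℝ) < 1 / 2 by norm_num)),
    h.tendsto_d.eventually (eventually_div_le
      (2 * zeta φ ^ 2 * c₀ * (6 + 12 * (K / c₀)) / theta0 φ ^ 2) (show (0 : ℝ) < 4 by norm_num))]
    with k hstep hdev hd hn hP1 hP2 hs ω hω
  have hn' : 0 < (P k).n := by exact_mod_cast hn
  have hd' : 0 < (P k).d := by exact_mod_cast hd
  have hup := norm_featGrad_sq_le_of_opNorm hω.2.2.1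
  have hb := biasCoord_sq_le (φ := φ) hn' hd' hK.le hup
  have hp := devBound_nonneg (φ := φ) hK (P k).d
  have hz : theta0 φ = 0 → theta1 φ = 0 ∧ theta2 φ = 0 := fun h0 => hθ.resolve_left (by simpa using h0)
  rw [neg_zero, Real.rpow_zero] at hP1 hP2
  refine ⟨⟨hn', hc, hK.le, (h.valid k).eta_pos, hp, hup, lower_of_posSemidef hn' hω.2.2.2,
    hdev ω hω, ?_, ?_, ?_, ?_, hstep _ hb⟩, hb⟩
  · rcases eq_or_ne (theta0 φ) 0 with h0 | h0
    · rw [devBound_eq_zero (hz h0)]; positivity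
    · rwa [one_div_mul_eq_div, div_le_one (abs_pos.2 h0)] at hP1
  · intro h0
    simp [biasCoord, (hz h0).1]
  · rcases eq_or_ne (theta0 φ) 0 with h0 | h0
    · rw [devBound_eq_zero (hz h0), h0]; simp
    · have hθ0 : 0 < |theta0 φ| := abs_pos.2 h0
      rw [div_mul_eq_mul_div, div_le_one hθ0] at hP2
      have := pow_le_pow_left₀ (by positivity) hP2 2
      rwa [mul_pow, Real.sq_sqrt (by positivity), sq_abs] at this
  · intro h0
    have h1 : 0 < theta0 φ ^ 2 := by positivity
    rw [div_le_iff₀ hd, div_le_iff₀ h1] at hs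
    rw [inputScale_sq]
    calc 2 / ((P k).d : ℝ) * zeta φ ^ 2 * c₀ * (6 + 12 * (K / c₀)) =
          (2 * zeta φ ^ 2 * c₀ * (6 + 12 * (K / c₀))) / (P k).d := by ring
      _ ≤ (4 * (P k).d * theta0 φ ^ 2) / (P k).d := by gcongr
      _ = _ := by field_simp

/-- Rounding the number of steps down changes ηT by at most η, negligible against d. -/
lemma Regime.step_mul_time_le (h : Regime φ c₀ κ a α γ K P) (hκ : 0 < κ) {k : ℕ}
    (hd : 1 ≤ (P k).d) :
    (P k).η * (P k).time κ ≤ κ * ((P k).d * Real.log (P k).d) ∧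
      κ * ((P k).d * Real.log (P k).d) - (P k).η ≤ (P k).η * (P k).time κ ∧
      ((P k).time κ : ℝ) ≤ κ * ((P k).d * Real.log (P k).d / (P k).η) := by
  have hη := (h.valid k).eta_pos
  have hL : 0 ≤ Real.log (P k).d := Real.log_nonneg (by exact_mod_cast hd)
  have e : (P k).η * (κ * ((P k).d * Real.log (P k).d / (P k).η)) =
      κ * ((P k).d * Real.log (P k).d) := by field_simp
  have h1 := Nat.floor_le (show 0 ≤ κ * ((P k).d * Real.log (P k).d / (P k).η) by positivity)
  have h2 := Nat.lt_floor_add_one (κ * ((P k).d * Real.log (P k).d / (P k).η))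
  refine ⟨?_, ?_, h1⟩
  · rw [← e]; exact mul_le_mul_of_nonneg_left h1 hη.le
  · have := mul_le_mul_of_nonneg_left h2.le hη.le
    rw [e, mul_add, mul_one] at this
    simp only [Problem.time]
    linarith

end Regime

/-! ### Class sizes and balanced labels -/

section Labels

variable (P : Problem)

lemma Problem.classSize_eq (c : ℤˣ) :
    P.classSize c = (Finset.univ.filter fun i => P.label i = c).card := by
  rw [Problem.classSize, Finset.card_eq_sum_card_fiberwise (f := P.spur) (t := Finset.univ)
    (fun _ _ => Finset.mem_coe.2 (Finset.mem_univ _))]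
  refine Finset.sum_congr rfl fun s _ => ?_
  rw [Problem.group, Finset.filter_filter]

lemma sum_units_int (f : ℤˣ → ℝ) : ∑ c, f c = f 1 + f (-1) := by
  rw [show (Finset.univ : Finset ℤˣ) = {1, -1} by decide, Finset.sum_pair (by decide)]

lemma Problem.classSize_add : P.classSize 1 + P.classSize (-1) = P.n := by
  have h : ∑ c, P.classSize c = P.n := by
    simp only [Problem.classSize_eq]
    rw [← Finset.card_eq_sum_card_fiberwise (f := P.label) (t := Finset.univ)
      (fun _ _ => Finset.mem_coe.2 (Finset.mem_univ _))]
    simp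
  rwa [show (Finset.univ : Finset ℤˣ) = {1, -1} by decide, Finset.sum_pair (by decide)] at h

lemma Problem.sum_y (h : P.Valid) : ∑ i, P.y i = 0 := by
  have h1 := h.balanced
  rw [← Finset.sum_fiberwise Finset.univ P.label, sum_units_int]
  have h2 : ∀ c : ℤˣ, ∑ i with P.label i = c, P.y i = P.classSize c * ((c : ℤ) : ℝ) := by
    intro c
    rw [Problem.classSize_eq, ← nsmul_eq_mul, ← Finset.sum_const]
    refine Finset.sum_congr rfl fun i hi => ?_
    rw [Problem.y, (Finset.mem_filter.1 hi).2]
  rw [h2, h2, h1]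
  simp

lemma Problem.y_sq (i : Fin P.n) : P.y i ^ 2 = 1 := by
  rw [Problem.y]
  rcases Int.units_eq_one_or (P.label i) with h | h <;> simp [h]

lemma Problem.classSize_eq_half (h : P.Valid) (c : ℤˣ) : (P.classSize c : ℝ) = P.n / 2 := by
  have h1 : (P.classSize 1 : ℝ) + P.classSize (-1) = P.n := by exact_mod_cast P.classSize_add
  have h2 : (P.classSize 1 : ℝ) = P.classSize (-1) := by exact_mod_cast h.balanced
  rcases Int.units_eq_one_or c with rfl | rfl <;> linarith

end Labels

/-! ### The linear model at time κ d log d/η -/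

section Regime

variable {φ : ℝ → ℝ} {c₀ κ a α γ K : ℝ} {P : ℕ → Problem}

lemma eventually_log_mul_devBound_le (C : ℝ) {y : ℝ} (h : y < 1 / 2) :
    ∀ᶠ t : ℝ in atTop, C * (Real.log t * devBound φ K t) ≤ t ^ (-y) := by
  filter_upwards [eventually_log_mul_sqrt_log_div_le
    (C * ((|theta1 φ| + |theta2 φ|) * (K * √(|Real.log K| + K)))) h] with t ht
  refine le_trans (le_of_eq ?_) ht
  unfold devBound; ring

/-- With squared input scale 2ζ²/d and ηT ≈ κ d log d, the exponent is -2q log d for q = c₀ζ²κ/16.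
The squared gradient thus gains d^(-2q), and the gradient d^(-q). -/
lemma Regime.eventually_exp_le (h : Regime φ c₀ κ a α γ K P) (hc : 0 < c₀) (hκ : 0 < κ) :
    ∀ᶠ k in atTop, Real.exp (-((P k).η * (c₀ * inputScale φ (P k).d ^ 2 / 8) / 2) *
      (P k).time κ) ≤ (2 * ((P k).d : ℝ) ^ (-(c₀ * zeta φ ^ 2 * κ / 16))) ^ 2 := by
  have hsmall := h.eta_small.const_mul (c₀ * zeta φ ^ 2 / 8)
  rw [mul_zero] at hsmall
  filter_upwards [hsmall.eventually (gt_mem_nhds one_pos), h.tendsto_d.eventually_ge_atTop 1]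
    with k h1 h2
  have hd : (0 : ℝ) < (P k).d := by linarith
  obtain ⟨-, h3, -⟩ := h.step_mul_time_le hκ (k := k) (by exact_mod_cast h2)
  set L := Real.log (P k).d with hL
  set q := c₀ * zeta φ ^ 2 * κ / 16 with hq
  -- The summand 1 pays for the rounding of T. It costs a factor e ≤ 4, hence the 2 in front of the
  -- power of d.
  have e1 : -((P k).η * (c₀ * inputScale φ (P k).d ^ 2 / 8) / 2) * (P k).time κ ≤ 1 - 2 * q * L := by
    have e2 : -((P k).η * (c₀ * inputScale φ (P k).d ^ 2 / 8) / 2) * (P k).time κ =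
        -(c₀ * zeta φ ^ 2 / (8 * (P k).d) * ((P k).η * (P k).time κ)) := by
      rw [inputScale_sq]; field_simp
    have e3 : c₀ * zeta φ ^ 2 / (8 * (P k).d) * (κ * ((P k).d * L) - (P k).η) =
        2 * q * L - c₀ * zeta φ ^ 2 / 8 * ((P k).η / (P k).d) := by
      rw [hq]; field_simp; ring
    have e4 := mul_le_mul_of_nonneg_left h3 (show 0 ≤ c₀ * zeta φ ^ 2 / (8 * (P k).d) by positivity)
    rw [e2]
    linarith
  calc _ ≤ Real.exp (1 - 2 * q * L) := Real.exp_le_exp.2 e1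
    _ = Real.exp 1 * (((P k).d : ℝ) ^ (-q)) ^ 2 := by
        rw [Real.rpow_def_of_pos hd, ← Real.exp_nat_mul, ← Real.exp_add]
        congr 1; push_cast; ring
    _ ≤ 4 * (((P k).d : ℝ) ^ (-q)) ^ 2 := by
        gcongr; linarith [Real.exp_one_lt_d9]
    _ = _ := by ring

set_option maxHeartbeats 1000000 in
/-- At time `κ d log d / η` the linear model is, up to polynomially small errors, an affine
predictor that is a critical point of the least squares problem. -/
theorem Regime.eventually_linear_predictor (h : Regime φ c₀ κ a α γ K P) (hα : 0 < α) (hK : 0 < K)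
    (hc : 0 < c₀) (hκ : 0 < κ) (hζ : zeta φ ≠ 0)
    (hθ : theta0 φ ≠ 0 ∨ theta1 φ = 0 ∧ theta2 φ = 0) {β : ℝ} (hβ : 0 < β) (hβ1 : β < 1 / 4)
    (hβ2 : β < c₀ * zeta φ ^ 2 * κ / 16) :
    ∀ᶠ k in atTop, ∀ ω, (P k).InputRegular K c₀ ω →
      ∃ (w : EuclideanSpace ℝ (Fin (P k).d)) (b : ℝ) (e r : Fin (P k).n → ℝ),
      (∀ i, r i = inner ℝ w ((P k).input ω i) + b + e i - (P k).y i) ∧ ∑ i, r i ^ 2 ≤ (P k).n ∧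
      ‖∑ i, r i • (P k).input ω i‖ ≤ ((P k).d : ℝ) ^ (-β) * (P k).n ∧
      (b = 0 ∨ |∑ i, r i| ≤ ((P k).d : ℝ) ^ (-β) * (P k).n) ∧
      (∀ i, |e i| ≤ ((P k).d : ℝ) ^ (-β) * (1 + |b|)) ∧
      ∀ v, |(P k).lin φ ω ((P k).time κ) v - inner ℝ w v| ≤
        normConst φ * (|b| + ((P k).d : ℝ) ^ (-β)) * (1 + ‖v‖) ^ 2 := by
  set q := c₀ * zeta φ ^ 2 * κ / 16 with hq
  set A := (|theta1 φ| + |theta2 φ|) ^ 2 * (K ^ 2 * (|Real.log K| + K)) with hA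
  have hA0 : 0 ≤ A := by positivity
  have hz0 : 0 < zeta φ ^ 2 := by positivity
  have hz : theta0 φ = 0 → theta1 φ = 0 ∧ theta2 φ = 0 := fun h0 => hθ.resolve_left (by simpa using h0)
  have hT := h.tendsto_d
  filter_upwards [h.eventually_linRegular hα hK hc hθ, h.eventually_exp_le (φ := φ) hc hκ,
    hT.eventually_ge_atTop 1, (Real.tendsto_log_atTop.comp hT).eventually_ge_atTop 1,
    hT.eventually (eventually_log_mul_devBound_le (φ := φ) (K := K)
      (3 * κ * (3 / 2 * theta1 φ ^ 2 * K ^ 2) / |theta0 φ|) (show (1 / 4 : ℝ) < 1 / 2 by norm_num)),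
    hT.eventually (eventually_log_pow_mul_rpow_le (2 * (2 * (K + A / zeta φ ^ 2 + 1))) 1 hβ2),
    hT.eventually (eventually_rpow_le (2 * √K) hβ1),
    hT.eventually (eventually_biasBound_le (φ := φ) (K := K) (1 / theta0 φ ^ 2) one_pos),
    hT.eventually (eventually_biasBound_le (φ := φ) (K := K) (2 / theta0 φ ^ 2) one_pos),
    hT.eventually (eventually_rpow_le (6 / |theta0 φ| * √(2 * zeta φ ^ 2 * K + 2)) hβ2),
    hT.eventually (eventually_rpow_le 6 hβ1),
    hT.eventually (eventually_devBound_le (φ := φ) (K := K) (3 / |theta0 φ|)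
      (show β < 1 / 2 by linarith)),
    hT.eventually (eventually_devBound_le (φ := φ) (K := K) 1 (show (0 : ℝ) < 1 / 2 by norm_num))]
    with k hlr hexp hd hL f1 f2 f3 f4 f5 f6 f7 f8 f9 ω hω
  have hL : 1 ≤ Real.log (P k).d := hL
  have hd0 : (0 : ℝ) < (P k).d := by linarith
  have hdn : 1 ≤ (P k).d := by exact_mod_cast hd
  obtain ⟨hlr, hkb⟩ := hlr ω hω
  obtain ⟨hT1, -, -⟩ := h.step_mul_time_le hκ hdn
  have hp := devBound_nonneg (φ := φ) hK (P k).d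
  have hp2 := devBound_sq (φ := φ) hK hd0 (by linarith)
  rw [← hA] at hp2
  have hkb0 : 0 ≤ biasBound φ K (P k).d := (sq_nonneg _).trans hkb
  have hs : inputScale φ (P k).d ≠ 0 := by
    have : 0 < inputScale φ (P k).d ^ 2 := by rw [inputScale_sq]; positivity
    intro h0; rw [h0] at this; simp at this
  rw [neg_zero, Real.rpow_zero, one_mul] at f9
  have hkbθ : biasBound φ K (P k).d / theta0 φ ^ 2 ≤ 1 := by rwa [one_div_mul_eq_div] at f4
  set p := devBound φ K (P k).d with hpdef
  set δ := ((P k).d : ℝ) ^ (-β) with hδ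
  set δ₁ := ((P k).d : ℝ) ^ (-(1 / 4) : ℝ) with hδ₁
  set μ := 2 * ((P k).d : ℝ) ^ (-q) with hμ
  set L := Real.log (P k).d with hLdef
  have hδ₁1 : δ₁ ≤ 1 := Real.rpow_le_one_of_one_le_of_nonpos hd (by norm_num)
  have hδ0 : 0 < δ := by positivity
  have hδ₁0 : 0 < δ₁ := by positivity
  have hδ₁δ : δ₁ ≤ δ := Real.rpow_le_rpow_of_exponent_le hd (by linarith)
  -- The squared bias coordinate is O(1/d) and cancels the factor d in ηT ≤ κ d log d. What remains
  -- is log d times the deviation of order √(log d/d), below d^(-1/4).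
  have g1 : 3 * ((P k).η * (P k).time κ) * biasBound φ K (P k).d * (p / |theta0 φ|) ≤ δ₁ := by
    refine le_trans ?_ f1
    calc _ ≤ 3 * (κ * ((P k).d * L)) * biasBound φ K (P k).d * (p / |theta0 φ|) := by gcongr
      _ = _ := by unfold biasBound; field_simp
  -- Both p² and the squared input scale are of order 1/d, up to a logarithm, so their ratio is only
  -- logarithmic and is absorbed by the gap between β and q.
  have g2 : μ * √(K + (1 + biasBound φ K (P k).d / theta0 φ ^ 2) * p ^ 2 /
      inputScale φ (P k).d ^ 2) ≤ δ / 2 := by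
    have e1 : K + (1 + biasBound φ K (P k).d / theta0 φ ^ 2) * p ^ 2 / inputScale φ (P k).d ^ 2 ≤
        ((K + A / zeta φ ^ 2 + 1) * L) ^ 2 := by
      calc _ ≤ K + (1 + 1) * p ^ 2 / inputScale φ (P k).d ^ 2 := by gcongr
        _ = K + A / zeta φ ^ 2 * L := by rw [hp2, inputScale_sq]; field_simp; ring
        _ ≤ (K + A / zeta φ ^ 2 + 1) * L := by nlinarith
        _ ≤ _ := by
          refine le_self_pow₀ ?_ two_ne_zero
          have : 0 ≤ A / zeta φ ^ 2 := by positivity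
          nlinarith
    have e2 : √(K + (1 + biasBound φ K (P k).d / theta0 φ ^ 2) * p ^ 2 /
        inputScale φ (P k).d ^ 2) ≤ (K + A / zeta φ ^ 2 + 1) * L :=
      Real.sqrt_le_iff.2 ⟨by positivity, e1⟩
    have e3 : μ * ((K + A / zeta φ ^ 2 + 1) * L) ≤ δ / 2 := by
      rw [pow_one] at f2
      have : 2 * (2 * (K + A / zeta φ ^ 2 + 1)) * (L * ((P k).d : ℝ) ^ (-q)) =
        2 * (μ * ((K + A / zeta φ ^ 2 + 1) * L)) := by rw [hμ]; ring
      linarith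
    exact (mul_le_mul_of_nonneg_left e2 (by positivity)).trans e3
  have g3 : theta0 φ ≠ 0 → μ * √(inputScale φ (P k).d ^ 2 * K +
      (1 + biasBound φ K (P k).d / theta0 φ ^ 2) * p ^ 2) + 2 * |theta0 φ| * δ₁ + p ≤
      |theta0 φ| * δ := by
    intro h0
    have hθ0 : 0 < |theta0 φ| := abs_pos.2 h0
    have e1 : √(inputScale φ (P k).d ^ 2 * K +
        (1 + biasBound φ K (P k).d / theta0 φ ^ 2) * p ^ 2) ≤ √(2 * zeta φ ^ 2 * K + 2) := by
      have hs1 : inputScale φ (P k).d ^ 2 ≤ 2 * zeta φ ^ 2 := by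
        rw [inputScale_sq]; gcongr; exact div_le_self (by norm_num) hd
      refine Real.sqrt_le_sqrt ?_
      calc _ ≤ 2 * zeta φ ^ 2 * K + (1 + 1) * 1 ^ 2 := by gcongr
        _ = _ := by norm_num
    have e2 : μ * √(2 * zeta φ ^ 2 * K + 2) ≤ |theta0 φ| * δ / 3 := by
      have : 6 / |theta0 φ| * √(2 * zeta φ ^ 2 * K + 2) * ((P k).d : ℝ) ^ (-q) =
        3 * (μ * √(2 * zeta φ ^ 2 * K + 2)) / |theta0 φ| := by rw [hμ]; field_simp; ring
      rw [this, div_le_iff₀ hθ0] at f6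
      linarith
    have e3 : μ * √(inputScale φ (P k).d ^ 2 * K +
        (1 + biasBound φ K (P k).d / theta0 φ ^ 2) * p ^ 2) ≤ μ * √(2 * zeta φ ^ 2 * K + 2) := by
      gcongr
    have e4 : p ≤ |theta0 φ| * δ / 3 := by
      rw [div_mul_eq_mul_div, div_le_iff₀ hθ0] at f8
      linarith
    have e5 : |theta0 φ| * (6 * δ₁) ≤ |theta0 φ| * δ := by gcongr
    linarith
  have g4 : 2 * biasBound φ K (P k).d ≤ theta0 φ ^ 2 := by
    rcases eq_or_ne (theta0 φ) 0 with h0 | h0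
    · simp [h0, biasBound, (hz h0).1]
    · rwa [div_mul_eq_mul_div, div_le_one (by positivity)] at f5
  have g5 : 2 * (p / |theta0 φ|) ≤ δ := by
    refine le_trans ?_ f8
    rw [mul_div_assoc', div_mul_eq_mul_div]
    gcongr
    norm_num
  have g6 : √K * δ₁ ≤ δ / 2 := by linarith
  obtain ⟨w, b, e, r, r1, r2, r3, r4, r5, r6⟩ := linGD_nearCritical hlr hdn hs hz (P k).y_sq
    ((P k).sum_y (h.valid k)) ((P k).time κ) hkb hexp (by positivity) g1 hδ₁1
    (δ := δ) (by linarith) g3 g4 g5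
  refine ⟨w, b, e, r, r1, r2, r3, r4, r5, fun v => (r6 v).trans ?_⟩
  have := normConst_pos (φ := φ)
  gcongr

end Regime

/-! ### From learning problems to regular feature samples -/

namespace Problem

variable (P : Problem)

/-- The core feature and the majority spurious feature of a class. -/
def mainFeature (c : ℤˣ) : Fin 2 → EuclideanSpace ℝ (Fin P.d) := ![P.core c, P.spurious (P.maj c)]

/-- The position of a main feature among all features. -/
def mainIndex (c : ℤˣ) : Fin 2 → ℤˣ ⊕ Fin P.numSpur := ![Sum.inl c, Sum.inr (P.maj c)]

/-- The training sample with its main features. -/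
def featureSample (ω : P.Sample) : FeatureSample (EuclideanSpace ℝ (Fin P.d)) P.n where
  v := P.mainFeature
  σ c j := featureStd P.noiseCov (P.mainFeature c j)
  x := P.input ω
  ξ := ω.1
  y := P.y
  I c := P.group c (P.maj c)
  J := {i | P.spur i ≠ P.maj (P.label i)}

/-- The majority groups, and the union of the minority groups. -/
def part : Option ℤˣ → Finset (Fin P.n)
  | some c => P.group c (P.maj c)
  | none => {i | P.spur i ≠ P.maj (P.label i)}

/-- The concentration of the noise up to a factor `B`. -/
structure NoiseRegular (B : ℝ) (ξ : Fin P.n → EuclideanSpace ℝ (Fin P.d)) : Prop where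
  sum : ∀ c, ‖∑ i ∈ P.group c (P.maj c), ξ i‖ ^ 2 ≤ B * (P.n * P.noiseCov.trace)
  cov : ∀ o c j, ‖∑ i ∈ P.part o, (inner ℝ (P.mainFeature c j) (ξ i) • ξ i -
    WithLp.toLp 2 (P.noiseCov *ᵥ (P.mainFeature c j).ofLp))‖ ^ 2 ≤
      B * (P.n * (gaussFour * (P.noiseCov.trace *
        ((P.mainFeature c j).ofLp ⬝ᵥ (P.noiseCov *ᵥ (P.mainFeature c j).ofLp)))))
  normSq : (∑ i ∈ P.group 1 (P.maj 1), (‖ξ i‖ ^ 2 - P.noiseCov.trace)) ^ 2 ≤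
    B * (P.n * (gaussFour * P.noiseCov.trace ^ 2))

variable {P}

lemma mainFeature_eq (c : ℤˣ) (j : Fin 2) : P.mainFeature c j = P.feature (P.mainIndex c j) := by
  fin_cases j <;> rfl

lemma Valid.maj_injective (h : P.Valid) : Function.Injective P.maj := by
  intro c c' hc
  have := h.maj_ne
  rcases Int.units_eq_one_or c with rfl | rfl <;> rcases Int.units_eq_one_or c' with rfl | rfl
  · rfl
  · exact absurd hc this
  · exact absurd hc.symm this
  · rfl

lemma Valid.mainIndex_ne (h : P.Valid) {c c' : ℤˣ} {j j' : Fin 2} (hne : (c, j) ≠ (c', j')) :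
    P.mainIndex c j ≠ P.mainIndex c' j' := by
  intro he
  apply hne
  fin_cases j <;> fin_cases j' <;> simp [mainIndex] at he ⊢
  · exact he
  · exact h.maj_injective he

lemma Valid.inner_feature (h : P.Valid) (p q : ℤˣ ⊕ Fin P.numSpur) :
    inner ℝ (P.feature p) (P.feature q) = if p = q then ‖P.feature p‖ ^ 2 else 0 := by
  split_ifs with hpq
  · rw [hpq, real_inner_self_eq_norm_sq]
  · exact h.orthogonal hpq

lemma Valid.mainFeature_ne_zero (h : P.Valid) (c : ℤˣ) (j : Fin 2) : P.mainFeature c j ≠ 0 := by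
  fin_cases j
  · exact h.core_ne_zero c
  · exact h.maj_ne_zero c

lemma Valid.mainFeature_eigen (h : P.Valid) (c : ℤˣ) (j : Fin 2) :
    P.noiseCov *ᵥ (P.mainFeature c j).ofLp =
      featureStd P.noiseCov (P.mainFeature c j) ^ 2 • (P.mainFeature c j).ofLp := by
  fin_cases j
  · exact h.core_eigen c
  · exact h.maj_eigen c

lemma Valid.nsr_mainFeature (h : P.Valid) (c c' : ℤˣ) (j : Fin 2) :
    nsr P.noiseCov (P.mainFeature c j) = nsr P.noiseCov (P.mainFeature c' j) := by
  have h1 := h.Rc_eq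
  have h2 := h.Rs_eq
  rcases Int.units_eq_one_or c with rfl | rfl <;> rcases Int.units_eq_one_or c' with rfl | rfl <;>
    fin_cases j <;> first | rfl | exact h1 | exact h2 | exact h1.symm | exact h2.symm

lemma featureStd_sq_mul (hS : P.noiseCov.PosSemidef) {v : EuclideanSpace ℝ (Fin P.d)} (hv : v ≠ 0) :
    v.ofLp ⬝ᵥ (P.noiseCov *ᵥ v.ofLp) = (featureStd P.noiseCov v * ‖v‖) ^ 2 := by
  have h1 := hS.dotProduct_mulVec_nonneg v.ofLp
  rw [star_trivial] at h1
  rw [featureStd, div_mul_cancel₀ _ (norm_ne_zero_iff.2 hv), Real.sq_sqrt h1]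

lemma sum_eq_parts (f : Fin P.n → ℝ) : ∑ i, f i = ∑ i ∈ P.group 1 (P.maj 1), f i +
    ∑ i ∈ P.group (-1) (P.maj (-1)), f i + ∑ i with P.spur i ≠ P.maj (P.label i), f i := by
  rw [← Finset.sum_filter_add_sum_filter_not Finset.univ fun i => P.spur i = P.maj (P.label i)]
  congr 1
  rw [← Finset.sum_fiberwise (Finset.univ.filter fun i => P.spur i = P.maj (P.label i)) P.label,
    sum_units_int]
  congr 1 <;>
  · refine Finset.sum_congr ?_ fun _ _ => rfl
    ext i
    simp only [group, Finset.mem_filter, Finset.mem_univ, true_and]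
    constructor
    · rintro ⟨h1, h2⟩; rw [h2] at h1; exact ⟨h2, h1⟩
    · rintro ⟨h1, h2⟩; rw [h1]; exact ⟨h2, rfl⟩

lemma card_group_maj_add (c : ℤˣ) : (P.group c (P.maj c)).card + P.minoritySize c = P.classSize c := by
  rw [classSize, minoritySize, ← Finset.add_sum_erase Finset.univ _ (Finset.mem_univ (P.maj c))]
  congr 2
  ext s
  simp

lemma card_minority (h : P.Valid) :
    ((Finset.univ.filter fun i => P.spur i ≠ P.maj (P.label i)).card : ℝ) =
      P.minoritySize 1 + P.minoritySize (-1) := by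
  have h1 := P.sum_eq_parts fun _ => (1 : ℝ)
  simp only [Finset.sum_const, nsmul_eq_mul, mul_one, Finset.card_univ, Fintype.card_fin] at h1
  have h2 : ∀ c, ((P.group c (P.maj c)).card : ℝ) + P.minoritySize c = P.n / 2 := fun c => by
    rw [← P.classSize_eq_half h c]; exact_mod_cast P.card_group_maj_add c
  linarith [h2 1, h2 (-1)]

end Problem

/-- Adding a constant vector cannot lower the sum of squares below the centred one. The bound
follows by completing the square in `u`, and so does not involve the size of the signal. -/
lemma sum_norm_sq_le_of_const_add {E : Type*} [NormedAddCommGroup E] [InnerProductSpace ℝ E]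
    {ι : Type*} (I : Finset ι) (hI : 0 < I.card) (u : E) (ξ : ι → E) :
    ∑ i ∈ I, ‖ξ i‖ ^ 2 ≤ ∑ i ∈ I, ‖u + ξ i‖ ^ 2 + ‖∑ i ∈ I, ξ i‖ ^ 2 / I.card := by
  have hI' : (0 : ℝ) < I.card := by exact_mod_cast hI
  set s := ∑ i ∈ I, ξ i with hs
  have h1 : ∑ i ∈ I, ‖u + ξ i‖ ^ 2 = I.card * ‖u‖ ^ 2 + 2 * inner ℝ u s + ∑ i ∈ I, ‖ξ i‖ ^ 2 := by
    simp only [norm_add_sq_real, Finset.sum_add_distrib, Finset.sum_const, nsmul_eq_mul,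
      ← Finset.mul_sum, hs, inner_sum]
  have h2 : 0 ≤ ‖(I.card : ℝ) • u + s‖ ^ 2 / I.card := by positivity
  have h3 : ‖(I.card : ℝ) • u + s‖ ^ 2 / I.card =
      I.card * ‖u‖ ^ 2 + 2 * inner ℝ u s + ‖s‖ ^ 2 / I.card := by
    rw [norm_add_sq_real, norm_smul, inner_smul_left, Real.norm_of_nonneg hI'.le]
    simp
    field_simp
  linarith

/-! ### Deterministic consequences of noise concentration -/

section Deterministic

variable {P : Problem} {ω : P.Sample} {B : ℝ}

/-- The trace of the noise covariance is not bounded by assumption; it is read off from the input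
norms. The noise has total squared length close to |I| times the trace, while the inputs have
squared norm at most 2d and the signal is constant on the group. As the concentration errors are
relative to the trace, they can be absorbed. -/
lemma Problem.NoiseRegular.trace_le (hN : P.NoiseRegular B ω.1) (hV : P.Valid) (hB : 0 < B)
    (hn : 0 < P.n) (hBn : B * (256 * (1 + gaussFour)) ≤ P.n)
    (hx : ∀ i, ‖P.input ω i‖ ^ 2 ≤ 2 * P.d) (hmin : (P.minoritySize 1 : ℝ) ≤ P.n / 4) :
    P.noiseCov.trace ≤ 16 * P.d := by
  have hn' : (0 : ℝ) < P.n := by exact_mod_cast hn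
  have hg := gaussFour_nonneg
  set τ := P.noiseCov.trace with hτ
  have hτ0 : 0 ≤ τ := hV.noise_psd.trace_nonneg
  set I := P.group 1 (P.maj 1) with hI
  have hc : (I.card : ℝ) + P.minoritySize 1 = P.n / 2 := by
    rw [← P.classSize_eq_half hV 1]; exact_mod_cast P.card_group_maj_add 1
  have hc1 : (P.n : ℝ) / 4 ≤ I.card := by linarith
  have hc2 : (I.card : ℝ) ≤ P.n := by
    have : (0 : ℝ) ≤ P.minoritySize 1 := by positivity
    linarith
  have hI0 : (0 : ℝ) < I.card := by linarith
  have h1 := sum_norm_sq_le_of_const_add I (by exact_mod_cast hI0)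
    (P.core 1 + P.spurious (P.maj 1)) ω.1
  have h2 : ∑ i ∈ I, ‖P.core 1 + P.spurious (P.maj 1) + ω.1 i‖ ^ 2 ≤ 2 * P.d * P.n := by
    calc _ = ∑ i ∈ I, ‖P.input ω i‖ ^ 2 := by
          refine Finset.sum_congr rfl fun i hi => ?_
          obtain ⟨e1, e2⟩ := (Finset.mem_filter.1 hi).2
          rw [Problem.input, e1, e2]
      _ ≤ ∑ i ∈ I, (2 * P.d : ℝ) := Finset.sum_le_sum fun i _ => hx i
      _ = I.card * (2 * P.d) := by simp
      _ ≤ P.n * (2 * P.d) := by gcongr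
      _ = _ := by ring
  have h3 : ‖∑ i ∈ I, ω.1 i‖ ^ 2 / I.card ≤ P.n / 64 * τ := by
    calc ‖∑ i ∈ I, ω.1 i‖ ^ 2 / I.card ≤ B * (P.n * τ) / (P.n / 4) := by gcongr; exact hN.sum 1
      _ = 4 * B * τ := by field_simp
      _ ≤ P.n / 64 * τ := by gcongr; nlinarith
  have h4 : P.n / 4 * τ - P.n / 16 * τ ≤ ∑ i ∈ I, ‖ω.1 i‖ ^ 2 := by
    have e1 : (∑ i ∈ I, (‖ω.1 i‖ ^ 2 - τ)) ^ 2 ≤ (P.n / 16 * τ) ^ 2 := by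
      refine hN.normSq.trans ?_
      have : B * gaussFour ≤ P.n / 256 := by nlinarith
      calc B * (P.n * (gaussFour * τ ^ 2)) = (B * gaussFour) * (P.n * τ ^ 2) := by ring
        _ ≤ P.n / 256 * (P.n * τ ^ 2) := by gcongr
        _ = _ := by ring
    have e2 := (abs_le.1 (abs_le_of_sq_le_sq e1 (by positivity))).1
    rw [Finset.sum_sub_distrib, Finset.sum_const, nsmul_eq_mul] at e2
    have e3 : P.n / 4 * τ ≤ I.card * τ := by gcongr
    linarith
  have h5 : P.n * τ ≤ P.n * (16 * P.d) := by nlinarith [mul_nonneg hn'.le hτ0]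
  exact le_of_mul_le_mul_left h5 hn'

/-- Regular inputs and noise make the sample regular. -/
theorem Problem.NoiseRegular.regular {K c₀ δ μ : ℝ} (hN : P.NoiseRegular B ω.1) (hV : P.Valid)
    (hω : P.InputRegular K c₀ ω) (hK : 0 ≤ K) (hB : 0 < B) (hn : 0 < P.n)
    (hBn : B * (256 * (1 + gaussFour)) ≤ P.n) (hx : ∀ i, ‖P.input ω i‖ ^ 2 ≤ 2 * P.d)
    (hmin : ∀ c, (P.minoritySize c : ℝ) ≤ μ * P.n) (hμ : μ ≤ 1 / 4) (hδ : 0 ≤ δ)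
    (hBδ : B * (16 * (1 + gaussFour) * P.d) ≤ δ ^ 2 * P.n) :
    (P.featureSample ω).Regular K c₀ (δ + 2 * μ) := by
  have hn' : (0 : ℝ) < P.n := by exact_mod_cast hn
  have hg := gaussFour_nonneg
  have hμ0 : 0 ≤ μ := by
    have h1 : 0 ≤ μ * P.n := le_trans (by positivity) (hmin 1)
    exact nonneg_of_mul_nonneg_left h1 hn'
  have hτ := hN.trace_le hV hB hn hBn hx ((hmin 1).trans (by nlinarith))
  have hτ0 : 0 ≤ P.noiseCov.trace := hV.noise_psd.trace_nonneg
  have hcard : ∀ c, ((P.group c (P.maj c)).card : ℝ) + P.minoritySize c = P.n / 2 := fun c => by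
    rw [← P.classSize_eq_half hV c]; exact_mod_cast P.card_group_maj_add c
  have hup := sum_inner_sq_le_of_norm_featGrad_le (by positivity)
    (norm_featGrad_sq_le_of_opNorm hω.2.2.1)
  have hcov : ∀ o c j, ‖∑ i ∈ P.part o, (inner ℝ (P.mainFeature c j) (ω.1 i) • ω.1 i -
      featureStd P.noiseCov (P.mainFeature c j) ^ 2 • P.mainFeature c j)‖ ≤
      (δ + 2 * μ) * P.n * (featureStd P.noiseCov (P.mainFeature c j) * ‖P.mainFeature c j‖) := by
    intro o c j
    have hσ : 0 ≤ featureStd P.noiseCov (P.mainFeature c j) := by unfold featureStd; positivity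
    have h1 := hN.cov o c j
    rw [Problem.featureStd_sq_mul hV.noise_psd (hV.mainFeature_ne_zero c j)] at h1
    -- The eigenvector assumption turns the population covariance vector into σ²v.
    rw [hV.mainFeature_eigen c j, WithLp.toLp_smul, WithLp.toLp_ofLp] at h1
    set s := featureStd P.noiseCov (P.mainFeature c j) * ‖P.mainFeature c j‖ with hs
    have hs0 : 0 ≤ s := by positivity
    have h2 : B * (P.n * (gaussFour * (P.noiseCov.trace * s ^ 2))) ≤ (δ * P.n * s) ^ 2 := by
      calc _ ≤ B * (P.n * ((1 + gaussFour) * (16 * P.d * s ^ 2))) := by gcongr; linarith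
        _ = (B * (16 * (1 + gaussFour) * P.d)) * (P.n * s ^ 2) := by ring
        _ ≤ (δ ^ 2 * P.n) * (P.n * s ^ 2) := by gcongr
        _ = _ := by ring
    refine ((le_abs_self _).trans (abs_le_of_sq_le_sq (h1.trans h2) (by positivity))).trans ?_
    gcongr
    linarith
  refine
    { n_pos := hn
      orthogonal := fun c j c' j' hne => ?_
      v_ne := hV.mainFeature_ne_zero
      σ_nonneg := fun c j => ?_
      nsr_eq := hV.nsr_mainFeature
      x_maj := fun c i hi => ?_
      y_maj := fun c i hi => ?_
      y_sq := P.y_sq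
      x_min := fun i _ c j => ?_
      sum_eq := P.sum_eq_parts
      card_le := fun c => ?_
      card_ge := fun c => ?_
      card_J := ?_
      noise_sum := fun c => ?_
      noise_cov := fun c c' j => hcov (some c') c j
      noise_cov_J := fun c j => hcov none c j
      upper := hup
      lower := lower_of_posSemidef hn hω.2.2.2 }
  · simp only [Problem.featureSample, Problem.mainFeature_eq]
    exact hV.orthogonal (hV.mainIndex_ne hne)
  · simp only [Problem.featureSample, featureStd]; positivity
  · obtain ⟨e1, e2⟩ := (Finset.mem_filter.1 hi).2
    simp [Problem.featureSample, Problem.input, e1, e2, Problem.mainFeature]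
  · simp [Problem.featureSample, Problem.y, (Finset.mem_filter.1 hi).2.1]
  · simp only [Problem.featureSample, Problem.mainFeature_eq, Problem.input, inner_add_right]
    have h1 : inner ℝ (P.feature (P.mainIndex c j)) (P.core (P.label i)) =
        if P.mainIndex c j = Sum.inl (P.label i) then ‖P.feature (P.mainIndex c j)‖ ^ 2 else 0 :=
      hV.inner_feature _ (Sum.inl (P.label i))
    have h2 : inner ℝ (P.feature (P.mainIndex c j)) (P.spurious (P.spur i)) =
        if P.mainIndex c j = Sum.inr (P.spur i) then ‖P.feature (P.mainIndex c j)‖ ^ 2 else 0 :=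
      hV.inner_feature _ (Sum.inr (P.spur i))
    rw [h1, h2]
    -- Features are orthogonal, so a main feature either occurs once in the example, as its core or
    -- as its spurious part, or not at all; the coefficient is 1 or 0.
    by_cases e1 : P.mainIndex c j = Sum.inl (P.label i)
    · exact ⟨1, zero_le_one, le_rfl, by simp [e1]⟩
    by_cases e2 : P.mainIndex c j = Sum.inr (P.spur i)
    · exact ⟨1, zero_le_one, le_rfl, by simp [e2]⟩
    · exact ⟨0, le_rfl, zero_le_one, by simp [e1, e2]⟩
  · have := hcard c
    have h0 : (0 : ℝ) ≤ P.minoritySize c := by positivity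
    show ((P.group c (P.maj c)).card : ℝ) ≤ P.n / 2
    linarith
  · have := hcard c
    have h0 := hmin c
    have : 0 ≤ (δ + μ) * P.n := by positivity
    show (P.n : ℝ) / 2 - (δ + 2 * μ) * P.n ≤ ((P.group c (P.maj c)).card : ℝ)
    linarith
  · have h0 := P.card_minority hV
    have : 0 ≤ δ * P.n := by positivity
    show ((Finset.univ.filter fun i => P.spur i ≠ P.maj (P.label i)).card : ℝ) ≤ (δ + 2 * μ) * P.n
    linarith [hmin 1, hmin (-1)]
  · have h2 : B * (P.n * P.noiseCov.trace) ≤ (δ * P.n) ^ 2 := by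
      calc _ ≤ B * (P.n * (16 * P.d)) := by gcongr
        _ = (B * (16 * 1 * P.d)) * P.n := by ring
        _ ≤ (B * (16 * (1 + gaussFour) * P.d)) * P.n := by gcongr; linarith
        _ ≤ (δ ^ 2 * P.n) * P.n := by gcongr
        _ = _ := by ring
    refine ((le_abs_self _).trans (abs_le_of_sq_le_sq ((hN.sum c).trans h2) (by positivity))).trans ?_
    show δ * P.n ≤ (δ + 2 * μ) * P.n
    gcongr
    linarith

end Deterministic

lemma withHighProbability_noiseRegular {P : ℕ → Problem} (hV : ∀ k, (P k).Valid) {B : ℕ → ℝ}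
    (hB : Tendsto B atTop atTop) :
    WithHighProbability P fun k ω => (P k).NoiseRegular (B k) ω.1 := by
  have h1 : WithHighProbability P fun k ω => ∀ c, ‖∑ i ∈ (P k).group c ((P k).maj c), ω.1 i‖ ^ 2 ≤
      B k * ((P k).n * (P k).noiseCov.trace) :=
    .all fun c => .of_noise hB fun k hk => noise_sum_concentration (hV k).noise_psd _ hk
  have h2 : WithHighProbability P fun k ω => ∀ o c j, ‖∑ i ∈ (P k).part o,
      (inner ℝ ((P k).mainFeature c j) (ω.1 i) • ω.1 i -
      WithLp.toLp 2 ((P k).noiseCov *ᵥ ((P k).mainFeature c j).ofLp))‖ ^ 2 ≤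
      B k * ((P k).n * (gaussFour * ((P k).noiseCov.trace *
        (((P k).mainFeature c j).ofLp ⬝ᵥ ((P k).noiseCov *ᵥ ((P k).mainFeature c j).ofLp))))) :=
    .all fun o => .all fun c => .all fun j => .of_noise hB fun k hk =>
      noise_cov_concentration (hV k).noise_psd _ _ hk
  have h3 : WithHighProbability P fun k ω =>
      (∑ i ∈ (P k).group 1 ((P k).maj 1), (‖ω.1 i‖ ^ 2 - (P k).noiseCov.trace)) ^ 2 ≤
      B k * ((P k).n * (gaussFour * (P k).noiseCov.trace ^ 2)) :=
    .of_noise hB fun k hk => noise_normSq_concentration (hV k).noise_psd _ hk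
  exact (h1.and (h2.and h3)).mono (Eventually.of_forall fun k ω hω => ⟨hω.1, hω.2.1, hω.2.2⟩)

/-! ### The trained network on the main features -/

section Regime

variable {φ : ℝ → ℝ} {c₀ κ a α γ K : ℝ} {P : ℕ → Problem}

/-- The limit of the predictions on the core feature (`j = 0`) and on the majority spurious feature
(`j = 1`) of a class, up to the sign of the class. -/
def Problem.limitOut (P : Problem) (j : Fin 2) : ℝ :=
  (nsr P.noiseCov (P.mainFeature 1 j) ^ 2)⁻¹ /
    (2 + (nsr P.noiseCov (P.mainFeature 1 0) ^ 2)⁻¹ + (nsr P.noiseCov (P.mainFeature 1 1) ^ 2)⁻¹)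

lemma Regime.eventually_normSq_le (h : Regime φ c₀ κ a α γ K P) (hα : 0 < α) (hK : 0 < K) :
    ∀ᶠ k in atTop, ∀ ω, (P k).InputRegular K c₀ ω →
      ∀ i, ‖(P k).input ω i‖ ^ 2 ≤ 2 * (P k).d := by
  filter_upwards [h.eventually_log_n_le hα hK, h.tendsto_d.eventually_gt_atTop 0,
    h.tendsto_d.eventually (eventually_sqrt_log_div_le (K * √(|Real.log K| + K))
      (show (0 : ℝ) < 1 / 2 by norm_num))] with k h1 h2 h3 ω hω i
  rw [neg_zero, Real.rpow_zero, mul_assoc, ← Real.sqrt_mul (by positivity), ← mul_div_assoc] at h3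
  have h4 : |‖(P k).input ω i‖ ^ 2 / (P k).d - 1| ≤ 1 :=
    ((hω.1 i).trans (by gcongr)).trans h3
  have h5 := (abs_le.1 h4).2
  rw [sub_le_iff_le_add, div_le_iff₀ h2] at h5
  linarith

lemma Regime.tendsto_n_rpow (h : Regime φ c₀ κ a α γ K P) (hα : 0 < α) (hK : 0 < K) (hγ : 0 < γ) :
    Tendsto (fun k => ((P k).n : ℝ) ^ (-γ)) atTop (𝓝 0) :=
  (tendsto_rpow_neg_atTop hγ).comp (h.tendsto_n hα hK)

/-- Noise concentration holds up to the factor d^(α/2). Since n is at least of order d^(1+α), the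
relative squared error is of order d^(α/2) · d/n, at most d^(-α/2) up to constants, below d^(-2β)
when 4β < α. The minority groups of the two classes add 2Kn^(-γ). -/
lemma Regime.eventually_regular (h : Regime φ c₀ κ a α γ K P) (hα : 0 < α) (hK : 0 < K)
    (hγ : 0 < γ) {β : ℝ} (hβ : 4 * β < α) :
    ∀ᶠ k in atTop, ∀ ω, (P k).InputRegular K c₀ ω →
      (P k).NoiseRegular (((P k).d : ℝ) ^ (α / 2)) ω.1 →
      ((P k).featureSample ω).Regular K c₀
        (((P k).d : ℝ) ^ (-β) + 2 * (K * ((P k).n : ℝ) ^ (-γ))) := by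
  have hg := gaussFour_nonneg
  have hμ := (h.tendsto_n_rpow hα hK hγ).const_mul K
  rw [mul_zero] at hμ
  filter_upwards [h.eventually_normSq_le hα hK, (h.tendsto_n hα hK).eventually_gt_atTop 0,
    h.tendsto_d.eventually_gt_atTop 0, hμ.eventually (gt_mem_nhds (show (0 : ℝ) < 1 / 4 by norm_num)),
    h.tendsto_d.eventually (eventually_rpow_le (256 * (1 + gaussFour) * K)
      (show 0 < 1 + α / 2 by linarith)),
    h.tendsto_d.eventually (eventually_rpow_le (16 * (1 + gaussFour) * K)
      (show 2 * β < α / 2 by linarith))] with k hx hn hd hμ f1 f2 ω hω hN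
  have hKn := h.n_ge k
  have hd1 : ((P k).d : ℝ) ^ (1 + α) * ((P k).d : ℝ) ^ (-(1 + α / 2)) = ((P k).d : ℝ) ^ (α / 2) := by
    rw [← Real.rpow_add hd]; ring_nf
  have hd2 : ((P k).d : ℝ) ^ (1 + α) * ((P k).d : ℝ) ^ (-(α / 2)) =
      ((P k).d : ℝ) ^ (α / 2) * (P k).d := by
    rw [← Real.rpow_add hd, ← Real.rpow_add_one hd.ne']; ring_nf
  rw [neg_zero, Real.rpow_zero] at f1
  refine hN.regular (h.valid k) hω hK.le (by positivity) (by exact_mod_cast hn) ?_ (hx ω hω) ?_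
    hμ.le (by positivity) ?_
  · have e : K * (((P k).d : ℝ) ^ (α / 2) * (256 * (1 + gaussFour))) ≤ K * (P k).n := by
      calc _ = ((P k).d : ℝ) ^ (1 + α) *
            (256 * (1 + gaussFour) * K * ((P k).d : ℝ) ^ (-(1 + α / 2))) := by rw [← hd1]; ring
        _ ≤ ((P k).d : ℝ) ^ (1 + α) * 1 := by gcongr
        _ ≤ _ := by rwa [mul_one]
    exact le_of_mul_le_mul_left e hK
  · intro c
    refine (h.minority k c).trans (le_of_eq ?_)
    rw [mul_assoc, ← Real.rpow_add_one hn.ne']; ring_nf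
  · have e : K * (((P k).d : ℝ) ^ (α / 2) * (16 * (1 + gaussFour) * (P k).d)) ≤
        K * ((((P k).d : ℝ) ^ (-β)) ^ 2 * (P k).n) := by
      calc _ = ((P k).d : ℝ) ^ (1 + α) *
            (16 * (1 + gaussFour) * K * ((P k).d : ℝ) ^ (-(α / 2))) := by
            linear_combination (-16 * (1 + gaussFour) * K) * hd2
        _ ≤ (K * (P k).n) * ((P k).d : ℝ) ^ (-(2 * β)) := by gcongr
        _ = _ := by
            have : ((P k).d : ℝ) ^ (-(2 * β)) = (((P k).d : ℝ) ^ (-β)) ^ 2 := by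
              rw [← Real.rpow_mul_natCast hd.le]; ring_nf
            rw [this]; ring
    exact le_of_mul_le_mul_left e hK

/-- At time T the simplicity-bias error is at most Kκ log d · d^(-aα), and the logarithm is absorbed
since β < aα. -/
lemma Regime.eventually_net_close (h : Regime φ c₀ κ a α γ K P) (hκ : 0 < κ) (hK : 0 < K)
    {β : ℝ} (hβ : β < a * α) :
    ∀ᶠ k in atTop, ∀ ω, (P k).SimplicityBias φ κ a α K ω → ∀ c j,
      |(P k).lin φ ω ((P k).time κ) ((P k).mainFeature c j) -
        (P k).net φ ω ((P k).time κ) ((P k).mainFeature c j)| ≤ ((P k).d : ℝ) ^ (-β) := by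
  filter_upwards [h.tendsto_d.eventually_ge_atTop 1,
    h.tendsto_d.eventually (eventually_log_pow_mul_rpow_le (K * κ) 1 hβ)] with k hd f ω hω c j
  have hd0 : (0 : ℝ) < (P k).d := by linarith
  obtain ⟨h1, -, h2⟩ := h.step_mul_time_le hκ (k := k) (by exact_mod_cast hd)
  have h3 := hω _ h2 c
  have h4 : K * ((P k).η * (P k).time κ / ((P k).d : ℝ) ^ (1 + a * α)) ≤ ((P k).d : ℝ) ^ (-β) := by
    refine le_trans ?_ f
    calc _ ≤ K * (κ * ((P k).d * Real.log (P k).d) / ((P k).d : ℝ) ^ (1 + a * α)) := by gcongr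
      _ = _ := by
        rw [Real.rpow_add hd0, Real.rpow_one, Real.rpow_neg hd0.le, pow_one]; field_simp
  fin_cases j
  · exact h3.1.trans h4
  · exact h3.2.trans h4

/-- A bound for all quantities of the regression problem. -/
def sizeBound (c₀ K : ℝ) : ℝ :=
  16 / c₀ * (8 * K + 4 * √K + 2) ^ 2 + (8 * K + 4 * √K + 2) + 24 * (1 + K / c₀) + 13 / c₀

/-- The constant of the error of the trained network. -/
def errConst (φ : ℝ → ℝ) (c₀ K : ℝ) : ℝ :=
  (1 + normConst φ * (1000 * sizeBound c₀ K ^ 5 + 1) * (1 + sizeBound c₀ K) ^ 2 +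
    2000 * sizeBound c₀ K ^ 6) * (1 + 2 * K)

lemma errConst_pos (hc : 0 < c₀) (hK : 0 < K) : 0 < errConst φ c₀ K := by
  have := normConst_pos (φ := φ)
  have : 0 < sizeBound c₀ K := by unfold sizeBound; positivity
  unfold errConst
  positivity

/-- The outputs of the trained network on the main features. -/
theorem Regime.net_mainFeature (h : Regime φ c₀ κ a α γ K P) (hα : 0 < α) (hK : 0 < K)
    (hγ : 0 < γ) (hc : 0 < c₀) (hκ : 0 < κ) (hζ : zeta φ ≠ 0)
    (hθ : theta0 φ ≠ 0 ∨ theta1 φ = 0 ∧ theta2 φ = 0) {β : ℝ} (hβ : 0 < β) (hβ1 : β < 1 / 4)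
    (hβ2 : β < c₀ * zeta φ ^ 2 * κ / 16) (hβ3 : 4 * β < α) (hβ4 : β < a * α) :
    WithHighProbability P fun k ω => ∀ c j, 0 < nsr (P k).noiseCov ((P k).mainFeature c j) ∧
      |(P k).net φ ω ((P k).time κ) ((P k).mainFeature c j) - ((c : ℤ) : ℝ) * (P k).limitOut j| ≤
        errConst φ c₀ K * (((P k).n : ℝ) ^ (-γ) + ((P k).d : ℝ) ^ (-β)) := by
  -- The noise events fail with probability at most d^(-α/2) each, up to a fixed number of events.
  have hB : Tendsto (fun k => ((P k).d : ℝ) ^ (α / 2)) atTop atTop :=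
    (tendsto_rpow_atTop (by linarith)).comp h.tendsto_d
  refine ((h.input.and h.simplicity).and (withHighProbability_noiseRegular h.valid hB)).mono ?_
  have hε0 : Tendsto (fun k => ((P k).d : ℝ) ^ (-β) + 2 * (K * ((P k).n : ℝ) ^ (-γ))) atTop
      (𝓝 0) := by
    have := ((tendsto_rpow_neg_atTop hβ).comp h.tendsto_d).add
      (((h.tendsto_n_rpow hα hK hγ).const_mul K).const_mul 2)
    simpa using this
  have hsmall : ∀ C c : ℝ, 0 < c → ∀ᶠ k in atTop,
      C * (((P k).d : ℝ) ^ (-β) + 2 * (K * ((P k).n : ℝ) ^ (-γ))) ≤ c := fun C c hc => by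
    have := hε0.const_mul C
    rw [mul_zero] at this
    exact (this.eventually (gt_mem_nhds hc)).mono fun _ h => le_of_lt h
  filter_upwards [h.eventually_regular hα hK hγ hβ3, h.eventually_net_close hκ hK hβ4,
    h.eventually_linear_predictor hα hK hc hκ hζ hθ hβ hβ1 hβ2, hsmall 1 (1 / 16) (by norm_num),
    hsmall (24 * (1 + K / c₀)) 1 one_pos, hsmall (48 * (8 * K + 4 * √K + 2) ^ 2) c₀ hc]
    with k hreg hnet hlin hε1 hε2 hε3 ω ⟨⟨hI, hS⟩, hN⟩ c j
  have hR := hreg ω hI hN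
  obtain ⟨w, b, e, r, r1, r2, r3, r4, r5, r6⟩ := hlin ω hI
  have hn := h.n_ge k
  set δ := ((P k).d : ℝ) ^ (-β) with hδ
  set μ := ((P k).n : ℝ) ^ (-γ) with hμ
  have hδ0 : 0 ≤ δ := by positivity
  have hμ0 : 0 ≤ μ := by positivity
  set ε := δ + 2 * (K * μ) with hε
  have hδε : δ ≤ ε := by have : 0 ≤ 2 * (K * μ) := by positivity
                         linarith
  have hε0 : 0 ≤ ε := hδ0.trans hδε
  have hr : ((P k).featureSample ω).NearCritical ε w b e r :=
    ⟨r1, r2, r3.trans (by gcongr), r4.imp_right fun h => h.trans (by gcongr),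
      fun i => (r5 i).trans (by gcongr)⟩
  have hb : ((P k).featureSample ω).BoundedBy K (sizeBound c₀ K) w b :=
    hR.boundedBy hc hK.le hr (by linarith) (by
      have : ε ^ 2 ≤ ε := by nlinarith
      calc ε ^ 2 * (24 * (1 + K / c₀)) ≤ ε * (24 * (1 + K / c₀)) := by gcongr
        _ ≤ 1 := by linarith) hε3
  obtain ⟨p1, p2⟩ := hR.predictor_on_features hr hb (by linarith)
    (R := fun j => nsr (P k).noiseCov ((P k).mainFeature 1 j))
    (fun c j => (h.valid k).nsr_mainFeature 1 c j)
  have hM := hb.one_le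
  have hv : ‖(P k).mainFeature c j‖ ≤ sizeBound c₀ K := hb.v_le c j
  have hσ := hb.inv_σ c j
  have hnc := normConst_pos (φ := φ)
  set M := sizeBound c₀ K with hMdef
  constructor
  · have h1 : 0 ≤ featureStd (P k).noiseCov ((P k).mainFeature c j) := hR.σ_nonneg c j
    have h2 : featureStd (P k).noiseCov ((P k).mainFeature c j) ≠ 0 := by
      intro h0
      have hσ' : 1 ≤ M * featureStd (P k).noiseCov ((P k).mainFeature c j) ^ 2 := hσ
      rw [h0] at hσ'
      norm_num at hσ'
    have h3 := norm_pos_iff.2 ((h.valid k).mainFeature_ne_zero c j)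
    unfold nsr
    positivity
  · have h1 := hnet ω hS c j
    have h2 := r6 ((P k).mainFeature c j)
    have h3 : |inner ℝ w ((P k).mainFeature c j) - ((c : ℤ) : ℝ) * (P k).limitOut j| ≤
      2000 * M ^ 6 * ε := p2 c j
    have h4 : normConst φ * (|b| + δ) * (1 + ‖(P k).mainFeature c j‖) ^ 2 ≤
        normConst φ * (1000 * M ^ 5 + 1) * (1 + M) ^ 2 * ε := by
      calc _ ≤ normConst φ * (1000 * M ^ 5 * ε + ε) * (1 + M) ^ 2 := by gcongr
        _ = _ := by ring
    have h5 : ε ≤ (1 + 2 * K) * (μ + δ) := by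
      have := mul_nonneg hK.le hδ0
      linarith
    -- Three errors: network against linear model, linear model against ⟨w, v⟩, and ⟨w, v⟩ against
    -- its limit. The second is small because |b| is of order ε.
    calc |(P k).net φ ω ((P k).time κ) ((P k).mainFeature c j) - ((c : ℤ) : ℝ) * (P k).limitOut j|
        = |-((P k).lin φ ω ((P k).time κ) ((P k).mainFeature c j) -
            (P k).net φ ω ((P k).time κ) ((P k).mainFeature c j)) +
          ((P k).lin φ ω ((P k).time κ) ((P k).mainFeature c j) -
            inner ℝ w ((P k).mainFeature c j)) +
          (inner ℝ w ((P k).mainFeature c j) - ((c : ℤ) : ℝ) * (P k).limitOut j)| := by ring_nf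
      _ ≤ _ := abs_add_three _ _ _
      _ ≤ ε + normConst φ * (1000 * M ^ 5 + 1) * (1 + M) ^ 2 * ε + 2000 * M ^ 6 * ε := by
          rw [abs_neg]
          linarith
      _ = (1 + normConst φ * (1000 * M ^ 5 + 1) * (1 + M) ^ 2 + 2000 * M ^ 6) * ε := by ring
      _ ≤ (1 + normConst φ * (1000 * M ^ 5 + 1) * (1 + M) ^ 2 + 2000 * M ^ 6) *
          ((1 + 2 * K) * (μ + δ)) := by gcongr
      _ = _ := by rw [errConst, ← hMdef]; ring

end Regime

/-! ### Elementary bounds on the limiting outputs -/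

section LimitOut

/-- After clearing denominators the quotient is R_s²/(2R_c²R_s² + R_s² + R_c²). The denominator is
at least R_sR_c, so the quotient is even at most R_s/R_c. -/
lemma inv_sq_div_le {Rc Rs : ℝ} (hc : 0 < Rc) (hs : 0 < Rs) :
    (Rc ^ 2)⁻¹ / (2 + (Rc ^ 2)⁻¹ + (Rs ^ 2)⁻¹) ≤ √2 * Rs / Rc := by
  have h2 : 1 ≤ √2 := Real.one_le_sqrt.2 (by norm_num)
  have h : (Rc ^ 2)⁻¹ / (2 + (Rc ^ 2)⁻¹ + (Rs ^ 2)⁻¹) = Rs ^ 2 / (2 * Rc ^ 2 * Rs ^ 2 + Rs ^ 2 + Rc ^ 2) := by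
    field_simp
  rw [h, div_le_div_iff₀ (by positivity) hc]
  have h3 : Rs * Rc ≤ 2 * Rc ^ 2 * Rs ^ 2 + Rs ^ 2 + Rc ^ 2 := by
    nlinarith [sq_nonneg (Rs - Rc), sq_nonneg (Rc * Rs), mul_pos hs hc]
  calc Rs ^ 2 * Rc = 1 * Rs * (Rs * Rc) := by ring
    _ ≤ √2 * Rs * (2 * Rc ^ 2 * Rs ^ 2 + Rs ^ 2 + Rc ^ 2) := by gcongr

lemma core_limit_le {Rc Rs ρ : ℝ} (hc : 0 < Rc) (hs : 0 < Rs) (h : Rs ≤ ρ * Rc) :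
    (Rc ^ 2)⁻¹ / (2 + (Rc ^ 2)⁻¹ + (Rs ^ 2)⁻¹) ≤ ρ ^ 2 := by
  have h' : (Rc ^ 2)⁻¹ / (2 + (Rc ^ 2)⁻¹ + (Rs ^ 2)⁻¹) = Rs ^ 2 / (2 * Rc ^ 2 * Rs ^ 2 + Rs ^ 2 + Rc ^ 2) := by
    field_simp
  rw [h', div_le_iff₀ (by positivity)]
  have h1 : Rs ^ 2 ≤ (ρ * Rc) ^ 2 := by gcongr
  have h2 : 0 ≤ ρ ^ 2 * (2 * Rc ^ 2 * Rs ^ 2 + Rs ^ 2) := by positivity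
  linarith

/-- In units of R_c² the denominator is at most 1/2 + 1/4 + 1 = 7/4 when R_s is at most half of both
R_c and 1. -/
lemma le_spurious_limit {Rc Rs ρ : ℝ} (hc : 0 < Rc) (hs : 0 < Rs) (hρ : ρ ≤ 1 / 2)
    (h : Rs ≤ ρ * Rc) (h1 : Rs ≤ ρ) :
    4 / 7 ≤ (Rs ^ 2)⁻¹ / (2 + (Rc ^ 2)⁻¹ + (Rs ^ 2)⁻¹) := by
  have h' : (Rs ^ 2)⁻¹ / (2 + (Rc ^ 2)⁻¹ + (Rs ^ 2)⁻¹) = Rc ^ 2 / (2 * Rc ^ 2 * Rs ^ 2 + Rs ^ 2 + Rc ^ 2) := by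
    field_simp
  rw [h', div_le_div_iff₀ (by norm_num) (by positivity)]
  have h2 : Rs ≤ 1 / 2 * Rc := h.trans (by gcongr)
  have h3 : Rs ^ 2 ≤ (1 / 2 * Rc) ^ 2 := by gcongr
  have h4 : Rs ^ 2 ≤ (1 / 2) ^ 2 := by gcongr; linarith
  have h5 : Rc ^ 2 * Rs ^ 2 ≤ Rc ^ 2 * (1 / 2) ^ 2 := by gcongr
  linarith

end LimitOut

end SpuriousNet

end

/-! ### Choice of exponents and conclusion -/

theorem mainTheorem3 :
    ∃ ρ : ℝ → ℝ, (∀ M, 0 < ρ M) ∧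
      ∀ φ : ℝ → ℝ, SpuriousNet.IsActivation φ → SpuriousNet.zeta φ ≠ 0 →
        (SpuriousNet.theta0 φ ≠ 0 ∨ (SpuriousNet.theta1 φ = 0 ∧ SpuriousNet.theta2 φ = 0)) →
      ∀ c₀ κ a : ℝ, 0 < c₀ → 0 < κ → 0 < a →
      ∃ ν₂ : ℝ, 0 < ν₂ ∧ ∃ b : ℝ, 0 < b ∧
      ∀ α γ K : ℝ, 0 < α → α < 1 / 4 → 0 < γ → 0 < K →
      ∃ C : ℝ, 0 < C ∧
      ∀ P : ℕ → SpuriousNet.Problem, SpuriousNet.Regime φ c₀ κ a α γ K P →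
        SpuriousNet.WithHighProbability P (fun k ω => ∀ c : ℤˣ,
          |(P k).net φ ω ((P k).time ν₂) ((P k).core c)| ≤
            √2 * (P k).Rs c / (P k).Rc c +
              C * (((P k).n : ℝ) ^ (-γ) + ((P k).d : ℝ) ^ (-(b * α)))) ∧
        ∀ M : ℝ, 0 < M → (∀ k c, (P k).Rs c ≤ ρ M * min ((P k).Rc c) 1) →
          SpuriousNet.WithHighProbability P (fun k ω => ∀ c : ℤˣ,
            M * |(P k).net φ ω ((P k).time ν₂) ((P k).core c)| <
              |(P k).net φ ω ((P k).time ν₂) ((P k).spurious ((P k).maj c))|) := by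
  -- With r = 1/(2(1 + M)), the limiting core output is at most r², and M r² ≤ 1/4. The absolute
  -- value only makes the choice positive for every real M.
  refine ⟨fun M => 1 / (2 * (1 + |M|)), fun M => by positivity, ?_⟩
  intro φ _ hζ hθ c₀ κ a hc hκ ha
  have hz : 0 < SpuriousNet.zeta φ ^ 2 := by positivity
  -- The training time is the longest one covered by the simplicity-bias hypothesis. The exponent β
  -- = bα must stay below aα, c₀ζ²κ/16, α/4 and 1/4; as α < 1/4, the three terms of the minimum
  -- leave strict room in each.
  refine ⟨κ, hκ, min (a / 2) (min (c₀ * SpuriousNet.zeta φ ^ 2 * κ / 8) (1 / 8)),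
    by positivity, ?_⟩
  intro α γ K hα hα1 hγ hK
  set b := min (a / 2) (min (c₀ * SpuriousNet.zeta φ ^ 2 * κ / 8) (1 / 8)) with hb
  have hb0 : 0 < b := by positivity
  have hb1 : b ≤ a / 2 := min_le_left _ _
  have hb2 : b ≤ c₀ * SpuriousNet.zeta φ ^ 2 * κ / 8 := (min_le_right _ _).trans (min_le_left _ _)
  have hb3 : b ≤ 1 / 8 := (min_le_right _ _).trans (min_le_right _ _)
  have hβ : 0 < b * α := by positivity
  have hq : 0 < c₀ * SpuriousNet.zeta φ ^ 2 * κ := by positivity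
  refine ⟨SpuriousNet.errConst φ c₀ K, SpuriousNet.errConst_pos hc hK, fun P hP => ?_⟩
  have main := hP.net_mainFeature hα hK hγ hc hκ hζ hθ hβ (by nlinarith) (by nlinarith)
    (by nlinarith) (by nlinarith)
  have hRc : ∀ k c, (P k).Rc c = SpuriousNet.nsr (P k).noiseCov ((P k).mainFeature 1 0) :=
    fun k c => (hP.valid k).nsr_mainFeature c 1 0
  have hRs : ∀ k c, (P k).Rs c = SpuriousNet.nsr (P k).noiseCov ((P k).mainFeature 1 1) :=
    fun k c => (hP.valid k).nsr_mainFeature c 1 1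
  have hnonneg : ∀ k j, 0 ≤ (P k).limitOut j := fun k j => by
    unfold SpuriousNet.Problem.limitOut; positivity
  refine ⟨main.mono (Eventually.of_forall fun k ω hω c => ?_), fun M hM hρ =>
    main.mono ?_⟩
  · have h2 := SpuriousNet.inv_sq_div_le (hω 1 0).1 (hω 1 1).1
    rw [hRc, hRs]
    refine le_trans ?_ (add_le_add_left h2 _)
    have h3 := (hω c 0).2
    have h4 := abs_sub_abs_le_abs_sub ((P k).net φ ω ((P k).time κ) ((P k).mainFeature c 0))
      (((c : ℤ) : ℝ) * (P k).limitOut 0)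
    rw [abs_mul, SpuriousNet.FeatureSample.abs_units_cast, one_mul, abs_of_nonneg (hnonneg k 0)] at h4
    exact (sub_le_iff_le_add'.1 h4).trans (add_le_add_right h3 _)
  · have herr := (((hP.tendsto_n_rpow hα hK hγ).add ((tendsto_rpow_neg_atTop hβ).comp
      hP.tendsto_d)).const_mul (SpuriousNet.errConst φ c₀ K))
    rw [add_zero, mul_zero] at herr
    -- With error E satisfying (1 + M)E < 1/4, M times the core output is at most 1/4 + ME, the
    -- spurious output is at least 4/7 - E, and 1/4 + 1/4 < 4/7.
    filter_upwards [herr.eventually (gt_mem_nhds (show 0 < 1 / (4 * (1 + M)) by positivity))]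
      with k hk ω hω c
    replace hk : SpuriousNet.errConst φ c₀ K *
      (((P k).n : ℝ) ^ (-γ) + ((P k).d : ℝ) ^ (-(b * α))) < 1 / (4 * (1 + M)) := hk
    set E := SpuriousNet.errConst φ c₀ K *
      (((P k).n : ℝ) ^ (-γ) + ((P k).d : ℝ) ^ (-(b * α)))
    have hr := hρ k 1
    simp only [hRc, hRs, abs_of_pos hM] at hr
    have hc0 := (hω 1 0).1
    have hs0 := (hω 1 1).1
    set r := 1 / (2 * (1 + M)) with hrdef
    have hr0 : 0 < r := by positivity
    have hr1 : r ≤ 1 / 2 := by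
      rw [hrdef]; gcongr; linarith
    have e1 := hr.trans (mul_le_mul_of_nonneg_left (min_le_left _ _) hr0.le)
    have e2 := hr.trans (mul_le_mul_of_nonneg_left (min_le_right _ _) hr0.le)
    rw [mul_one] at e2
    have t0 : (P k).limitOut 0 ≤ r ^ 2 := SpuriousNet.core_limit_le hc0 hs0 e1
    have t1 : 4 / 7 ≤ (P k).limitOut 1 := SpuriousNet.le_spurious_limit hc0 hs0 hr1 e1 e2
    have n0 := abs_sub_abs_le_abs_sub ((P k).net φ ω ((P k).time κ) ((P k).mainFeature c 0))
      (((c : ℤ) : ℝ) * (P k).limitOut 0)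
    have n1 := abs_sub_abs_le_abs_sub (((c : ℤ) : ℝ) * (P k).limitOut 1)
      ((P k).net φ ω ((P k).time κ) ((P k).mainFeature c 1))
    rw [abs_mul, SpuriousNet.FeatureSample.abs_units_cast, one_mul, abs_of_nonneg (hnonneg k _)] at n0 n1
    rw [abs_sub_comm (((c : ℤ) : ℝ) * (P k).limitOut 1)] at n1
    have m0 := (hω c 0).2
    have m1 := (hω c 1).2
    show M * |(P k).net φ ω ((P k).time κ) ((P k).mainFeature c 0)| <
      |(P k).net φ ω ((P k).time κ) ((P k).mainFeature c 1)|
    have k0 : |(P k).net φ ω ((P k).time κ) ((P k).mainFeature c 0)| ≤ r ^ 2 + E := by linarith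
    have k1 : 4 / 7 - E ≤ |(P k).net φ ω ((P k).time κ) ((P k).mainFeature c 1)| := by linarith
    have hrM : (1 + M) * r = 1 / 2 := by rw [hrdef]; field_simp
    have hkE : (1 + M) * E < 1 / 4 := by
      have := mul_lt_mul_of_pos_left hk (show 0 < 1 + M by linarith)
      refine this.trans_eq ?_
      field_simp
    have hMr : M * r ^ 2 ≤ 1 / 4 := by nlinarith
    have := mul_le_mul_of_nonneg_left k0 hM.le
    linarith
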